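/- Let $M$ be a smooth $3$-manifold and let $I\subset\mathbb R$ be a nondegenerate interval. For $t\in I$ let $g_t$ be Riemannian metrics on $M$, $U_t$ vector fields with $g_t(U_t,U_t)=1$, and let $f:I\times M\to\mathbb R$ be a nowhere vanishing function, all depending smoothly on $(t,x)\in I\times M$. Let $T=T_t$ be a symmetric covariant $2$-tensor field on $M$, write $\theta=g(U,\cdot)$, $\theta\odot df=\frac12(\theta\otimes df+df\otimes\theta)$, where $df$ is the differential of $f$ along $M$, and define $\hat T$ by $g(\hat T(E),F)=T(E,F)$. Suppose that $$\frac{\partial U}{\partial t}=-f\nabla^g_UU+\mathrm{grad}_g f,\qquad \frac{\partial g}{\partial t}=-2\,\theta\odot df+2T,\qquad \hat T(U)=-\tfrac12\mathrm{grad}_gf+\tfrac12U(f)U .$$ (1) Every integral curve of the vector field $\partial_t+fU$ on $I\times M$ is, up to parametrization, a null geodesic of the space-time metric $\mathcal G=-f^2dt^2+g_t$; that is, its velocity $\dot\gamma$ satisfies $\mathcal G(\dot\gamma,\dot\gamma)=0$ and $\nabla^{\mathcal G}_{\dot\gamma}\dot\gamma=\alpha\,\dot\gamma$ for some function $\alpha$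 of the parameter. (2) Write $R(X,Y)=[\nabla_X,\nabla_Y]-\nabla_{[X,Y]}$ for the curvature, $\mathrm{Ricci}(v,w)=\mathrm{trace}\,(z\mapsto R(z,v)w)$, and $$\mathcal R=-f\,\mathrm{Ricci}^g+\mathrm{sym}\,\mathcal G\big({}^{\mathcal G}R(\partial_t,\cdot)U,\cdot\big),\qquad (\mathrm{sym}\,S)(X,Y)=\tfrac12\big(S(X,Y)+S(Y,X)\big).$$ Suppose in addition that at every point of $I\times M$, for all $Z=X-iY$ with $X,Y,U$ a $g_t$-orthonormal triple and with $\rho=g(\nabla^g_{\bar Z}U,Z)$ (tensors being extended complex-linearly), $$-\tfrac12T(Z,Z)\big(\rho-2U(\ln |f|)\big)+\tfrac1f\,Z(f)^2+\mathcal R(Z,Z)=0 .$$ Suppose that $0\in I$ and that $U_0$ is tangent to a conformal foliation on $(M,g_0)$, i.e. there is a function $a$ with $(\mathcal L_{U_0}g_0)(X,Y)=a\,g_0(X,Y)$ for all $X,Y$ orthogonal to $U_0$. Then for every $t\in I$ with $t\ge0$ the field $U_t$ is tangent to a conformal foliation, with respect to $g_t$, on the set of all $x\in M$ such that $(t,x)$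 lies on an integral curve of $\partial_t+fU$ starting from $\{0\}\times M$. If $M$ is compact, then $U_t$ is tangent to a conformal foliation on all of $(M,g_t)$ for every $t\in I$ with $t\ge 0$. -/

import Mathlib

open Set
open scoped Manifold ContDiff

noncomputable section

namespace SlicedSpacetime

/-- The model space of a 3-manifold. -/
abbrev E3 : Type := EuclideanSpace ℝ (Fin 3)

/-! ### Semi-Riemannian geometry in local coordinates

A metric in local coordinates is a function `G` from a coordinate domain `S ⊆ E` to bilinear forms.
All derivatives are taken within `S`; this is the ordinary derivative when `S` is open, and the
one-sided one at the boundary of `S = J × V` when the time interval `J` contains an endpoint. -/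

section Local

variable {E : Type*} [NormedAddCommGroup E] [NormedSpace ℝ E]

/-- Raising an index: for a nondegenerate form `B` (in finite dimension), `sharp B η` is the vector
`v` with `B v = η`. -/
def sharp (B : E →L[ℝ] E →L[ℝ] ℝ) (η : E →L[ℝ] ℝ) : E := B.inverse η

/-- The Christoffel symbols `Γ(v, w) = v^a w^b Γ^c_{ab}`, where
`Γ^c_{ab} = ½ G^{cd} (∂_a G_{bd} + ∂_b G_{ad} - ∂_d G_{ab})`. -/
def christoffel (G : E → E →L[ℝ] E →L[ℝ] ℝ) (S : Set E) (p v w : E) : E :=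
  sharp (G p) ((1 / 2 : ℝ) •
    (fderivWithin ℝ G S p v w + fderivWithin ℝ G S p w v
      - ((fderivWithin ℝ G S p).flip v).flip w))

/-- The Levi-Civita covariant derivative `∇_v Y` at the point `p`. -/
def covDeriv (G : E → E →L[ℝ] E →L[ℝ] ℝ) (S : Set E) (Y : E → E) (p v : E) : E :=
  fderivWithin ℝ Y S p v + christoffel G S p v (Y p)

/-- The curvature `R(a, b)c`, with the convention
`R(∂_a, ∂_b)∂_c = ∇_{∂_a}∇_{∂_b}∂_c - ∇_{∂_b}∇_{∂_a}∂_c`, that is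
`R^d_{abc} = ∂_a Γ^d_{bc} - ∂_b Γ^d_{ac} + Γ^e_{bc} Γ^d_{ae} - Γ^e_{ac} Γ^d_{be}`. -/
def curvature (G : E → E →L[ℝ] E →L[ℝ] ℝ) (S : Set E) (p a b c : E) : E :=
  fderivWithin ℝ (fun q => christoffel G S q b c) S p a
    - fderivWithin ℝ (fun q => christoffel G S q a c) S p b
    + christoffel G S p a (christoffel G S p b c)
    - christoffel G S p b (christoffel G S p a c)

/-- The metric `𝒢 = -f² dt² + g_t` in coordinates `(t, y)`. -/
def lorentz (f : ℝ → E → ℝ) (g : ℝ → E → E →L[ℝ] E →L[ℝ] ℝ) (p : ℝ × E) :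
    (ℝ × E) →L[ℝ] (ℝ × E) →L[ℝ] ℝ :=
  (-(f p.1 p.2) ^ 2) •
      (ContinuousLinearMap.fst ℝ ℝ E).smulRight (ContinuousLinearMap.fst ℝ ℝ E)
    + (g p.1 p.2).bilinearComp (ContinuousLinearMap.snd ℝ ℝ E) (ContinuousLinearMap.snd ℝ ℝ E)

/-- The complex-bilinear extension of a real bilinear form `B`; a pair `z` stands for the complex
vector `z.1 + i z.2`. -/
def complexify (B : E → E → ℝ) (z w : E × E) : ℂ :=
  ((B z.1 w.1 - B z.2 w.2 : ℝ) : ℂ) + Complex.I * ((B z.1 w.2 + B z.2 w.1 : ℝ) : ℂ)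

/-- The Ricci curvature `Ricci(v, w) = trace (z ↦ R(z, v)w)` of a metric in dimension three. -/
def ricci (G : E3 → E3 →L[ℝ] E3 →L[ℝ] ℝ) (S : Set E3) (p v w : E3) : ℝ :=
  ∑ i : Fin 3, curvature G S p (EuclideanSpace.single i 1) v w i

variable (J : Set ℝ) (V : Set E3) (f : ℝ → E3 → ℝ) (g : ℝ → E3 → E3 →L[ℝ] E3 →L[ℝ] ℝ)
  (U : ℝ → E3 → E3) (T : ℝ → E3 → E3 →L[ℝ] E3 →L[ℝ] ℝ)

/-- The differential at `y` of `f_t`, a function on the slice. -/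
def slicediff (t : ℝ) (y : E3) : E3 →L[ℝ] ℝ := fderivWithin ℝ (f t) V y

/-- The gradient of `f_t` with respect to `g_t`. -/
def slicegrad (t : ℝ) (y : E3) : E3 := sharp (g t y) (slicediff V f t y)

/-- The tensor `𝒢(R^𝒢(∂_t, v)U, w)` on the slices. -/
def mixedCurv (t : ℝ) (y v w : E3) : ℝ :=
  lorentz f g (t, y)
    (curvature (lorentz f g) (J ×ˢ V) (t, y) ((1 : ℝ), (0 : E3)) ((0 : ℝ), v) ((0 : ℝ), U t y))
    ((0 : ℝ), w)

/-- The tensor `ℛ = -f Ricci^g + sym 𝒢(R^𝒢(∂_t, ·)U, ·)` on the slices. -/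
def curvTensor (t : ℝ) (y v w : E3) : ℝ :=
  -(f t y) * ricci (g t) V y v w
    + (1 / 2) * (mixedCurv J V f g U t y v w + mixedCurv J V f g U t y w v)

/-- `ρ = g(∇_{Z̄} U, Z)` for `Z = X - iY`. -/
def rho (t : ℝ) (y X Y : E3) : ℂ :=
  complexify (fun v w => g t y (covDeriv (g t) V (U t) y v) w) (X, Y) (X, -Y)

/-- The quadratic expression
`-½ T(Z,Z) (ρ - 2 U(ln f)) + (1/f) Z(f)² + ℛ(Z,Z)` for `Z = X - iY`, where `U(ln f) = U(f) / f`. -/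
def quadExpr (t : ℝ) (y X Y : E3) : ℂ :=
  -(1 / 2) * complexify (fun v w => T t y v w) (X, -Y) (X, -Y) *
      (rho V g U t y X Y - 2 * ((slicediff V f t y (U t y) / f t y : ℝ) : ℂ))
    + (1 / (f t y : ℂ)) *
      ((slicediff V f t y X : ℂ) - Complex.I * (slicediff V f t y Y : ℂ)) ^ 2
    + complexify (curvTensor J V f g U t y) (X, -Y) (X, -Y)

/-- The evolution equations in a coordinate domain `V`, for `t` in the interval `J`. -/
structure EvolvesLocally : Prop where
  /-- `T` is symmetric. -/
  T_symm : ∀ t ∈ J, ∀ y ∈ V, ∀ v w, T t y v w = T t y w v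
  /-- `T̂(U) = -½ grad f + ½ U(f) U`, where `g(T̂(v), w) = T(v, w)`. -/
  T_U : ∀ t ∈ J, ∀ y ∈ V,
    sharp (g t y) (T t y (U t y)) =
      -(1 / 2 : ℝ) • slicegrad V f g t y + ((1 / 2 : ℝ) * slicediff V f t y (U t y)) • U t y
  /-- `∂U/∂t = -f ∇_U U + grad f`. -/
  evol_U : ∀ t ∈ J, ∀ y ∈ V,
    HasDerivWithinAt (fun s => U s y)
      (-(f t y) • covDeriv (g t) V (U t) y (U t y) + slicegrad V f g t y) J t
  /-- `∂g/∂t = -2 θ ⊙ df + 2T`, where `θ = g(U, ·)` and `2 θ ⊙ df = θ ⊗ df + df ⊗ θ`. -/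
  evol_g : ∀ t ∈ J, ∀ y ∈ V, ∀ v w,
    HasDerivWithinAt (fun s => g s y v w)
      (-(g t y (U t y) v * slicediff V f t y w + slicediff V f t y v * g t y (U t y) w)
        + 2 * T t y v w) J t

/-- The quadratic condition in a coordinate domain `V`: the quadratic expression vanishes for every
`Z = X - iY` such that `X, Y, U` is orthonormal. -/
def QuadLocally : Prop :=
  ∀ t ∈ J, ∀ y ∈ V, ∀ X Y : E3,
    g t y X X = 1 → g t y Y Y = 1 → g t y X Y = 0 → g t y X (U t y) = 0 → g t y Y (U t y) = 0 →
    quadExpr J V f g U T t y X Y = 0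

end Local

/-! ### Fields on a 3-manifold and their coordinate expressions -/

section Manifold

variable {M : Type*} [TopologicalSpace M] [ChartedSpace E3 M]

/-- The coordinate expression, in the chart around `x₀`, of a covariant 2-tensor field. -/
def chartTensor (B : ∀ x : M, TangentSpace (𝓡 3) x →L[ℝ] TangentSpace (𝓡 3) x →L[ℝ] ℝ)
    (x₀ : M) (y : E3) : E3 →L[ℝ] E3 →L[ℝ] ℝ :=
  let A : E3 →L[ℝ] E3 := mfderiv 𝓘(ℝ, E3) (𝓡 3) (extChartAt (𝓡 3) x₀).symm y
  let B' : E3 →L[ℝ] E3 →L[ℝ] ℝ := B ((extChartAt (𝓡 3) x₀).symm y)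
  B'.bilinearComp A A

/-- The coordinate expression, in the chart around `x₀`, of a vector field. -/
def chartVec (X : ∀ x : M, TangentSpace (𝓡 3) x) (x₀ : M) (y : E3) : E3 :=
  mfderiv (𝓡 3) 𝓘(ℝ, E3) (extChartAt (𝓡 3) x₀) ((extChartAt (𝓡 3) x₀).symm y)
    (X ((extChartAt (𝓡 3) x₀).symm y))

/-- The coordinate expression, in the chart around `x₀`, of a function. -/
def chartFun (f : M → ℝ) (x₀ : M) (y : E3) : ℝ := f ((extChartAt (𝓡 3) x₀).symm y)

variable (J : Set ℝ) (f : ℝ → M → ℝ)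
  (g : ℝ → ∀ x : M, TangentSpace (𝓡 3) x →L[ℝ] TangentSpace (𝓡 3) x →L[ℝ] ℝ)
  (U : ℝ → ∀ x : M, TangentSpace (𝓡 3) x)
  (T : ℝ → ∀ x : M, TangentSpace (𝓡 3) x →L[ℝ] TangentSpace (𝓡 3) x →L[ℝ] ℝ)

/-- For `t ∈ J`: `g_t` are Riemannian metrics, `U_t` are vector fields of unit length and `f` is a
nowhere vanishing function, all smooth on `J × M`. -/
structure IsEvolvingTriple [IsManifold (𝓡 3) ∞ M] : Prop where
  smooth_f : ContMDiffOn (𝓘(ℝ, ℝ).prod (𝓡 3)) 𝓘(ℝ, ℝ) ∞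
    (fun p : ℝ × M => f p.1 p.2) (J ×ˢ univ)
  smooth_U : ContMDiffOn (𝓘(ℝ, ℝ).prod (𝓡 3)) ((𝓡 3).prod 𝓘(ℝ, E3)) ∞
    (fun p : ℝ × M => (⟨p.2, U p.1 p.2⟩ : TangentBundle (𝓡 3) M)) (J ×ˢ univ)
  smooth_g : ContMDiffOn (𝓘(ℝ, ℝ).prod (𝓡 3)) ((𝓡 3).prod 𝓘(ℝ, E3 →L[ℝ] E3 →L[ℝ] ℝ)) ∞
    (fun p : ℝ × M => Bundle.TotalSpace.mk' (E3 →L[ℝ] E3 →L[ℝ] ℝ)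
      (E := fun x : M => TangentSpace (𝓡 3) x →L[ℝ] TangentSpace (𝓡 3) x →L[ℝ] ℝ)
      p.2 (g p.1 p.2)) (J ×ˢ univ)
  symm : ∀ t ∈ J, ∀ x v w, g t x v w = g t x w v
  pos : ∀ t ∈ J, ∀ x v, v ≠ 0 → 0 < g t x v v
  unit : ∀ t ∈ J, ∀ x, g t x (U t x) (U t x) = 1
  f_ne : ∀ t ∈ J, ∀ x, f t x ≠ 0

/-- The evolution equations hold in every chart. -/
def Evolves : Prop :=
  ∀ x₀ : M, EvolvesLocally J (extChartAt (𝓡 3) x₀).target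
    (fun t => chartFun (f t) x₀) (fun t => chartTensor (g t) x₀)
    (fun t => chartVec (U t) x₀) (fun t => chartTensor (T t) x₀)

/-- The quadratic condition holds in every chart. -/
def QuadCondition : Prop :=
  ∀ x₀ : M, QuadLocally J (extChartAt (𝓡 3) x₀).target
    (fun t => chartFun (f t) x₀) (fun t => chartTensor (g t) x₀)
    (fun t => chartVec (U t) x₀) (fun t => chartTensor (T t) x₀)

/-- The vector field `∂_t + fU` on `ℝ × M`. -/
def nullField (p : ℝ × M) : TangentSpace (𝓘(ℝ, ℝ).prod (𝓡 3)) p :=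
  ((1 : ℝ), (f p.1 p.2 • U p.1 p.2 : TangentSpace (𝓡 3) p.2))

/-- The regular curve `γ`, with parameter in the interval `s`, is a null geodesic of
`𝒢 = -f² dt² + g_t` in `J × M`, up to parametrization: `γ' ≠ 0`, `𝒢(γ', γ') = 0` and
`∇_{γ'} γ' = α γ'` for a function `α` of the parameter. The equations are written for the coordinate
expression `c` of `γ` in the chart `(t, x) ↦ (t, y)` of `ℝ × M`, for every chart of `M`. -/
def IsNullGeodesicOn (γ : ℝ → ℝ × M) (s : Set ℝ) : Prop :=
  ∃ α : ℝ → ℝ, ContinuousOn α s ∧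
    ∀ x₀ : M, ∀ τ ∈ s, (γ τ).2 ∈ (extChartAt (𝓡 3) x₀).source →
      let c : ℝ → ℝ × E3 := fun r => ((γ r).1, extChartAt (𝓡 3) x₀ (γ r).2)
      let c' : ℝ → ℝ × E3 := derivWithin c s
      let G := lorentz (fun t => chartFun (f t) x₀) (fun t => chartTensor (g t) x₀)
      ContDiffWithinAt ℝ 2 c s τ ∧ c' τ ≠ 0 ∧ G (c τ) (c' τ) (c' τ) = 0 ∧
        derivWithin c' s τ
            + christoffel G (J ×ˢ (extChartAt (𝓡 3) x₀).target) (c τ) (c' τ) (c' τ)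
          = α τ • c' τ

/-- The points `x` such that `(t, x)` lies on an integral curve of `∂_t + fU` which starts from the
slice `{0} × M`. -/
def reachedAt (t : ℝ) : Set M :=
  {x | ∃ γ : ℝ → ℝ × M, IsMIntegralCurveOn (I := 𝓘(ℝ, ℝ).prod (𝓡 3)) γ (nullField f U) (Icc 0 t) ∧
    (γ 0).1 = 0 ∧ γ t = (t, x)}

end Manifold

/-! ### Conformal foliations -/

section Conformal

variable {M : Type*} [TopologicalSpace M] [ChartedSpace E3 M]
  (g : ∀ x : M, TangentSpace (𝓡 3) x →L[ℝ] TangentSpace (𝓡 3) x →L[ℝ] ℝ)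
  (U : ∀ x : M, TangentSpace (𝓡 3) x)

/-- The Lie derivative `(ℒ_U g)(X, Y) = U(g(X, Y)) - g([U, X], Y) - g(X, [U, Y])`. -/
def lieDerivMetric (X Y : ∀ x : M, TangentSpace (𝓡 3) x) (x : M) : ℝ :=
  mvfderiv (𝓡 3) (fun z => g z (X z) (Y z)) x (U x)
    - g x (VectorField.mlieBracket (𝓡 3) U X x) (Y x)
    - g x (X x) (VectorField.mlieBracket (𝓡 3) U Y x)

/-- On the set `A`, the (nowhere vanishing) field `U` is tangent to a conformal foliation: there is a
function `a` with `(ℒ_U g)(X, Y) = a g(X, Y)` for `X`, `Y` orthogonal to `U`. -/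
def IsTangentToConformalFoliationOn [IsManifold (𝓡 3) ∞ M] (A : Set M) : Prop :=
  ∃ a : M → ℝ, ∀ x ∈ A, ∀ X Y : ∀ x : M, TangentSpace (𝓡 3) x,
    MDifferentiableAt (𝓡 3) ((𝓡 3).prod 𝓘(ℝ, E3))
      (fun z => (⟨z, X z⟩ : TangentBundle (𝓡 3) M)) x →
    MDifferentiableAt (𝓡 3) ((𝓡 3).prod 𝓘(ℝ, E3))
      (fun z => (⟨z, Y z⟩ : TangentBundle (𝓡 3) M)) x →
    g x (U x) (X x) = 0 → g x (U x) (Y x) = 0 →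
    lieDerivMetric g U X Y x = a x * g x (X x) (Y x)

end Conformal

end SlicedSpacetime

end

open SlicedSpacetime

open Set
open scoped Manifold ContDiff

noncomputable section

set_option maxSynthPendingDepth 3

namespace SlicedSpacetime

/-! ### Derivatives along the two factors of `ℝ × E` -/

section Calculus

variable {D : Type*} [NormedAddCommGroup D] [NormedSpace ℝ D]
  {E : Type*} [NormedAddCommGroup E] [NormedSpace ℝ E]
  {F : Type*} [NormedAddCommGroup F] [NormedSpace ℝ F]
  {G : Type*} [NormedAddCommGroup G] [NormedSpace ℝ G]

/-! Write `N = ∂_t + fU`, `B(v, w) = g(∇_v U, w)` and, for an orthonormal triple `X, Y, U` with `Z =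
X - iY`, `σ = B(Z, Z)`. Since `ℒ_U g` is twice the symmetric part of `B`, the field `U` is tangent
to a conformal foliation exactly where `σ = 0`.

The condition on `T̂(U)` turns the evolution of the metric into `(∂_t g)(U, ·) = -2 df`, so that `T`
survives only on the plane orthogonal to `U`, where `∂_t g = 2T`. Inserting this and the evolution
of `U` into the Christoffel symbols of `𝒢` gives `∇_N N = (N(f)/f) N`
(`EvolvingFields.nabla_nullField`). Along an integral curve the acceleration is the derivative of
the field in its own direction, so this identity is the geodesic equation, with `α` the logarithmic
derivative of `f` along the curve.

For the shear, differentiate `B` along `N`. The evolution of `U` contributes `-f ∇_v(∇_U U)` and the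
Ricci identity contributes `+f ∇_v(∇_U U)`; these cancel, and the remaining Hessian of `f` and time
derivative of the connection are part of `𝒢(R(∂_t, v)U, w)`. Hence `N(B)` involves only `B`, first
derivatives of `f` and `g`, and curvature (`EvolvingFields.transport`). For the isotropic `Z` in
dimension three, `Ricci(Z, Z) = -g(R(U, Z)U, Z)`, so the quadratic condition (`QuadLocally.quadAt`)
removes precisely the part of `N(σ)` that is not proportional to `σ`. Rotation of the frame
multiplies `σ` by a phase, and what is left is `N(|σ|²) = 2κ|σ|²` with `κ` continuous
(`EvolvingFields.shear_transport`).

The number `|σ|²` is independent of the frame (`shearNorm_eq`), so it defines, up to a factor, a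
function `W ≥ 0` on `J × M` with `N(W) ≤ CW` on compact sets (`IsShearNorm.exists_growthAt`).
Grönwall's inequality along an integral curve starting on `{0} × M`, where `W = 0`, gives `W = 0` on
the reached set. If `M` is compact, a maximum principle for `exp(-(C+1)t) W` gives `W = 0`
everywhere without constructing the flow of `N`. -/

theorem fderivWithin_apply_field {S : Set D} {p : D} (hS : UniqueDiffWithinAt ℝ S p)
    {H : D → E →L[ℝ] F} {A : D → E} (hH : DifferentiableWithinAt ℝ H S p)
    (hA : DifferentiableWithinAt ℝ A S p) (x : D) :
    fderivWithin ℝ (fun q => H q (A q)) S p x =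
      fderivWithin ℝ H S p x (A p) + H p (fderivWithin ℝ A S p x) := by
  rw [fderivWithin_clm_apply hS hH hA]
  simp [add_comm]

theorem fderivWithin_apply_fields {S : Set D} {p : D} (hS : UniqueDiffWithinAt ℝ S p)
    {B : D → E →L[ℝ] F →L[ℝ] G} {A : D → E} {C : D → F} (hB : DifferentiableWithinAt ℝ B S p)
    (hA : DifferentiableWithinAt ℝ A S p) (hC : DifferentiableWithinAt ℝ C S p) (x : D) :
    fderivWithin ℝ (fun q => B q (A q) (C q)) S p x =
      fderivWithin ℝ B S p x (A p) (C p) + B p (fderivWithin ℝ A S p x) (C p)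
        + B p (A p) (fderivWithin ℝ C S p x) := by
  rw [fderivWithin_apply_field hS (hB.clm_apply hA) hC, fderivWithin_apply_field hS hB hA]
  simp

/-- The derivative of `F` within `S` along the second factor. -/
def spatialDeriv (Q : ℝ × E → F) (S : Set (ℝ × E)) (q : ℝ × E) : E →L[ℝ] F :=
  (fderivWithin ℝ Q S q).comp (ContinuousLinearMap.inr ℝ ℝ E)

/-- The derivative of `F` within `S` along the first factor. -/
def timeDeriv (Q : ℝ × E → F) (S : Set (ℝ × E)) (q : ℝ × E) : F :=
  fderivWithin ℝ Q S q (1, 0)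

theorem spatialDeriv_apply (Q : ℝ × E → F) (S : Set (ℝ × E)) (q : ℝ × E) (v : E) :
    spatialDeriv Q S q v = fderivWithin ℝ Q S q (0, v) := by
  simp [spatialDeriv]

theorem fderivWithin_eq_time_add_spatial (Q : ℝ × E → F) (S : Set (ℝ × E)) (q : ℝ × E) (a : ℝ)
    (v : E) : fderivWithin ℝ Q S q (a, v) = a • timeDeriv Q S q + spatialDeriv Q S q v := by
  rw [spatialDeriv_apply, timeDeriv, ← map_smul, ← map_add]
  simp

theorem fderivWithin_slice {J : Set ℝ} {V : Set E} (hV : IsOpen V) {Q : ℝ × E → F} {t : ℝ} {y : E}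
    (ht : t ∈ J) (hy : y ∈ V) (hQ : DifferentiableWithinAt ℝ Q (J ×ˢ V) (t, y)) :
    fderivWithin ℝ (fun z => Q (t, z)) V y = spatialDeriv Q (J ×ˢ V) (t, y) := by
  have h1 : HasFDerivWithinAt (fun z : E => (t, z)) (ContinuousLinearMap.inr ℝ ℝ E) V y :=
    (hasFDerivAt_prodMk_right t y).hasFDerivWithinAt
  have h2 := hQ.hasFDerivWithinAt.comp y h1 (fun z hz => ⟨ht, hz⟩)
  exact h2.fderivWithin (hV.uniqueDiffWithinAt hy)

theorem hasDerivWithinAt_time {J : Set ℝ} {V : Set E} {Q : ℝ × E → F} {t : ℝ} {y : E}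
    (hy : y ∈ V) (hQ : DifferentiableWithinAt ℝ Q (J ×ˢ V) (t, y)) :
    HasDerivWithinAt (fun s => Q (s, y)) (timeDeriv Q (J ×ˢ V) (t, y)) J t := by
  have h1 : HasDerivWithinAt (fun s : ℝ => (s, y)) ((1 : ℝ), (0 : E)) J t :=
    (hasDerivWithinAt_id t J).prodMk (hasDerivWithinAt_const t J y)
  exact HasFDerivWithinAt.comp_hasDerivWithinAt (t := J ×ˢ V) t hQ.hasFDerivWithinAt h1
    (fun s hs => ⟨hs, hy⟩)

theorem contDiffOn_spatialDeriv {S : Set (ℝ × E)} (hS : UniqueDiffOn ℝ S) {Q : ℝ × E → F}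
    (hQ : ContDiffOn ℝ ∞ Q S) : ContDiffOn ℝ ∞ (spatialDeriv Q S) S :=
  (hQ.fderivWithin (m := ∞) hS (by simp)).clm_comp contDiffOn_const

theorem contDiffOn_timeDeriv {S : Set (ℝ × E)} (hS : UniqueDiffOn ℝ S) {Q : ℝ × E → F}
    (hQ : ContDiffOn ℝ ∞ Q S) : ContDiffOn ℝ ∞ (timeDeriv Q S) S :=
  (hQ.fderivWithin (m := ∞) hS (by simp)).clm_apply contDiffOn_const

/-- The time interval may contain an endpoint. There the symmetry of second derivatives is inherited
from interior points, which is why `S` must lie in the closure of its interior. -/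
theorem fderivWithin_fderivWithin_comm {S : Set D} (hS : UniqueDiffOn ℝ S)
    (hS' : S ⊆ closure (interior S)) {Q : D → F} (hQ : ContDiffOn ℝ ∞ Q S) {p : D} (hp : p ∈ S)
    (x z : D) : fderivWithin ℝ (fderivWithin ℝ Q S) S p x z =
      fderivWithin ℝ (fderivWithin ℝ Q S) S p z x :=
  ((hQ p hp).isSymmSndFDerivWithinAt (n := ∞) (by simpa using ENat.LEInfty.out) hS
    (hS' hp) hp) x z

theorem fderivWithin_spatialDeriv {S : Set (ℝ × E)} (hS : UniqueDiffOn ℝ S) {Q : ℝ × E → F}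
    (hQ : ContDiffOn ℝ ∞ Q S) {p : ℝ × E} (hp : p ∈ S) (x : ℝ × E) (v : E) :
    fderivWithin ℝ (spatialDeriv Q S) S p x v =
      fderivWithin ℝ (fderivWithin ℝ Q S) S p x (0, v) := by
  have h := (hQ.fderivWithin (m := ∞) hS (by simp)).differentiableOn (by simp) p hp
  have h2 := h.hasFDerivWithinAt.clm_comp
    (hasFDerivWithinAt_const (ContinuousLinearMap.inr ℝ ℝ E) p S)
  rw [show spatialDeriv Q S = fun q => (fderivWithin ℝ Q S q).comp (ContinuousLinearMap.inr ℝ ℝ E)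
    from rfl, h2.fderivWithin (hS p hp)]
  simp

theorem fderivWithin_timeDeriv {S : Set (ℝ × E)} (hS : UniqueDiffOn ℝ S) {Q : ℝ × E → F}
    (hQ : ContDiffOn ℝ ∞ Q S) {p : ℝ × E} (hp : p ∈ S) (x : ℝ × E) :
    fderivWithin ℝ (timeDeriv Q S) S p x =
      fderivWithin ℝ (fderivWithin ℝ Q S) S p x (1, 0) := by
  have h := (hQ.fderivWithin (m := ∞) hS (by simp)).differentiableOn (by simp) p hp
  unfold timeDeriv
  rw [fderivWithin_apply_field (hS p hp) h (differentiableWithinAt_const _)]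
  simp

end Calculus

/-! ### Positive definite forms -/

section Forms

variable {E : Type*} [NormedAddCommGroup E] [NormedSpace ℝ E] [FiniteDimensional ℝ E]

/-- An injective map from a space to its dual of equal dimension is bijective. Nondegeneracy is the
right generality because the indefinite metric `𝒢` is treated as well. -/
theorem isInvertible_of_nondegenerate {B : E →L[ℝ] E →L[ℝ] ℝ}
    (h : ∀ v, (∀ w, B v w = 0) → v = 0) : B.IsInvertible := by
  have hinj : Function.Injective (B : E →ₗ[ℝ] (E →L[ℝ] ℝ)) := by
    rw [← LinearMap.ker_eq_bot, LinearMap.ker_eq_bot']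
    intro v hv
    have h3 : B v = 0 := hv
    exact h v fun w => by simp [h3]
  have hfin : Module.finrank ℝ E = Module.finrank ℝ (E →L[ℝ] ℝ) := by
    rw [← (LinearMap.toContinuousLinearMap (𝕜 := ℝ) (E := E) (F' := ℝ)).finrank_eq]
    exact (Subspace.dual_finrank_eq (K := ℝ) (V := E)).symm
  exact ⟨(LinearMap.linearEquivOfInjective (B : E →ₗ[ℝ] (E →L[ℝ] ℝ)) hinj
    hfin).toContinuousLinearEquiv, by ext v w; simp⟩

theorem isInvertible_of_pos {B : E →L[ℝ] E →L[ℝ] ℝ} (h : ∀ v, v ≠ 0 → 0 < B v v) :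
    B.IsInvertible :=
  isInvertible_of_nondegenerate fun v hv => by
    by_contra hne
    exact (h v hne).ne' (hv v)

end Forms

/-! ### Sliced fields in a coordinate domain -/

section SlicedFields

variable {E : Type*} [NormedAddCommGroup E] [NormedSpace ℝ E]

/-- The Christoffel symbols of the slice metrics, as a field on `S ⊆ ℝ × E`. -/
def sliceChristoffel (g : ℝ × E → E →L[ℝ] E →L[ℝ] ℝ) (S : Set (ℝ × E)) (q : ℝ × E) :
    E →L[ℝ] E →L[ℝ] E :=
  (ContinuousLinearMap.compL ℝ E (E →L[ℝ] ℝ) E (g q).inverse).comp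
    ((1 / 2 : ℝ) • (spatialDeriv g S q + (spatialDeriv g S q).flip
      - ((ContinuousLinearMap.flipₗᵢ ℝ E E ℝ).toContinuousLinearEquiv :
          (E →L[ℝ] E →L[ℝ] ℝ) →L[ℝ] (E →L[ℝ] E →L[ℝ] ℝ)).comp (spatialDeriv g S q).flip))

/-- The covariant derivative `v ↦ ∇_v U` along the slices. -/
def sliceNabla (g : ℝ × E → E →L[ℝ] E →L[ℝ] ℝ) (S : Set (ℝ × E)) (U : ℝ × E → E) (q : ℝ × E) :
    E →L[ℝ] E :=
  spatialDeriv U S q + (sliceChristoffel g S q).flip (U q)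

/-- The gradient of `f` along the slices. -/
def sliceGradient (g : ℝ × E → E →L[ℝ] E →L[ℝ] ℝ) (S : Set (ℝ × E)) (f : ℝ × E → ℝ) (q : ℝ × E) :
    E :=
  (g q).inverse (spatialDeriv f S q)

/-- The endomorphism associated with the time derivative of the slice metric. -/
def metricRate (g : ℝ × E → E →L[ℝ] E →L[ℝ] ℝ) (S : Set (ℝ × E)) (q : ℝ × E) : E →L[ℝ] E :=
  (g q).inverse.comp (timeDeriv g S q)

/-- The curvature `R(a, b)c` of the slice metrics. -/
def sliceCurvature (g : ℝ × E → E →L[ℝ] E →L[ℝ] ℝ) (S : Set (ℝ × E)) (q : ℝ × E) (a b c : E) : E :=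
  fderivWithin ℝ (sliceChristoffel g S) S q (0, a) b c
    - fderivWithin ℝ (sliceChristoffel g S) S q (0, b) a c
    + sliceChristoffel g S q a (sliceChristoffel g S q b c)
    - sliceChristoffel g S q b (sliceChristoffel g S q a c)

/-- Smooth families of metrics, unit vector fields and nowhere vanishing functions in a coordinate
domain. -/
structure SlicedFields (J : Set ℝ) (V : Set E) (f : ℝ × E → ℝ) (g : ℝ × E → E →L[ℝ] E →L[ℝ] ℝ)
    (U : ℝ × E → E) : Prop where
  convex : Convex ℝ J
  interior_nonempty : (interior J).Nonempty
  isOpen : IsOpen V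
  smooth_f : ContDiffOn ℝ ∞ f (J ×ˢ V)
  smooth_g : ContDiffOn ℝ ∞ g (J ×ˢ V)
  smooth_U : ContDiffOn ℝ ∞ U (J ×ˢ V)
  symm : ∀ p ∈ J ×ˢ V, ∀ v w, g p v w = g p w v
  pos : ∀ p ∈ J ×ˢ V, ∀ v, v ≠ 0 → 0 < g p v v
  unit : ∀ p ∈ J ×ˢ V, g p (U p) (U p) = 1
  f_ne : ∀ p ∈ J ×ˢ V, f p ≠ 0

theorem sliceNabla_apply (g : ℝ × E → E →L[ℝ] E →L[ℝ] ℝ) (S : Set (ℝ × E)) (U : ℝ × E → E)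
    (q : ℝ × E) (v : E) :
    sliceNabla g S U q v = spatialDeriv U S q v + sliceChristoffel g S q v (U q) := by
  simp [sliceNabla]

theorem sliceChristoffel_apply (g : ℝ × E → E →L[ℝ] E →L[ℝ] ℝ) (S : Set (ℝ × E)) (q : ℝ × E)
    (v w : E) :
    sliceChristoffel g S q v w = (g q).inverse ((1 / 2 : ℝ) •
      (spatialDeriv g S q v w + spatialDeriv g S q w v
        - ((spatialDeriv g S q).flip v).flip w)) := by
  simp [sliceChristoffel]

namespace SlicedFields

variable {J : Set ℝ} {V : Set E} {f : ℝ × E → ℝ} {g : ℝ × E → E →L[ℝ] E →L[ℝ] ℝ} {U : ℝ × E → E}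
  (h : SlicedFields J V f g U) {p : ℝ × E}
include h

theorem uniqueDiffOn : UniqueDiffOn ℝ (J ×ˢ V) :=
  (uniqueDiffOn_convex h.convex h.interior_nonempty).prod h.isOpen.uniqueDiffOn

theorem subset_closure_interior : J ×ˢ V ⊆ closure (interior (J ×ˢ V)) := by
  rw [interior_prod_eq, closure_prod_eq, h.isOpen.interior_eq]
  refine prod_mono ?_ subset_closure
  exact subset_closure.trans (h.convex.closure_interior_eq_closure_of_nonempty_interior
    h.interior_nonempty).ge

theorem differentiable_f (hp : p ∈ J ×ˢ V) : DifferentiableWithinAt ℝ f (J ×ˢ V) p :=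
  h.smooth_f.differentiableOn (by simp) p hp

theorem differentiable_g (hp : p ∈ J ×ˢ V) : DifferentiableWithinAt ℝ g (J ×ˢ V) p :=
  h.smooth_g.differentiableOn (by simp) p hp

theorem differentiable_U (hp : p ∈ J ×ˢ V) : DifferentiableWithinAt ℝ U (J ×ˢ V) p :=
  h.smooth_U.differentiableOn (by simp) p hp

variable [FiniteDimensional ℝ E]

theorem isInvertible (hp : p ∈ J ×ˢ V) : (g p).IsInvertible := isInvertible_of_pos (h.pos p hp)

theorem metric_inverse (hp : p ∈ J ×ˢ V) (η : E →L[ℝ] ℝ) : g p ((g p).inverse η) = η :=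
  (h.isInvertible hp).self_apply_inverse η

theorem metric_injective (hp : p ∈ J ×ˢ V) {v w : E} (hvw : ∀ z, g p v z = g p w z) : v = w :=
  (h.isInvertible hp).injective (ContinuousLinearMap.ext hvw)

theorem smooth_inverse : ContDiffOn ℝ ∞ (fun q => (g q).inverse) (J ×ˢ V) := by
  have : CompleteSpace E := FiniteDimensional.complete ℝ E
  intro p hp
  exact (h.isInvertible hp).contDiffAt_map_inverse.comp_contDiffWithinAt p (h.smooth_g p hp)

theorem smooth_sliceChristoffel : ContDiffOn ℝ ∞ (sliceChristoffel g (J ×ˢ V)) (J ×ˢ V) := by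
  have h1 := contDiffOn_spatialDeriv h.uniqueDiffOn h.smooth_g
  have h2 : ContDiffOn ℝ ∞ (fun q => (spatialDeriv g (J ×ˢ V) q).flip) (J ×ˢ V) :=
    ((ContinuousLinearMap.flipₗᵢ ℝ E E (E →L[ℝ] ℝ)).contDiff).comp_contDiffOn h1
  refine ContDiffOn.clm_comp ?_ (ContDiffOn.const_smul (1 / 2 : ℝ) ((h1.add h2).sub
    (contDiffOn_const.clm_comp h2)))
  exact (ContinuousLinearMap.contDiff _).comp_contDiffOn h.smooth_inverse

theorem smooth_sliceNabla {Q : ℝ × E → E} (hQ : ContDiffOn ℝ ∞ Q (J ×ˢ V)) :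
    ContDiffOn ℝ ∞ (sliceNabla g (J ×ˢ V) Q) (J ×ˢ V) := by
  refine (contDiffOn_spatialDeriv h.uniqueDiffOn hQ).add (ContDiffOn.clm_apply ?_ hQ)
  exact ((ContinuousLinearMap.flipₗᵢ ℝ E E E).contDiff).comp_contDiffOn h.smooth_sliceChristoffel

theorem smooth_sliceGradient : ContDiffOn ℝ ∞ (sliceGradient g (J ×ˢ V) f) (J ×ˢ V) :=
  h.smooth_inverse.clm_apply (contDiffOn_spatialDeriv h.uniqueDiffOn h.smooth_f)

theorem smooth_metricRate : ContDiffOn ℝ ∞ (metricRate g (J ×ˢ V)) (J ×ˢ V) :=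
  h.smooth_inverse.clm_comp (contDiffOn_timeDeriv h.uniqueDiffOn h.smooth_g)

theorem metric_sliceGradient (hp : p ∈ J ×ˢ V) (w : E) :
    g p (sliceGradient g (J ×ˢ V) f p) w = spatialDeriv f (J ×ˢ V) p w := by
  rw [sliceGradient, h.metric_inverse hp]

theorem metric_metricRate (hp : p ∈ J ×ˢ V) (v w : E) :
    g p (metricRate g (J ×ˢ V) p v) w = timeDeriv g (J ×ˢ V) p v w := by
  rw [metricRate, ContinuousLinearMap.comp_apply, h.metric_inverse hp]

omit [FiniteDimensional ℝ E] in
theorem fderivWithin_metric_symm (hp : p ∈ J ×ˢ V) (x : ℝ × E) (v w : E) :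
    fderivWithin ℝ g (J ×ˢ V) p x v w = fderivWithin ℝ g (J ×ˢ V) p x w v := by
  have hu := h.uniqueDiffOn p hp
  have e : fderivWithin ℝ (fun q => g q v w) (J ×ˢ V) p x =
      fderivWithin ℝ (fun q => g q w v) (J ×ˢ V) p x := by
    rw [fderivWithin_congr (fun q hq => h.symm q hq v w) (h.symm p hp v w)]
  rw [fderivWithin_apply_fields hu (h.differentiable_g hp) (differentiableWithinAt_const _)
    (differentiableWithinAt_const _), fderivWithin_apply_fields hu (h.differentiable_g hp)
    (differentiableWithinAt_const _) (differentiableWithinAt_const _)] at e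
  simpa using e

omit [FiniteDimensional ℝ E] in
theorem timeDeriv_metric_symm (hp : p ∈ J ×ˢ V) (v w : E) :
    timeDeriv g (J ×ˢ V) p v w = timeDeriv g (J ×ˢ V) p w v :=
  h.fderivWithin_metric_symm hp _ v w

omit [FiniteDimensional ℝ E] in
theorem spatialDeriv_metric_symm (hp : p ∈ J ×ˢ V) (x v w : E) :
    spatialDeriv g (J ×ˢ V) p x v w = spatialDeriv g (J ×ˢ V) p x w v := by
  simp only [spatialDeriv_apply]
  exact h.fderivWithin_metric_symm hp _ v w

theorem metric_sliceChristoffel (hp : p ∈ J ×ˢ V) (v w z : E) :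
    g p (sliceChristoffel g (J ×ˢ V) p v w) z = (1 / 2) * (spatialDeriv g (J ×ˢ V) p v w z
      + spatialDeriv g (J ×ˢ V) p w v z - spatialDeriv g (J ×ˢ V) p z v w) := by
  rw [sliceChristoffel_apply, h.metric_inverse hp]
  simp

theorem sliceChristoffel_symm (hp : p ∈ J ×ˢ V) (v w : E) :
    sliceChristoffel g (J ×ˢ V) p v w = sliceChristoffel g (J ×ˢ V) p w v := by
  refine h.metric_injective hp fun z => ?_
  rw [h.metric_sliceChristoffel hp, h.metric_sliceChristoffel hp,
    h.spatialDeriv_metric_symm hp z v w]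
  ring

/-- Compatibility of the slice connection with the metric, in coordinates. -/
theorem spatialDeriv_metric (hp : p ∈ J ×ˢ V) (v w z : E) :
    spatialDeriv g (J ×ˢ V) p v w z = g p (sliceChristoffel g (J ×ˢ V) p v w) z
      + g p w (sliceChristoffel g (J ×ˢ V) p v z) := by
  rw [h.symm p hp w, h.metric_sliceChristoffel hp, h.metric_sliceChristoffel hp,
    h.spatialDeriv_metric_symm hp z v w, h.spatialDeriv_metric_symm hp v z w]
  ring

/-- Differentiate metric compatibility once more on constant fields `c, d` and antisymmetrize in `a,
b`: the second derivatives of `g(c, d)` cancel by symmetry, and so do the products of two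
Christoffel symbols paired with each other. -/
theorem sliceCurvature_skew (hp : p ∈ J ×ˢ V) (a b c d : E) :
    g p (sliceCurvature g (J ×ˢ V) p a b c) d = -g p (sliceCurvature g (J ×ˢ V) p a b d) c := by
  have hu := h.uniqueDiffOn p hp
  have hΓ := h.smooth_sliceChristoffel.differentiableOn (by simp) p hp
  have hsm : ∀ c d : E, ContDiffOn ℝ ∞ (fun q => g q c d) (J ×ˢ V) := fun c d =>
    (h.smooth_g.clm_apply contDiffOn_const).clm_apply contDiffOn_const
  have key : ∀ a b c d : E,
      fderivWithin ℝ (fderivWithin ℝ (fun q => g q c d) (J ×ˢ V)) (J ×ˢ V) p (0, a) (0, b) =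
        g p (fderivWithin ℝ (sliceChristoffel g (J ×ˢ V)) (J ×ˢ V) p (0, a) b c) d
        + g p (sliceChristoffel g (J ×ˢ V) p a (sliceChristoffel g (J ×ˢ V) p b c)) d
        + g p (sliceChristoffel g (J ×ˢ V) p b c) (sliceChristoffel g (J ×ˢ V) p a d)
        + (g p (fderivWithin ℝ (sliceChristoffel g (J ×ˢ V)) (J ×ˢ V) p (0, a) b d) c
        + g p (sliceChristoffel g (J ×ˢ V) p a (sliceChristoffel g (J ×ˢ V) p b d)) c
        + g p (sliceChristoffel g (J ×ˢ V) p b d) (sliceChristoffel g (J ×ˢ V) p a c)) := by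
    intro a b c d
    have hc : ∀ {F : Type _} [NormedAddCommGroup F] [NormedSpace ℝ F] (c : F),
      DifferentiableWithinAt ℝ (fun _ : ℝ × E => c) (J ×ˢ V) p :=
      fun c => differentiableWithinAt_const c
    have e1 : ∀ c : E, DifferentiableWithinAt ℝ (fun q => sliceChristoffel g (J ×ˢ V) q b c)
        (J ×ˢ V) p := fun c => (hΓ.clm_apply (hc b)).clm_apply (hc c)
    have e2 : ∀ c d : E, DifferentiableWithinAt ℝ
        (fun q => g q (sliceChristoffel g (J ×ˢ V) q b c) d) (J ×ˢ V) p := fun c d =>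
      ((h.differentiable_g hp).clm_apply (e1 c)).clm_apply (hc d)
    have e3 : ∀ c d : E, fderivWithin ℝ (fun q => g q (sliceChristoffel g (J ×ˢ V) q b c) d)
        (J ×ˢ V) p (0, a) =
        g p (fderivWithin ℝ (sliceChristoffel g (J ×ˢ V)) (J ×ˢ V) p (0, a) b c) d
        + g p (sliceChristoffel g (J ×ˢ V) p a (sliceChristoffel g (J ×ˢ V) p b c)) d
        + g p (sliceChristoffel g (J ×ˢ V) p b c) (sliceChristoffel g (J ×ˢ V) p a d) := by
      intro c d
      rw [fderivWithin_apply_fields hu (h.differentiable_g hp) (e1 c) (hc d),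
        fderivWithin_apply_fields hu hΓ (hc b) (hc c), ← spatialDeriv_apply g,
        h.spatialDeriv_metric hp]
      simp only [fderivWithin_fun_const, Pi.zero_apply, zero_apply, map_zero,
        add_zero]
      ring
    have e4 : ∀ q ∈ J ×ˢ V, spatialDeriv (fun q => g q c d) (J ×ˢ V) q b =
        spatialDeriv g (J ×ˢ V) q b c d := by
      intro q hq
      rw [spatialDeriv_apply, spatialDeriv_apply, fderivWithin_apply_fields (h.uniqueDiffOn q hq)
        (h.differentiable_g hq) (differentiableWithinAt_const _) (differentiableWithinAt_const _)]
      simp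
    have e5 := fderivWithin_apply_field hu ((contDiffOn_spatialDeriv h.uniqueDiffOn
      (hsm c d)).differentiableOn (by simp) p hp) (hc b) (0, a)
    rw [fderivWithin_spatialDeriv h.uniqueDiffOn (hsm c d) hp] at e5
    simp only [fderivWithin_fun_const, Pi.zero_apply, zero_apply, map_zero, add_zero] at e5
    rw [← e5, ← e3 c d, ← e3 d c, ← add_apply, ← fderivWithin_fun_add hu (e2 c d) (e2 d c)]
    refine congrArg (fun L : ℝ × E →L[ℝ] ℝ => L (0, a)) (fderivWithin_congr (fun q hq => ?_) ?_)
    · rw [e4 q hq, h.spatialDeriv_metric hq, h.symm q hq c]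
    · rw [e4 p hp, h.spatialDeriv_metric hp, h.symm p hp c]
  have h1 := key a b c d
  rw [fderivWithin_fderivWithin_comm h.uniqueDiffOn h.subset_closure_interior (hsm c d) hp,
    key b a c d] at h1
  simp only [sliceCurvature, map_add, map_sub, add_apply, sub_apply]
  rw [h.symm p hp (sliceChristoffel g (J ×ˢ V) p a c),
    h.symm p hp (sliceChristoffel g (J ×ˢ V) p a d)] at h1
  linarith

end SlicedFields
end SlicedFields

/-! ### Connection and curvature of `-f² dt² + g_t` in terms of the slices -/

section Lorentz

variable {E : Type*} [NormedAddCommGroup E] [NormedSpace ℝ E]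

/-- The metric `-f² dt² + g_t` of a pair of fields on `ℝ × E`. -/
abbrev lorentzMetric (f : ℝ × E → ℝ) (g : ℝ × E → E →L[ℝ] E →L[ℝ] ℝ) :
    ℝ × E → (ℝ × E) →L[ℝ] (ℝ × E) →L[ℝ] ℝ :=
  lorentz (fun t y => f (t, y)) (fun t y => g (t, y))

theorem lorentzMetric_apply (f : ℝ × E → ℝ) (g : ℝ × E → E →L[ℝ] E →L[ℝ] ℝ) (q u v : ℝ × E) :
    lorentzMetric f g q u v = -(f q) ^ 2 * (u.1 * v.1) + g q u.2 v.2 := by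
  simp [lorentz]

namespace SlicedFields

variable {J : Set ℝ} {V : Set E} {f : ℝ × E → ℝ} {g : ℝ × E → E →L[ℝ] E →L[ℝ] ℝ} {U : ℝ × E → E}
  (h : SlicedFields J V f g U) {p : ℝ × E} [FiniteDimensional ℝ E]
include h

theorem smooth_lorentzMetric : ContDiffOn ℝ ∞ (lorentzMetric f g) (J ×ˢ V) := by
  refine contDiffOn_clm_apply.2 fun u => contDiffOn_clm_apply.2 fun v => ?_
  simp only [lorentzMetric_apply]
  exact ((h.smooth_f.pow 2).neg.mul contDiffOn_const).add
    ((h.smooth_g.clm_apply contDiffOn_const).clm_apply contDiffOn_const)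

theorem isInvertible_lorentzMetric (hp : p ∈ J ×ˢ V) : (lorentzMetric f g p).IsInvertible := by
  refine isInvertible_of_nondegenerate fun u hu => ?_
  have h1 := hu (1, 0)
  have h2 := hu (0, u.2)
  rw [lorentzMetric_apply] at h1 h2
  simp only [map_zero, add_zero, mul_one, mul_zero, zero_add] at h1 h2
  have h3 : u.1 = 0 := by simpa [h.f_ne p hp] using h1
  have h4 : u.2 = 0 := by
    by_contra hne
    exact (h.pos p hp _ hne).ne' h2
  exact Prod.ext h3 h4

theorem fderivWithin_lorentzMetric (hp : p ∈ J ×ˢ V) (x u v : ℝ × E) :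
    fderivWithin ℝ (lorentzMetric f g) (J ×ˢ V) p x u v =
      -(2 * f p * fderivWithin ℝ f (J ×ˢ V) p x) * (u.1 * v.1)
        + fderivWithin ℝ g (J ×ˢ V) p x u.2 v.2 := by
  have hu := h.uniqueDiffOn p hp
  have hc : ∀ c : ℝ × E, DifferentiableWithinAt ℝ (fun _ : ℝ × E => c) (J ×ˢ V) p :=
    fun c => differentiableWithinAt_const c
  have hc' : ∀ c : E, DifferentiableWithinAt ℝ (fun _ : ℝ × E => c) (J ×ˢ V) p :=
    fun c => differentiableWithinAt_const c
  have h1 := fderivWithin_apply_fields hu (h.smooth_lorentzMetric.differentiableOn (by simp) p hp)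
    (hc u) (hc v) x
  have h2 := fderivWithin_apply_fields hu (h.differentiable_g hp) (hc' u.2) (hc' v.2) x
  simp only [fderivWithin_fun_const, Pi.zero_apply, zero_apply, map_zero, add_zero] at h1 h2
  rw [← h1, ← h2]
  simp only [lorentzMetric_apply]
  have hd := (h.differentiable_f hp).hasFDerivWithinAt
  have hd2 := (((h.differentiable_g hp).clm_apply (hc' u.2)).clm_apply (hc' v.2)).hasFDerivWithinAt
  have := (((hd.pow 2).neg.mul_const (u.1 * v.1)).add hd2).fderivWithin hu
  refine (congrArg (fun L : ℝ × E →L[ℝ] ℝ => L x) this).trans ?_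
  simp
  ring

/-- After lowering the index, that is pairing with an arbitrary `(c, z)`, both sides become the same
combination of first derivatives of `f` and `g`. -/
theorem christoffel_lorentzMetric (hp : p ∈ J ×ˢ V) (a b : ℝ) (v w : E) :
    christoffel (lorentzMetric f g) (J ×ˢ V) p (a, v) (b, w) =
      (a * b * (timeDeriv f (J ×ˢ V) p / f p)
          + (a * spatialDeriv f (J ×ˢ V) p w + b * spatialDeriv f (J ×ˢ V) p v) / f p
          + timeDeriv g (J ×ˢ V) p v w / (2 * f p ^ 2),
        (a * b * f p) • sliceGradient g (J ×ˢ V) f p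
          + (1 / 2 : ℝ) • metricRate g (J ×ˢ V) p (a • w + b • v)
          + sliceChristoffel g (J ×ˢ V) p v w) := by
  refine ((h.isInvertible_lorentzMetric hp).inverse_apply_eq).2 (ContinuousLinearMap.ext ?_)
  rintro ⟨c, z⟩
  have hf := h.f_ne p hp
  rw [lorentzMetric_apply]
  simp only [smul_apply, add_apply, sub_apply, ContinuousLinearMap.flip_apply,
    h.fderivWithin_lorentzMetric hp]
  simp only [smul_apply, add_apply, map_add, map_smul, smul_eq_mul,
    fderivWithin_eq_time_add_spatial, h.metric_sliceGradient hp, h.metric_metricRate hp, h.metric_sliceChristoffel hp]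
  field_simp
  ring

theorem lorentzMetric_curvature (hp : p ∈ J ×ˢ V) (u v w : E) :
    lorentzMetric f g p (curvature (lorentzMetric f g) (J ×ˢ V) p (1, 0) (0, v) (0, u)) (0, w) =
      g p (fderivWithin ℝ (sliceChristoffel g (J ×ˢ V)) (J ×ˢ V) p (1, 0) v u) w
      - (1 / 2) * g p (fderivWithin ℝ (metricRate g (J ×ˢ V)) (J ×ˢ V) p (0, v) u) w
      + (timeDeriv g (J ×ˢ V) p v u / (2 * f p)) * spatialDeriv f (J ×ˢ V) p w
      + (1 / 2) * timeDeriv g (J ×ˢ V) p (sliceChristoffel g (J ×ˢ V) p v u) w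
      - (spatialDeriv f (J ×ˢ V) p u / (2 * f p)) * timeDeriv g (J ×ˢ V) p v w
      - (1 / 2) * g p (sliceChristoffel g (J ×ˢ V) p v (metricRate g (J ×ˢ V) p u)) w := by
  have hu := h.uniqueDiffOn p hp
  have hf := h.f_ne p hp
  have hc : ∀ c : E, DifferentiableWithinAt ℝ (fun _ : ℝ × E => c) (J ×ˢ V) p :=
    fun c => differentiableWithinAt_const c
  have hf' := (contDiffOn_spatialDeriv h.uniqueDiffOn h.smooth_f).differentiableOn (by simp) p hp
  have hg' := (contDiffOn_timeDeriv h.uniqueDiffOn h.smooth_g).differentiableOn (by simp) p hp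
  have hΓ := h.smooth_sliceChristoffel.differentiableOn (by simp) p hp
  have hr := h.smooth_metricRate.differentiableOn (by simp) p hp
  have e1 : ∀ q ∈ J ×ˢ V, christoffel (lorentzMetric f g) (J ×ˢ V) q (0, v) (0, u) =
      (timeDeriv g (J ×ˢ V) q v u * (2 * f q ^ 2)⁻¹, sliceChristoffel g (J ×ˢ V) q v u) := by
    intro q hq
    rw [h.christoffel_lorentzMetric hq]
    simp [div_eq_mul_inv]
  have e2 : ∀ q ∈ J ×ˢ V, christoffel (lorentzMetric f g) (J ×ˢ V) q (1, 0) (0, u) =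
      (spatialDeriv f (J ×ˢ V) q u * (f q)⁻¹, (1 / 2 : ℝ) • metricRate g (J ×ˢ V) q u) := by
    intro q hq
    rw [h.christoffel_lorentzMetric hq]
    simp [div_eq_mul_inv]
  have d1 : DifferentiableWithinAt ℝ (fun q => timeDeriv g (J ×ˢ V) q v u * (2 * f q ^ 2)⁻¹)
      (J ×ˢ V) p :=
    ((hg'.clm_apply (hc v)).clm_apply (hc u)).mul
      ((((h.differentiable_f hp).pow 2).const_mul 2).inv (mul_ne_zero two_ne_zero (pow_ne_zero 2 hf)))
  have d2 : DifferentiableWithinAt ℝ (fun q => spatialDeriv f (J ×ˢ V) q u * (f q)⁻¹)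
      (J ×ˢ V) p := (hf'.clm_apply (hc u)).mul ((h.differentiable_f hp).inv hf)
  -- The curvature is only paired with `(0, w)`, so the spatial components of the differentiated
  -- symbols suffice.
  have s1 : (fderivWithin ℝ (fun q => christoffel (lorentzMetric f g) (J ×ˢ V) q (0, v) (0, u))
      (J ×ˢ V) p (1, 0)).2 =
      fderivWithin ℝ (sliceChristoffel g (J ×ˢ V)) (J ×ˢ V) p (1, 0) v u := by
    rw [fderivWithin_congr e1 (e1 p hp),
      d1.fderivWithin_prodMk ((hΓ.clm_apply (hc v)).clm_apply (hc u)) hu]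
    rw [ContinuousLinearMap.prod_apply, fderivWithin_apply_fields hu hΓ (hc v) (hc u)]
    simp
  have s2 : (fderivWithin ℝ (fun q => christoffel (lorentzMetric f g) (J ×ˢ V) q (1, 0) (0, u))
      (J ×ˢ V) p (0, v)).2 =
      (1 / 2 : ℝ) • fderivWithin ℝ (metricRate g (J ×ˢ V)) (J ×ˢ V) p (0, v) u := by
    rw [fderivWithin_congr e2 (e2 p hp),
      d2.fderivWithin_prodMk ((hr.clm_apply (hc u)).fun_const_smul _) hu]
    rw [ContinuousLinearMap.prod_apply, fderivWithin_fun_const_smul hu (hr.clm_apply (hc u)),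
      smul_apply, fderivWithin_apply_field hu hr (hc u)]
    simp
  rw [lorentzMetric_apply]
  simp only [curvature, Prod.snd_add, Prod.snd_sub, s1, s2, e1 p hp, e2 p hp, mul_zero, zero_add]
  rw [h.christoffel_lorentzMetric hp, h.christoffel_lorentzMetric hp]
  simp only [map_add, map_sub, map_smul, add_apply, sub_apply, smul_apply, smul_eq_mul,
    h.metric_sliceGradient hp, h.metric_metricRate hp, one_mul, zero_mul, zero_smul, one_smul,
    zero_add, add_zero, map_zero, smul_zero, zero_apply]
  field_simp
  ring

end SlicedFields

end Lorentz

/-! ### Derivative of `∇U` along `∂_t + fU` -/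

section Evolution

variable {E : Type*} [NormedAddCommGroup E] [NormedSpace ℝ E]

/-- Sliced fields with `∂U/∂t = -f ∇_U U + grad f` and `(∂g/∂t)(U, ·) = -2 df`. -/
structure EvolvingFields (J : Set ℝ) (V : Set E) (f : ℝ × E → ℝ) (g : ℝ × E → E →L[ℝ] E →L[ℝ] ℝ)
    (U : ℝ × E → E) : Prop extends SlicedFields J V f g U where
  evol_U : ∀ p ∈ J ×ˢ V, timeDeriv U (J ×ˢ V) p =
    -(f p) • sliceNabla g (J ×ˢ V) U p (U p) + sliceGradient g (J ×ˢ V) f p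
  rate_U : ∀ p ∈ J ×ˢ V, ∀ w, timeDeriv g (J ×ˢ V) p (U p) w = -2 * spatialDeriv f (J ×ˢ V) p w

namespace EvolvingFields

variable {J : Set ℝ} {V : Set E} {f : ℝ × E → ℝ} {g : ℝ × E → E →L[ℝ] E →L[ℝ] ℝ} {U : ℝ × E → E}
  (h : EvolvingFields J V f g U) {p : ℝ × E} [FiniteDimensional ℝ E]
include h

theorem metricRate_U (hp : p ∈ J ×ˢ V) :
    metricRate g (J ×ˢ V) p (U p) = (-2 : ℝ) • sliceGradient g (J ×ˢ V) f p := by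
  refine h.metric_injective hp fun z => ?_
  rw [h.metric_metricRate hp, h.rate_U p hp, map_smul, smul_apply, h.metric_sliceGradient hp,
    smul_eq_mul]

omit [FiniteDimensional ℝ E] in
theorem rate_U_right (hp : p ∈ J ×ˢ V) (w : E) :
    timeDeriv g (J ×ˢ V) p w (U p) = -2 * spatialDeriv f (J ×ˢ V) p w := by
  rw [h.timeDeriv_metric_symm hp, h.rate_U p hp]

/-- The velocity field `∂_t + fU` has acceleration proportional to itself. -/
theorem nabla_nullField (hp : p ∈ J ×ˢ V) :
    fderivWithin ℝ (fun q => ((1 : ℝ), f q • U q)) (J ×ˢ V) p (1, f p • U p)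
      + christoffel (lorentzMetric f g) (J ×ˢ V) p (1, f p • U p) (1, f p • U p) =
    (fderivWithin ℝ f (J ×ˢ V) p (1, f p • U p) / f p) • ((1 : ℝ), f p • U p) := by
  have hu := h.uniqueDiffOn p hp
  have hf := h.f_ne p hp
  have h1 : fderivWithin ℝ (fun q => ((1 : ℝ), f q • U q)) (J ×ˢ V) p (1, f p • U p) =
      (0, (fderivWithin ℝ f (J ×ˢ V) p (1, f p • U p)) • U p
        + f p • fderivWithin ℝ U (J ×ˢ V) p (1, f p • U p)) := by
    rw [(differentiableWithinAt_const (1 : ℝ)).fderivWithin_prodMk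
      ((h.differentiable_f hp).fun_smul (h.differentiable_U hp)) hu,
      fderivWithin_fun_smul hu (h.differentiable_f hp) (h.differentiable_U hp)]
    simp [add_comm]
  rw [h1, h.christoffel_lorentzMetric hp]
  -- In the time component `(∂_t g)(U, U) = -2U(f)` halves the term `2U(f)`. In the space component
  -- the two gradients `f grad f`, one from the evolution of `U` and one from the connection, are
  -- cancelled by the metric rate applied to `fU`.
  simp only [fderivWithin_eq_time_add_spatial, map_smul, smul_apply, h.rate_U p hp, map_add,
    h.metricRate_U hp, h.evol_U p hp, sliceNabla_apply, smul_eq_mul]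
  ext
  · simp only [Prod.fst_add, Prod.smul_fst, smul_eq_mul]
    field_simp
    ring
  · simp only [Prod.snd_add, Prod.smul_snd]
    match_scalars <;> field_simp <;> ring

/-- The time derivative of `v ↦ ∇_v U`. -/
theorem timeDeriv_sliceNabla (hp : p ∈ J ×ˢ V) (v : E) :
    fderivWithin ℝ (sliceNabla g (J ×ˢ V) U) (J ×ˢ V) p (1, 0) v =
      -(spatialDeriv f (J ×ˢ V) p v) • sliceNabla g (J ×ˢ V) U p (U p)
      - f p • fderivWithin ℝ (fun q => sliceNabla g (J ×ˢ V) U q (U q)) (J ×ˢ V) p (0, v)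
      + fderivWithin ℝ (sliceGradient g (J ×ˢ V) f) (J ×ˢ V) p (0, v)
      + fderivWithin ℝ (sliceChristoffel g (J ×ˢ V)) (J ×ˢ V) p (1, 0) v (U p)
      + sliceChristoffel g (J ×ˢ V) p v (timeDeriv U (J ×ˢ V) p) := by
  have hu := h.uniqueDiffOn p hp
  have hN := (h.smooth_sliceNabla h.smooth_U).differentiableOn (by simp) p hp
  have hΓ := h.smooth_sliceChristoffel.differentiableOn (by simp) p hp
  have hdU := (contDiffOn_spatialDeriv h.uniqueDiffOn h.smooth_U).differentiableOn (by simp) p hp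
  have hgr := h.smooth_sliceGradient.differentiableOn (by simp) p hp
  have hc : DifferentiableWithinAt ℝ (fun _ : ℝ × E => v) (J ×ˢ V) p :=
    differentiableWithinAt_const v
  have hacc := hN.clm_apply (h.differentiable_U hp)
  have e1 := fderivWithin_apply_field hu hN hc (1, 0)
  have e2 := fderivWithin_apply_fields hu hΓ hc (h.differentiable_U hp) (1, 0)
  have e3 := fderivWithin_apply_field hu hdU hc (1, 0)
  simp only [fderivWithin_fun_const, Pi.zero_apply, zero_apply, map_zero, add_zero] at e1 e2 e3
  rw [← e1]
  simp only [sliceNabla_apply] at e1 ⊢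
  -- Exchange `∂_t` with the spatial derivative of `U`, so that the evolution equation of `U` can be
  -- differentiated along `v`.
  rw [fderivWithin_fun_add hu (hdU.clm_apply hc) ((hΓ.clm_apply hc).clm_apply
    (h.differentiable_U hp)), add_apply, e2, e3,
    fderivWithin_spatialDeriv h.uniqueDiffOn h.smooth_U hp, fderivWithin_fderivWithin_comm
    h.uniqueDiffOn h.subset_closure_interior h.smooth_U hp,
    ← fderivWithin_timeDeriv h.uniqueDiffOn h.smooth_U hp,
    fderivWithin_congr h.evol_U (h.evol_U p hp)]
  rw [fderivWithin_fun_add hu ((h.differentiable_f hp).fun_neg.fun_smul hacc) hgr,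
    fderivWithin_fun_smul hu (h.differentiable_f hp).fun_neg hacc, fderivWithin_fun_neg hu]
  simp only [add_apply, smul_apply, ContinuousLinearMap.smulRight_apply, neg_apply,
    spatialDeriv_apply, timeDeriv, sliceNabla_apply]
  module

/-- The derivative of `v ↦ ∇_v U` along `U`, in terms of the curvature. -/
theorem spatialDeriv_sliceNabla (hp : p ∈ J ×ˢ V) (v : E) :
    fderivWithin ℝ (sliceNabla g (J ×ˢ V) U) (J ×ˢ V) p (0, U p) v =
      sliceCurvature g (J ×ˢ V) p (U p) v (U p)
      + fderivWithin ℝ (fun q => sliceNabla g (J ×ˢ V) U q (U q)) (J ×ˢ V) p (0, v)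
      + sliceChristoffel g (J ×ˢ V) p v (sliceNabla g (J ×ˢ V) U p (U p))
      - sliceChristoffel g (J ×ˢ V) p (U p) (sliceNabla g (J ×ˢ V) U p v)
      - sliceNabla g (J ×ˢ V) U p (spatialDeriv U (J ×ˢ V) p v) := by
  have hu := h.uniqueDiffOn p hp
  have hN := (h.smooth_sliceNabla h.smooth_U).differentiableOn (by simp) p hp
  have hΓ := h.smooth_sliceChristoffel.differentiableOn (by simp) p hp
  have hdU := (contDiffOn_spatialDeriv h.uniqueDiffOn h.smooth_U).differentiableOn (by simp) p hp
  have hU := h.differentiable_U hp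
  have key : ∀ a v : E, fderivWithin ℝ (sliceNabla g (J ×ˢ V) U) (J ×ˢ V) p (0, a) v =
      fderivWithin ℝ (fderivWithin ℝ U (J ×ˢ V)) (J ×ˢ V) p (0, a) (0, v)
      + fderivWithin ℝ (sliceChristoffel g (J ×ˢ V)) (J ×ˢ V) p (0, a) v (U p)
      + sliceChristoffel g (J ×ˢ V) p v (spatialDeriv U (J ×ˢ V) p a) := by
    intro a v
    have hc : DifferentiableWithinAt ℝ (fun _ : ℝ × E => v) (J ×ˢ V) p :=
      differentiableWithinAt_const v
    have e1 := fderivWithin_apply_field hu hN hc (0, a)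
    have e2 := fderivWithin_apply_fields hu hΓ hc hU (0, a)
    have e3 := fderivWithin_apply_field hu hdU hc (0, a)
    simp only [fderivWithin_fun_const, Pi.zero_apply, zero_apply, map_zero, add_zero] at e1 e2 e3
    rw [← e1]
    simp only [sliceNabla_apply]
    rw [fderivWithin_fun_add hu (hdU.clm_apply hc) ((hΓ.clm_apply hc).clm_apply hU), add_apply,
      e2, e3, fderivWithin_spatialDeriv h.uniqueDiffOn h.smooth_U hp, spatialDeriv_apply]
    abel
  -- Comparing `key` for `(U, v)` with `key` for `(v, U)`, the second derivatives of `U` agree; the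
  -- difference of the derivatives of the Christoffel symbols belongs to the curvature.
  rw [fderivWithin_apply_field hu hN hU, key, key, fderivWithin_fderivWithin_comm
    h.uniqueDiffOn h.subset_closure_interior h.smooth_U hp, ← spatialDeriv_apply U]
  simp only [sliceNabla_apply, sliceCurvature, map_add]
  rw [h.sliceChristoffel_symm hp (spatialDeriv U (J ×ˢ V) p v)]
  abel

/-- The mixed space-time curvature in terms of the slices. -/
theorem lorentzMetric_curvature_U (hp : p ∈ J ×ˢ V) (v w : E) :
    lorentzMetric f g p (curvature (lorentzMetric f g) (J ×ˢ V) p (1, 0) (0, v) (0, U p)) (0, w) =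
      g p (fderivWithin ℝ (sliceChristoffel g (J ×ˢ V)) (J ×ˢ V) p (1, 0) v (U p)) w
      + g p (fderivWithin ℝ (sliceGradient g (J ×ˢ V) f) (J ×ˢ V) p (0, v)) w
      + g p (sliceChristoffel g (J ×ˢ V) p v (sliceGradient g (J ×ˢ V) f p)) w
      + (1 / 2) * timeDeriv g (J ×ˢ V) p (sliceNabla g (J ×ˢ V) U p v) w
      - spatialDeriv f (J ×ˢ V) p v * spatialDeriv f (J ×ˢ V) p w / f p
      - spatialDeriv f (J ×ˢ V) p (U p) / (2 * f p) * timeDeriv g (J ×ˢ V) p v w := by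
  have hu := h.uniqueDiffOn p hp
  have hf := h.f_ne p hp
  have hr := h.smooth_metricRate.differentiableOn (by simp) p hp
  have hgr := h.smooth_sliceGradient.differentiableOn (by simp) p hp
  -- Differentiating the identity that the metric rate of `U` is `-2 grad f` trades the derivative
  -- of the metric rate for the Hessian of `f`.
  have e1 := fderivWithin_apply_field hu hr (h.differentiable_U hp) (0, v)
  rw [fderivWithin_congr (fun q hq => h.metricRate_U hq) (h.metricRate_U hp),
    fderivWithin_fun_const_smul hu hgr, smul_apply, ← spatialDeriv_apply U] at e1
  have e2 := congrArg (fun x => g p x w) e1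
  simp only [map_add, map_smul, add_apply, smul_apply, smul_eq_mul, h.metric_metricRate hp] at e2
  rw [h.lorentzMetric_curvature hp, h.rate_U_right hp, h.metricRate_U hp, sliceNabla_apply]
  simp only [map_add, map_smul, add_apply, smul_apply, smul_eq_mul]
  field_simp
  linear_combination f p * e2

/-- The derivative of `g(∇_A U, C)` along `∂_t + fU`. -/
theorem transport (hp : p ∈ J ×ˢ V) {A C : ℝ × E → E} (hA : DifferentiableWithinAt ℝ A (J ×ˢ V) p)
    (hC : DifferentiableWithinAt ℝ C (J ×ˢ V) p) :
    fderivWithin ℝ (fun q => g q (sliceNabla g (J ×ˢ V) U q (A q)) (C q)) (J ×ˢ V) p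
      (1, f p • U p) =
      lorentzMetric f g p (curvature (lorentzMetric f g) (J ×ˢ V) p (1, 0) (0, A p) (0, U p))
        (0, C p)
      + f p * g p (sliceCurvature g (J ×ˢ V) p (U p) (A p) (U p)) (C p)
      + (1 / 2) * timeDeriv g (J ×ˢ V) p (sliceNabla g (J ×ˢ V) U p (A p)) (C p)
      - spatialDeriv f (J ×ˢ V) p (A p) * g p (sliceNabla g (J ×ˢ V) U p (U p)) (C p)
      + spatialDeriv f (J ×ˢ V) p (A p) * spatialDeriv f (J ×ˢ V) p (C p) / f p
      + spatialDeriv f (J ×ˢ V) p (U p) / (2 * f p) * timeDeriv g (J ×ˢ V) p (A p) (C p)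
      - f p * g p (sliceNabla g (J ×ˢ V) U p (sliceNabla g (J ×ˢ V) U p (A p))) (C p)
      + g p (sliceNabla g (J ×ˢ V) U p (fderivWithin ℝ A (J ×ˢ V) p (1, f p • U p)
          + f p • sliceChristoffel g (J ×ˢ V) p (U p) (A p))) (C p)
      + g p (sliceNabla g (J ×ˢ V) U p (A p)) (fderivWithin ℝ C (J ×ˢ V) p (1, f p • U p)
          + f p • sliceChristoffel g (J ×ˢ V) p (U p) (C p)) := by
  have hu := h.uniqueDiffOn p hp
  have hN := (h.smooth_sliceNabla h.smooth_U).differentiableOn (by simp) p hp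
  rw [fderivWithin_apply_fields hu (h.differentiable_g hp) (hN.clm_apply hA) hC,
    fderivWithin_apply_field hu hN hA]
  rw [h.lorentzMetric_curvature_U hp]
  have eN : fderivWithin ℝ (sliceNabla g (J ×ˢ V) U) (J ×ˢ V) p (1, f p • U p) (A p) =
      fderivWithin ℝ (sliceNabla g (J ×ˢ V) U) (J ×ˢ V) p (1, 0) (A p)
      + f p • fderivWithin ℝ (sliceNabla g (J ×ˢ V) U) (J ×ˢ V) p (0, U p) (A p) := by
    rw [fderivWithin_eq_time_add_spatial]
    simp [timeDeriv, spatialDeriv_apply]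
  have eG : ∀ a b, fderivWithin ℝ g (J ×ˢ V) p (1, f p • U p) a b =
      timeDeriv g (J ×ˢ V) p a b + f p * (g p (sliceChristoffel g (J ×ˢ V) p (U p) a) b
        + g p a (sliceChristoffel g (J ×ˢ V) p (U p) b)) := by
    intro a b
    rw [fderivWithin_eq_time_add_spatial, ← h.spatialDeriv_metric hp]
    simp
  have eS : spatialDeriv U (J ×ˢ V) p (A p) = sliceNabla g (J ×ˢ V) U p (A p)
      - sliceChristoffel g (J ×ˢ V) p (U p) (A p) := by
    rw [sliceNabla_apply, h.sliceChristoffel_symm hp (U p)]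
    abel
  -- The terms `∓f ∇_v(∇_U U)` from the time and the space derivative cancel here, leaving no second
  -- derivative of `U`.
  rw [eN, eG, h.timeDeriv_sliceNabla hp, h.spatialDeriv_sliceNabla hp, h.evol_U p hp, eS]
  simp only [map_add, map_sub, map_smul, map_neg, add_apply, sub_apply, smul_apply, neg_apply,
    smul_eq_mul, neg_smul]
  ring

end EvolvingFields

end Evolution

/-! ### Orthonormal frames -/

section Frames

variable {E : Type*} [NormedAddCommGroup E] [NormedSpace ℝ E]

/-- The vectors `X, Y, N` are orthonormal for the bilinear form `B`. -/
structure IsFrame (B : E →L[ℝ] E →L[ℝ] ℝ) (X Y N : E) : Prop where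
  xx : B X X = 1
  yy : B Y Y = 1
  nn : B N N = 1
  xy : B X Y = 0
  xn : B X N = 0
  yn : B Y N = 0

variable [FiniteDimensional ℝ E]

/-- The component map to `ℝ³` is onto, as combinations of the frame show, hence injective by
equality of dimensions. -/
theorem IsFrame.expand {B : E →L[ℝ] E →L[ℝ] ℝ} {X Y N : E} (h : IsFrame B X Y N)
    (hE : Module.finrank ℝ E = 3) (hB : ∀ v w, B v w = B w v) (v : E) :
    v = B v X • X + B v Y • Y + B v N • N := by
  let φ : E →ₗ[ℝ] ℝ × ℝ × ℝ :=
    ((B.flip X : E →L[ℝ] ℝ) : E →ₗ[ℝ] ℝ).prod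
      (((B.flip Y : E →L[ℝ] ℝ) : E →ₗ[ℝ] ℝ).prod ((B.flip N : E →L[ℝ] ℝ) : E →ₗ[ℝ] ℝ))
  have hφ : ∀ z, φ z = (B z X, B z Y, B z N) := fun z => rfl
  have hyx := (hB Y X).trans h.xy
  have hnx := (hB N X).trans h.xn
  have hny := (hB N Y).trans h.yn
  have key : ∀ a b c : ℝ, φ (a • X + b • Y + c • N) = (a, b, c) := by
    intro a b c
    simp [hφ, h.xx, h.yy, h.nn, h.xy, h.xn, h.yn, hyx, hnx, hny]
  have hsurj : Function.Surjective φ := fun ⟨a, b, c⟩ => ⟨_, key a b c⟩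
  have hinj : Function.Injective φ :=
    (LinearMap.injective_iff_surjective_of_finrank_eq_finrank (by simp [hE])).2 hsurj
  exact hinj (by rw [key, hφ])

theorem exists_ne_zero_of_two (hE : Module.finrank ℝ E = 3) (η ξ : E →L[ℝ] ℝ) :
    ∃ v, v ≠ 0 ∧ η v = 0 ∧ ξ v = 0 := by
  have hker := LinearMap.ker_ne_bot_of_finrank_lt
    (f := (η : E →ₗ[ℝ] ℝ).prod (ξ : E →ₗ[ℝ] ℝ)) (by simp [hE])
  obtain ⟨v, hv, hne⟩ := Submodule.exists_mem_ne_zero_of_ne_bot hker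
  have : (η v, ξ v) = 0 := hv
  exact ⟨v, hne, congrArg Prod.fst this, congrArg Prod.snd this⟩

omit [FiniteDimensional ℝ E] in
theorem normalize_apply {B : E →L[ℝ] E →L[ℝ] ℝ} {v : E} (hv : 0 < B v v) :
    B ((√(B v v))⁻¹ • v) ((√(B v v))⁻¹ • v) = 1 := by
  have h2 := Real.mul_self_sqrt hv.le
  have h3 := (Real.sqrt_pos.2 hv).ne'
  simp only [map_smul, smul_apply, smul_eq_mul]
  field_simp
  rw [sq, h2]

theorem exists_isFrame (hE : Module.finrank ℝ E = 3) {B : E →L[ℝ] E →L[ℝ] ℝ}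
    (hB : ∀ v w, B v w = B w v) (hpos : ∀ v, v ≠ 0 → 0 < B v v) {N : E} (hN : B N N = 1) :
    ∃ X Y, IsFrame B X Y N := by
  obtain ⟨v, hv, hv1, -⟩ := exists_ne_zero_of_two hE (B N) (B N)
  obtain ⟨w, hw, hw1, hw2⟩ := exists_ne_zero_of_two hE (B N) (B v)
  refine ⟨(√(B v v))⁻¹ • v, (√(B w w))⁻¹ • w, normalize_apply (hpos v hv),
    normalize_apply (hpos w hw), hN, ?_, ?_, ?_⟩
  · simp [hw2]
  · simp [hB v N, hv1]
  · simp [hB w N, hw1]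

end Frames

/-! ### Smooth local orthonormal frames adapted to `U` -/

section FrameFields

variable {E : Type*} [NormedAddCommGroup E] [NormedSpace ℝ E] [FiniteDimensional ℝ E]
  {J : Set ℝ} {V : Set E} {f : ℝ × E → ℝ} {g : ℝ × E → E →L[ℝ] E →L[ℝ] ℝ} {U : ℝ × E → E}

omit [FiniteDimensional ℝ E] in
theorem contDiffOn_normalize {S : Set (ℝ × E)} (hg : ContDiffOn ℝ ∞ g S) {A : ℝ × E → E}
    (hA : ContDiffOn ℝ ∞ A S) (hpos : ∀ q ∈ S, 0 < g q (A q) (A q)) :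
    ContDiffOn ℝ ∞ (fun q => (√(g q (A q) (A q)))⁻¹ • A q) S := by
  have h1 : ContDiffOn ℝ ∞ (fun q => g q (A q) (A q)) S := (hg.clm_apply hA).clm_apply hA
  exact ((h1.sqrt fun q hq => (hpos q hq).ne').inv
    fun q hq => (Real.sqrt_pos.2 (hpos q hq)).ne').smul hA

/-- Gram–Schmidt applied to a frame frozen at `p`, relative to the moving `U` and `g`. At `p` it
changes nothing, so the vectors to be normalized stay nonzero nearby. -/
theorem SlicedFields.exists_frame_fields (h : SlicedFields J V f g U)
    (hE : Module.finrank ℝ E = 3) {p : ℝ × E} (hp : p ∈ J ×ˢ V) :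
    ∃ (X Y : ℝ × E → E) (O : Set (ℝ × E)), IsOpen O ∧ p ∈ O ∧ ContDiffOn ℝ ∞ X (J ×ˢ V ∩ O) ∧
      ContDiffOn ℝ ∞ Y (J ×ˢ V ∩ O) ∧
      ∀ q ∈ J ×ˢ V ∩ O, IsFrame (g q) (X q) (Y q) (U q) := by
  obtain ⟨X₀, Y₀, hF⟩ := exists_isFrame hE (h.symm p hp) (h.pos p hp) (h.unit p hp)
  have hUX := (h.symm p hp (U p) X₀).trans hF.xn
  have hUY := (h.symm p hp (U p) Y₀).trans hF.yn
  let X₁ : ℝ × E → E := fun q => X₀ - g q X₀ (U q) • U q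
  have hX₁ : ContDiffOn ℝ ∞ X₁ (J ×ˢ V) := contDiffOn_const.sub
    (((h.smooth_g.clm_apply contDiffOn_const).clm_apply h.smooth_U).smul h.smooth_U)
  have hX₁p : X₁ p = X₀ := by simp [X₁, hF.xn]
  -- The fields are controlled only on `S`, so the positivity set is described as the trace on `S`
  -- of an ambient open set.
  have relOpen : ∀ {S : Set (ℝ × E)} {A : ℝ × E → E}, S ⊆ J ×ˢ V → ContDiffOn ℝ ∞ A S →
      ∃ O, IsOpen O ∧ ∀ q ∈ S, q ∈ O ↔ 0 < g q (A q) (A q) := by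
    intro S A hS hA
    have hc : ContinuousOn (fun q => g q (A q) (A q)) S :=
      (((h.smooth_g.mono hS).clm_apply hA).clm_apply hA).continuousOn
    obtain ⟨O, hO, hO'⟩ := continuousOn_iff'.1 hc (Ioi 0) isOpen_Ioi
    refine ⟨O, hO, fun q hq => ?_⟩
    have := Set.ext_iff.1 hO' q
    simp only [mem_inter_iff, mem_preimage, mem_Ioi, hq, and_true] at this
    exact this.symm
  obtain ⟨O₁, hO₁, hO₁'⟩ := relOpen Subset.rfl hX₁
  let X : ℝ × E → E := fun q => (√(g q (X₁ q) (X₁ q)))⁻¹ • X₁ q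
  have hX : ContDiffOn ℝ ∞ X (J ×ˢ V ∩ O₁) :=
    contDiffOn_normalize (h.smooth_g.mono inter_subset_left) (hX₁.mono inter_subset_left)
      fun q hq => (hO₁' q hq.1).1 hq.2
  have hXp : X p = X₀ := by simp [X, hX₁p, hF.xx]
  let Y₁ : ℝ × E → E := fun q => Y₀ - g q Y₀ (U q) • U q - g q Y₀ (X q) • X q
  have hg' := h.smooth_g.mono (inter_subset_left (t := O₁))
  have hU' := h.smooth_U.mono (inter_subset_left (t := O₁))
  have hY₁ : ContDiffOn ℝ ∞ Y₁ (J ×ˢ V ∩ O₁) :=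
    (contDiffOn_const.sub (((hg'.clm_apply contDiffOn_const).clm_apply hU').smul hU')).sub
      (((hg'.clm_apply contDiffOn_const).clm_apply hX).smul hX)
  have hY₁p : Y₁ p = Y₀ := by
    simp [Y₁, hXp, hF.yn, (h.symm p hp Y₀ X₀).trans hF.xy]
  obtain ⟨O₂, hO₂, hO₂'⟩ := relOpen inter_subset_left hY₁
  have hpO₁ : p ∈ O₁ := (hO₁' p hp).2 (by rw [hX₁p, hF.xx]; exact one_pos)
  let Y : ℝ × E → E := fun q => (√(g q (Y₁ q) (Y₁ q)))⁻¹ • Y₁ q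
  have hY : ContDiffOn ℝ ∞ Y (J ×ˢ V ∩ O₁ ∩ O₂) :=
    contDiffOn_normalize (hg'.mono inter_subset_left) (hY₁.mono inter_subset_left)
      fun q hq => (hO₂' q hq.1).1 hq.2
  refine ⟨X, Y, O₁ ∩ O₂, hO₁.inter hO₂, ⟨hpO₁, (hO₂' p ⟨hp, hpO₁⟩).2 ?_⟩,
    hX.mono fun q hq => ⟨hq.1, hq.2.1⟩, hY.mono fun q hq => ⟨⟨hq.1, hq.2.1⟩, hq.2.2⟩, ?_⟩
  · rw [hY₁p, hF.yy]; exact one_pos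
  rintro q ⟨hq, hq1, hq2⟩
  have pX := (hO₁' q hq).1 hq1
  have pY := (hO₂' q ⟨hq, hq1⟩).1 hq2
  have xx : g q (X q) (X q) = 1 := normalize_apply pX
  have xn1 : g q (X₁ q) (U q) = 0 := by simp [X₁, h.unit q hq]
  have xn : g q (X q) (U q) = 0 := by simp [X, xn1]
  have nx : g q (U q) (X q) = 0 := (h.symm q hq _ _).trans xn
  have yx : g q (Y₁ q) (X q) = 0 := by simp [Y₁, xx, nx]
  have yn1 : g q (Y₁ q) (U q) = 0 := by simp [Y₁, xn, h.unit q hq]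
  exact ⟨xx, normalize_apply pY, h.unit q hq, by simp [Y, h.symm q hq (X q), yx], xn,
    by simp [Y, yn1]⟩

end FrameFields

/-! ### The transport equation of the shear -/

section Transport

variable {E : Type*} [NormedAddCommGroup E] [NormedSpace ℝ E] [FiniteDimensional ℝ E]
  {J : Set ℝ} {V : Set E} {f : ℝ × E → ℝ} {g : ℝ × E → E →L[ℝ] E →L[ℝ] ℝ} {U : ℝ × E → E}

/-- The covariant derivative of `A` along `∂_t + fU` with respect to the slice metrics. -/
def nullNabla (J : Set ℝ) (V : Set E) (f : ℝ × E → ℝ) (g : ℝ × E → E →L[ℝ] E →L[ℝ] ℝ)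
    (U A : ℝ × E → E) (p : ℝ × E) : E :=
  fderivWithin ℝ A (J ×ˢ V) p (1, f p • U p) + f p • sliceChristoffel g (J ×ˢ V) p (U p) (A p)

namespace EvolvingFields

variable (h : EvolvingFields J V f g U) {p : ℝ × E}
include h

/-- The slice connection is metric only within a slice; the term with `∂_t g` measures its failure
along `∂_t + fU`. -/
theorem fderivWithin_metric_apply (hp : p ∈ J ×ˢ V) {A C : ℝ × E → E}
    (hA : DifferentiableWithinAt ℝ A (J ×ˢ V) p) (hC : DifferentiableWithinAt ℝ C (J ×ˢ V) p) :
    fderivWithin ℝ (fun q => g q (A q) (C q)) (J ×ˢ V) p (1, f p • U p) =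
      timeDeriv g (J ×ˢ V) p (A p) (C p) + g p (nullNabla J V f g U A p) (C p)
        + g p (A p) (nullNabla J V f g U C p) := by
  rw [fderivWithin_apply_fields (h.uniqueDiffOn p hp) (h.differentiable_g hp) hA hC,
    fderivWithin_eq_time_add_spatial]
  simp only [nullNabla, add_apply, smul_apply, map_add, map_smul, smul_eq_mul, one_smul]
  rw [h.spatialDeriv_metric hp]
  ring

omit [FiniteDimensional ℝ E] in
-- The term `-f ∇_U U` in the evolution of `U` cancels the spatial part of the derivative along
-- `fU`.
theorem nullNabla_U (hp : p ∈ J ×ˢ V) : nullNabla J V f g U U p = sliceGradient g (J ×ˢ V) f p := by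
  rw [nullNabla, fderivWithin_eq_time_add_spatial, h.evol_U p hp, sliceNabla_apply, map_smul]
  module

/-- Differentiate `g(U, U) = 1`. -/
theorem sliceNabla_orthogonal (hp : p ∈ J ×ˢ V) (v : E) :
    g p (sliceNabla g (J ×ˢ V) U p v) (U p) = 0 := by
  have hU := h.differentiable_U hp
  have hu := h.uniqueDiffOn p hp
  have e1 := fderivWithin_apply_fields hu (h.differentiable_g hp) hU hU (0, v)
  rw [fderivWithin_congr (f := fun _ => (1 : ℝ)) h.unit (h.unit p hp),
    ← spatialDeriv_apply g, ← spatialDeriv_apply U, h.spatialDeriv_metric hp] at e1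
  simp only [fderivWithin_fun_const, Pi.zero_apply, zero_apply] at e1
  rw [sliceNabla_apply, map_add, add_apply]
  rw [h.symm p hp (U p), h.symm p hp (U p)] at e1
  linarith

/-- The shear of `U` in the frame `X, Y` satisfies a linear equation along `∂_t + fU`. -/
theorem shear_transport (hE : Module.finrank ℝ E = 3) (hp : p ∈ J ×ˢ V) {X Y : ℝ × E → E}
    (hX : DifferentiableWithinAt ℝ X (J ×ˢ V) p) (hY : DifferentiableWithinAt ℝ Y (J ×ˢ V) p)
    (hF : ∀ᶠ q in nhdsWithin p (J ×ˢ V), IsFrame (g q) (X q) (Y q) (U q))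
    {B : ℝ × E → E → E → ℝ} (hB : B = fun q v w => g q (sliceNabla g (J ×ˢ V) U q v) w)
    {m r : E → E → ℝ}
    (hm : m = fun v w => lorentzMetric f g p
      (curvature (lorentzMetric f g) (J ×ˢ V) p (1, 0) (0, v) (0, U p)) (0, w))
    (hr : r = fun v w => g p (sliceCurvature g (J ×ˢ V) p (U p) v (U p)) w)
    {τ : E → E → ℝ} (hτ : τ = fun v w => timeDeriv g (J ×ˢ V) p v w) {d : E → ℝ}
    (hd : d = fun v => spatialDeriv f (J ×ˢ V) p v)
    (hre : -(1 / 4) * ((τ (X p) (X p) - τ (Y p) (Y p)) *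
          (B p (X p) (X p) + B p (Y p) (Y p) - 2 * (d (U p) / f p))
        + 2 * τ (X p) (Y p) * (B p (Y p) (X p) - B p (X p) (Y p)))
        + (d (X p) ^ 2 - d (Y p) ^ 2) / f p
        + (f p * (r (X p) (X p) - r (Y p) (Y p)) + (m (X p) (X p) - m (Y p) (Y p))) = 0)
    (him : -(1 / 4) * ((τ (X p) (X p) - τ (Y p) (Y p)) * (B p (Y p) (X p) - B p (X p) (Y p))
        - 2 * τ (X p) (Y p) * (B p (X p) (X p) + B p (Y p) (Y p) - 2 * (d (U p) / f p)))
        - 2 * (d (X p) * d (Y p)) / f p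
        - (f p * (r (X p) (Y p) + r (Y p) (X p)) + (m (X p) (Y p) + m (Y p) (X p))) = 0) :
    DifferentiableWithinAt ℝ (fun q => (B q (X q) (X q) - B q (Y q) (Y q)) ^ 2
        + (B q (X q) (Y q) + B q (Y q) (X q)) ^ 2) (J ×ˢ V) p ∧
    fderivWithin ℝ (fun q => (B q (X q) (X q) - B q (Y q) (Y q)) ^ 2
        + (B q (X q) (Y q) + B q (Y q) (X q)) ^ 2) (J ×ˢ V) p (1, f p • U p) =
      2 * (-(1 / 4) * (τ (X p) (X p) + τ (Y p) (Y p))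
          - f p * (B p (X p) (X p) + B p (Y p) (Y p))) *
        ((B p (X p) (X p) - B p (Y p) (Y p)) ^ 2 + (B p (X p) (Y p) + B p (Y p) (X p)) ^ 2) := by
  have hu := h.uniqueDiffOn p hp
  have hU := h.differentiable_U hp
  have hF0 : IsFrame (g p) (X p) (Y p) (U p) := hF.self_of_nhdsWithin hp
  have hN := (h.smooth_sliceNabla h.smooth_U).differentiableOn (by simp) p hp
  have hf := h.f_ne p hp
  have hsym := h.symm p hp
  -- derivatives of the orthonormality relations
  have const : ∀ {A C : ℝ × E → E} {c : ℝ}, DifferentiableWithinAt ℝ A (J ×ˢ V) p →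
      DifferentiableWithinAt ℝ C (J ×ˢ V) p → g p (A p) (C p) = c →
      (∀ᶠ q in nhdsWithin p (J ×ˢ V), g q (A q) (C q) = c) →
      timeDeriv g (J ×ˢ V) p (A p) (C p) + g p (nullNabla J V f g U A p) (C p)
        + g p (nullNabla J V f g U C p) (A p) = 0 := by
    intro A C c hA hC hpc hev
    have e1 := h.fderivWithin_metric_apply hp hA hC
    rw [Filter.EventuallyEq.fderivWithin_eq (f₁ := fun q => g q (A q) (C q)) (f := fun _ => c)
      hev hpc] at e1
    simp only [fderivWithin_fun_const, Pi.zero_apply, zero_apply] at e1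
    rw [hsym (nullNabla J V f g U C p), ← e1]
  have cxx := const hX hX hF0.xx (hF.mono fun q hq => hq.xx)
  have cyy := const hY hY hF0.yy (hF.mono fun q hq => hq.yy)
  have cxy := const hX hY hF0.xy (hF.mono fun q hq => hq.xy)
  have cxn := const hX hU hF0.xn (hF.mono fun q hq => hq.xn)
  have cyn := const hY hU hF0.yn (hF.mono fun q hq => hq.yn)
  rw [h.nullNabla_U hp, h.metric_sliceGradient hp, h.rate_U_right hp] at cxn cyn
  -- expansions in the frame
  have eNX := hF0.expand hE hsym (sliceNabla g (J ×ˢ V) U p (X p))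
  have eNY := hF0.expand hE hsym (sliceNabla g (J ×ˢ V) U p (Y p))
  rw [h.sliceNabla_orthogonal hp, zero_smul, add_zero] at eNX eNY
  have eDX := hF0.expand hE hsym (nullNabla J V f g U X p)
  have eDY := hF0.expand hE hsym (nullNabla J V f g U Y p)
  -- transport of the components
  have tr : ∀ {A C : ℝ × E → E}, DifferentiableWithinAt ℝ A (J ×ˢ V) p →
      DifferentiableWithinAt ℝ C (J ×ˢ V) p →
      HasFDerivWithinAt (fun q => B q (A q) (C q))
        (fderivWithin ℝ (fun q => B q (A q) (C q)) (J ×ˢ V) p) (J ×ˢ V) p ∧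
      fderivWithin ℝ (fun q => B q (A q) (C q)) (J ×ˢ V) p (1, f p • U p) =
        m (A p) (C p) + f p * r (A p) (C p)
        + (1 / 2) * τ (sliceNabla g (J ×ˢ V) U p (A p)) (C p)
        - d (A p) * B p (U p) (C p) + d (A p) * d (C p) / f p
        + d (U p) / (2 * f p) * τ (A p) (C p)
        - f p * B p (sliceNabla g (J ×ˢ V) U p (A p)) (C p)
        + B p (nullNabla J V f g U A p) (C p) + B p (A p) (nullNabla J V f g U C p) := by
    intro A C hA hC
    subst hB hm hr hτ hd
    exact ⟨(((h.differentiable_g hp).clm_apply (hN.clm_apply hA)).clm_apply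
      hC).hasFDerivWithinAt, h.transport hp hA hC⟩
  obtain ⟨dxx, txx⟩ := tr hX hX
  obtain ⟨dyy, tyy⟩ := tr hY hY
  obtain ⟨dxy, txy⟩ := tr hX hY
  obtain ⟨dyx, tyx⟩ := tr hY hX
  have hW := ((dxx.sub dyy).pow 2).add ((dxy.add dyx).pow 2)
  refine ⟨hW.differentiableWithinAt, ?_⟩
  have hW' := congrArg (fun L : ℝ × E →L[ℝ] ℝ => L (1, f p • U p)) (hW.fderivWithin hu)
  refine Eq.trans hW' ?_
  clear hW hW' dxx dyy dxy dyx tr const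
  -- From here `B`, `m`, `r`, `τ`, `d` enter only through linearity, symmetry of `τ` and `B(·, U) =
  -- 0`, so the goal reduces to a polynomial identity in their values on the frame.
  have τs : ∀ v w, τ v w = τ w v := by
    intro v w; rw [hτ]; exact h.timeDeriv_metric_symm hp v w
  have τadd : ∀ a b c v w, τ (a • v + b • w) c = a * τ v c + b * τ w c := by
    intro a b c v w; simp [hτ]
  have Badd : ∀ a b c v w, B p (a • v + b • w) c = a * B p v c + b * B p w c := by
    intro a b c v w; simp [hB]
  have Badd3 : ∀ a b e c v w z, B p (a • v + b • w + e • z) c =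
      a * B p v c + b * B p w c + e * B p z c := by
    intro a b e c v w z; simp [hB]
  have Badd3' : ∀ a b e c v w z, B p c (a • v + b • w + e • z) =
      a * B p c v + b * B p c w + e * B p c z := by
    intro a b e c v w z; simp [hB]
  have BU : ∀ v, B p v (U p) = 0 := by
    intro v; rw [hB]; exact h.sliceNabla_orthogonal hp v
  have gB : ∀ v w, g p (sliceNabla g (J ×ˢ V) U p v) w = B p v w := fun v w => by rw [hB]
  have gτ : ∀ v w, timeDeriv g (J ×ˢ V) p v w = τ v w := fun v w => by rw [hτ]
  have gd : ∀ v, spatialDeriv f (J ×ˢ V) p v = d v := fun v => by rw [hd]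
  simp only [gτ] at cxx cyy cxy
  simp only [gd] at cxn cyn
  simp only [gB] at eNX eNY
  rw [eNX, eDX] at txx
  rw [eNY, eDY] at tyy
  rw [eNX, eDX, eDY] at txy
  rw [eNY, eDX, eDY] at tyx
  simp only [τadd, Badd, Badd3, Badd3', BU, mul_zero, add_zero] at txx tyy txy tyx
  simp only [add_apply, sub_apply, smul_apply, smul_eq_mul, txx, tyy, txy, tyx,
    Pi.add_apply, Pi.sub_apply, Nat.add_one_sub_one, pow_one]
  clear txx tyy txy tyx eNX eNY eDX eDY
  rw [τs (Y p) (X p)]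
  -- The differentiated orthonormality relations fix the derivatives of `X` and `Y` up to the
  -- rotation rate `g(∇X, Y)`, which changes only the phase of `σ` and drops out of `|σ|²`.
  have nxn : g p (nullNabla J V f g U X p) (U p) = d (X p) := by linarith
  have nyn : g p (nullNabla J V f g U Y p) (U p) = d (Y p) := by linarith
  have nxx : g p (nullNabla J V f g U X p) (X p) = -(1 / 2) * τ (X p) (X p) := by linarith
  have nyy : g p (nullNabla J V f g U Y p) (Y p) = -(1 / 2) * τ (Y p) (Y p) := by linarith
  have nyx : g p (nullNabla J V f g U Y p) (X p) = -τ (X p) (Y p)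
    - g p (nullNabla J V f g U X p) (Y p) := by linarith
  rw [nxn, nyn, nxx, nyy, nyx]
  -- With `σ = (B(X,X) - B(Y,Y)) - i(B(X,Y) + B(Y,X))`, this is twice the real part of the conjugate
  -- of `σ` times the quadratic expression, whose real and imaginary parts are `hre` and `him`.
  linear_combination (2 * (B p (X p) (X p) - B p (Y p) (Y p))) * hre
    - (2 * (B p (X p) (Y p) + B p (Y p) (X p))) * him

end EvolvingFields

end Transport

/-! ### The shear in a coordinate domain -/

section Shear

variable {E : Type*} [NormedAddCommGroup E] [NormedSpace ℝ E]

/-- The Lie derivative `ℒ_U g` of the slice metrics. -/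
def lieForm (g : ℝ × E → E →L[ℝ] E →L[ℝ] ℝ) (S : Set (ℝ × E)) (U : ℝ × E → E) (q : ℝ × E)
    (v w : E) : ℝ :=
  spatialDeriv g S q (U q) v w + g q (spatialDeriv U S q v) w + g q v (spatialDeriv U S q w)

/-- The squared norm of the trace-free part of a form on the plane spanned by `X, Y`. -/
def shearNorm (l : E → E → ℝ) (X Y : E) : ℝ := (l X X - l Y Y) ^ 2 + 4 * l X Y ^ 2

omit [NormedAddCommGroup E] [NormedSpace ℝ E] in
theorem shearNorm_nonneg (l : E → E → ℝ) (X Y : E) : 0 ≤ shearNorm l X Y := by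
  unfold shearNorm; positivity

variable [FiniteDimensional ℝ E]

/-- The norm of the shear does not depend on the frame. -/
theorem shearNorm_eq (hE : Module.finrank ℝ E = 3) {B : E →L[ℝ] E →L[ℝ] ℝ}
    (hB : ∀ v w, B v w = B w v) {X Y X' Y' N : E} (h : IsFrame B X Y N) (h' : IsFrame B X' Y' N)
    {l : E → E → ℝ} (hl : ∀ v w, l v w = l w v)
    (hadd : ∀ a b v w z, l (a • v + b • w) z = a * l v z + b * l w z) :
    shearNorm l X' Y' = shearNorm l X Y := by
  have e1 := h.expand hE hB X'
  have e2 := h.expand hE hB Y'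
  rw [h'.xn, zero_smul, add_zero] at e1
  rw [h'.yn, zero_smul, add_zero] at e2
  set a := B X' X
  set b := B X' Y
  set c := B Y' X
  set d := B Y' Y
  have hadd' : ∀ a b v w z, l z (a • v + b • w) = a * l z v + b * l z w := fun a b v w z => by
    rw [hl, hadd, hl v, hl w]
  have hyx := (hB Y X).trans h.xy
  have r1 : a ^ 2 + b ^ 2 = 1 := by
    have := h'.xx
    rw [e1] at this
    simp only [map_add, map_smul, add_apply, smul_apply, smul_eq_mul, h.xx, h.yy, h.xy, hyx] at this
    linarith
  have r2 : c ^ 2 + d ^ 2 = 1 := by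
    have := h'.yy
    rw [e2] at this
    simp only [map_add, map_smul, add_apply, smul_apply, smul_eq_mul, h.xx, h.yy, h.xy, hyx] at this
    linarith
  have r3 : a * c + b * d = 0 := by
    have := h'.xy
    rw [e1, e2] at this
    simp only [map_add, map_smul, add_apply, smul_apply, smul_eq_mul, h.xx, h.yy, h.xy, hyx] at this
    linarith
  -- The change of frame lies in `O(2)`; its determinant `s` is `±1` and determines the second row
  -- from the first.
  obtain ⟨s, hs, hc, hd⟩ : ∃ s : ℝ, s ^ 2 = 1 ∧ c = -s * b ∧ d = s * a := by
    refine ⟨a * d - b * c, ?_, ?_, ?_⟩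
    · linear_combination (c ^ 2 + d ^ 2) * r1 + r2 - (a * c + b * d) * r3
    · linear_combination (-c) * r1 + a * r3
    · linear_combination (-d) * r1 + b * r3
  unfold shearNorm
  rw [e1, e2]
  simp only [hadd, hadd', hl Y X, hc, hd]
  -- A rotation of the frame turns the vector `(l(X,X) - l(Y,Y), 2 l(X,Y))` by twice the angle,
  -- whence the factor `(a² + b²)²`. The sign `s` is dealt with by `k1` and `k2`.
  have key : (a * (a * l X X + b * l X Y) + b * (a * l X Y + b * l Y Y)
      - (b * (b * l X X - a * l X Y) - a * (b * l X Y - a * l Y Y))) ^ 2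
      + 4 * (a * (-b * l X X + a * l X Y) + b * (-b * l X Y + a * l Y Y)) ^ 2 =
      (a ^ 2 + b ^ 2) ^ 2 * ((l X X - l Y Y) ^ 2 + 4 * l X Y ^ 2) := by ring
  rw [r1, one_pow, one_mul] at key
  rw [← key]
  have k1 : -s * b * (-s * b * l X X + s * a * l X Y) + s * a * (-s * b * l X Y + s * a * l Y Y) =
      s ^ 2 * (b * (b * l X X - a * l X Y) - a * (b * l X Y - a * l Y Y)) := by ring
  have k2 : a * (-s * b * l X X + s * a * l X Y) + b * (-s * b * l X Y + s * a * l Y Y) =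
      s * (a * (-b * l X X + a * l X Y) + b * (-b * l X Y + a * l Y Y)) := by ring
  rw [k1, k2, hs, one_mul, mul_pow, hs, one_mul]

variable {J : Set ℝ} {V : Set E} {f : ℝ × E → ℝ} {g : ℝ × E → E →L[ℝ] E →L[ℝ] ℝ} {U : ℝ × E → E}

theorem SlicedFields.lieForm_eq (h : SlicedFields J V f g U) {p : ℝ × E} (hp : p ∈ J ×ˢ V)
    (v w : E) : lieForm g (J ×ˢ V) U p v w =
      g p (sliceNabla g (J ×ˢ V) U p v) w + g p (sliceNabla g (J ×ˢ V) U p w) v := by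
  rw [lieForm, h.spatialDeriv_metric hp, sliceNabla_apply, sliceNabla_apply,
    h.symm p hp v, h.symm p hp v, h.sliceChristoffel_symm hp v, h.sliceChristoffel_symm hp w]
  simp only [map_add, add_apply]
  ring

theorem SlicedFields.lieForm_symm (h : SlicedFields J V f g U) {p : ℝ × E} (hp : p ∈ J ×ˢ V)
    (v w : E) : lieForm g (J ×ˢ V) U p v w = lieForm g (J ×ˢ V) U p w v := by
  rw [h.lieForm_eq hp, h.lieForm_eq hp, add_comm]

omit [FiniteDimensional ℝ E] in
theorem lieForm_combination (S : Set (ℝ × E)) (p : ℝ × E) (a b : ℝ) (v w z : E) :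
    lieForm g S U p (a • v + b • w) z = a * lieForm g S U p v z + b * lieForm g S U p w z := by
  simp only [lieForm, map_add, map_smul, add_apply, smul_apply, smul_eq_mul]
  ring

/-- The real form of the quadratic condition, at the point `p`. -/
def QuadAt (J : Set ℝ) (V : Set E) (f : ℝ × E → ℝ) (g : ℝ × E → E →L[ℝ] E →L[ℝ] ℝ) (U : ℝ × E → E)
    (p : ℝ × E) : Prop :=
  ∀ X Y, IsFrame (g p) X Y (U p) →
    ∀ {B m r τ : E → E → ℝ} {d : E → ℝ}, (B = fun v w => g p (sliceNabla g (J ×ˢ V) U p v) w) →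
    (m = fun v w => lorentzMetric f g p
      (curvature (lorentzMetric f g) (J ×ˢ V) p (1, 0) (0, v) (0, U p)) (0, w)) →
    (r = fun v w => g p (sliceCurvature g (J ×ˢ V) p (U p) v (U p)) w) →
    (τ = fun v w => timeDeriv g (J ×ˢ V) p v w) → (d = fun v => spatialDeriv f (J ×ˢ V) p v) →
    (-(1 / 4) * ((τ X X - τ Y Y) * (B X X + B Y Y - 2 * (d (U p) / f p))
        + 2 * τ X Y * (B Y X - B X Y)) + (d X ^ 2 - d Y ^ 2) / f p
        + (f p * (r X X - r Y Y) + (m X X - m Y Y)) = 0) ∧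
    (-(1 / 4) * ((τ X X - τ Y Y) * (B Y X - B X Y)
        - 2 * τ X Y * (B X X + B Y Y - 2 * (d (U p) / f p))) - 2 * (d X * d Y) / f p
        - (f p * (r X Y + r Y X) + (m X Y + m Y X)) = 0)

/-- Locally, the norm of the shear grows at most exponentially along `∂_t + fU`. -/
theorem EvolvingFields.shear_estimate (h : EvolvingFields J V f g U)
    (hE : Module.finrank ℝ E = 3) (hQ : ∀ p ∈ J ×ˢ V, QuadAt J V f g U p) {W : ℝ × E → ℝ}
    (hW : ∀ q ∈ J ×ˢ V, ∀ X Y, IsFrame (g q) X Y (U q) →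
      W q = shearNorm (lieForm g (J ×ˢ V) U q) X Y) {p₀ : ℝ × E} (hp₀ : p₀ ∈ J ×ˢ V) :
    ∃ C : ℝ, ∀ᶠ p in nhdsWithin p₀ (J ×ˢ V), DifferentiableWithinAt ℝ W (J ×ˢ V) p ∧
      fderivWithin ℝ W (J ×ˢ V) p (1, f p • U p) ≤ C * W p := by
  obtain ⟨X, Y, O, hO, hp₀O, hX, hY, hF⟩ := h.exists_frame_fields hE hp₀
  set B : ℝ × E → E → E → ℝ := fun q v w => g q (sliceNabla g (J ×ˢ V) U q v) w with hB
  let κ : ℝ × E → ℝ := fun p => -(1 / 4) * (timeDeriv g (J ×ˢ V) p (X p) (X p)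
      + timeDeriv g (J ×ˢ V) p (Y p) (Y p)) - f p * (B p (X p) (X p) + B p (Y p) (Y p))
  have hmono : ∀ {F : Type _} [NormedAddCommGroup F] [NormedSpace ℝ F] {Q : ℝ × E → F},
      ContDiffOn ℝ ∞ Q (J ×ˢ V) → ContDiffOn ℝ ∞ Q (J ×ˢ V ∩ O) := fun hQ =>
    hQ.mono inter_subset_left
  have hN := hmono (h.smooth_sliceNabla h.smooth_U)
  have hg' := hmono (contDiffOn_timeDeriv h.uniqueDiffOn h.smooth_g)
  have hg := hmono h.smooth_g
  have hκ : ContDiffOn ℝ ∞ κ (J ×ˢ V ∩ O) :=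
    (contDiffOn_const.mul (((hg'.clm_apply hX).clm_apply hX).add
      ((hg'.clm_apply hY).clm_apply hY))).sub ((h.smooth_f.mono inter_subset_left).mul
      (((hg.clm_apply (hN.clm_apply hX)).clm_apply hX).add
        ((hg.clm_apply (hN.clm_apply hY)).clm_apply hY)))
  -- The exact growth rate of `W` is `2κ`. By continuity `κ < κ(p₀) + 1` near `p₀`, and `W ≥ 0`
  -- preserves the inequality.
  refine ⟨2 * (κ p₀ + 1), ?_⟩
  have hbd : ∀ᶠ p in nhdsWithin p₀ (J ×ˢ V), κ p < κ p₀ + 1 := by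
    have h1 := (hκ.continuousOn p₀ ⟨hp₀, hp₀O⟩).eventually_lt_const (lt_add_one (κ p₀))
    rwa [nhdsWithin_inter_of_mem' (mem_nhdsWithin_of_mem_nhds (hO.mem_nhds hp₀O))] at h1
  filter_upwards [hbd, self_mem_nhdsWithin, mem_nhdsWithin_of_mem_nhds (hO.mem_nhds hp₀O)]
    with p hpκ hp hpO
  have hO' : O ∈ nhdsWithin p (J ×ˢ V) := mem_nhdsWithin_of_mem_nhds (hO.mem_nhds hpO)
  have hXp : DifferentiableWithinAt ℝ X (J ×ˢ V) p :=
    (differentiableWithinAt_inter (hO.mem_nhds hpO)).1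
      (hX.differentiableOn (by simp) p ⟨hp, hpO⟩)
  have hYp : DifferentiableWithinAt ℝ Y (J ×ˢ V) p :=
    (differentiableWithinAt_inter (hO.mem_nhds hpO)).1
      (hY.differentiableOn (by simp) p ⟨hp, hpO⟩)
  have hFp : ∀ᶠ q in nhdsWithin p (J ×ˢ V), IsFrame (g q) (X q) (Y q) (U q) := by
    filter_upwards [hO', self_mem_nhdsWithin] with q hq hq' using hF q ⟨hq', hq⟩
  obtain ⟨q1, q2⟩ := hQ p hp (X p) (Y p) (hF p ⟨hp, hpO⟩) rfl rfl rfl rfl rfl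
  obtain ⟨D1, D2⟩ := h.shear_transport hE hp hXp hYp hFp hB rfl rfl rfl rfl q1 q2
  have heq : ∀ q ∈ J ×ˢ V ∩ O, W q = 4 * ((B q (X q) (X q) - B q (Y q) (Y q)) ^ 2
        + (B q (X q) (Y q) + B q (Y q) (X q)) ^ 2) := by
    intro q hq
    rw [hW q hq.1 _ _ (hF q hq), shearNorm, h.lieForm_eq hq.1, h.lieForm_eq hq.1,
      h.lieForm_eq hq.1]
    ring
  have hev : W =ᶠ[nhdsWithin p (J ×ˢ V)] fun q => 4 * ((B q (X q) (X q) - B q (Y q) (Y q)) ^ 2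
        + (B q (X q) (Y q) + B q (Y q) (X q)) ^ 2) := by
    filter_upwards [hO', self_mem_nhdsWithin] with q hq hq' using heq q ⟨hq', hq⟩
  refine ⟨(D1.const_mul 4).congr_of_eventuallyEq hev (heq p ⟨hp, hpO⟩), ?_⟩
  have hWn : 0 ≤ W p := by
    rw [hW p hp _ _ (hF p ⟨hp, hpO⟩)]
    exact shearNorm_nonneg _ _ _
  have : fderivWithin ℝ W (J ×ˢ V) p (1, f p • U p) = 2 * κ p * W p := by
    rw [hev.fderivWithin_eq (heq p ⟨hp, hpO⟩), fderivWithin_const_mul (h.uniqueDiffOn p hp) D1, smul_apply, D2,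
      heq p ⟨hp, hpO⟩, smul_eq_mul]
    ring
  rw [this]
  gcongr

end Shear

/-! ### Coordinate expressions on the slices -/

section Slices

theorem finrank_E3 : Module.finrank ℝ E3 = 3 := by simp

theorem E3_sum_single (v : E3) : ∑ i : Fin 3, v i • EuclideanSpace.single i (1 : ℝ) = v := by
  ext j
  simp [Finset.sum_apply, Pi.single_apply]

/-- Invariance of the trace: expand the images of the frame in the standard basis, then the standard
basis in the frame. -/
theorem trace_eq_frame {B : E3 →L[ℝ] E3 →L[ℝ] ℝ} (hB : ∀ v w, B v w = B w v) {X Y N : E3}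
    (h : IsFrame B X Y N) (A : E3 →ₗ[ℝ] E3) :
    ∑ i : Fin 3, A (EuclideanSpace.single i 1) i = B (A X) X + B (A Y) Y + B (A N) N := by
  have key : ∀ F : E3, B (A F) F = ∑ i : Fin 3, B (EuclideanSpace.single i 1) F * A F i := by
    intro F
    conv_lhs => rw [← E3_sum_single (A F)]
    simp [mul_comm]
  rw [key, key, key, ← Finset.sum_add_distrib, ← Finset.sum_add_distrib]
  refine Finset.sum_congr rfl fun i _ => ?_
  conv_lhs => rw [h.expand finrank_E3 hB (EuclideanSpace.single i (1 : ℝ))]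
  simp

variable {J : Set ℝ} {V : Set E3} {f : ℝ → E3 → ℝ} {g : ℝ → E3 → E3 →L[ℝ] E3 →L[ℝ] ℝ}
  {U : ℝ → E3 → E3} {T : ℝ → E3 → E3 →L[ℝ] E3 →L[ℝ] ℝ}
  (h : SlicedFields J V (fun q => f q.1 q.2) (fun q => g q.1 q.2) (fun q => U q.1 q.2))
  {t : ℝ} {y : E3}
include h

theorem slicediff_eq (ht : t ∈ J) (hy : y ∈ V) :
    slicediff V f t y = spatialDeriv (fun q => f q.1 q.2) (J ×ˢ V) (t, y) :=
  fderivWithin_slice h.isOpen ht hy (h.differentiable_f ⟨ht, hy⟩)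

theorem slicegrad_eq (ht : t ∈ J) (hy : y ∈ V) :
    slicegrad V f g t y =
      sliceGradient (fun q => g q.1 q.2) (J ×ˢ V) (fun q => f q.1 q.2) (t, y) := by
  rw [slicegrad, slicediff_eq h ht hy]
  rfl

theorem christoffel_slice (ht : t ∈ J) (hy : y ∈ V) (v w : E3) :
    christoffel (g t) V y v w = sliceChristoffel (fun q => g q.1 q.2) (J ×ˢ V) (t, y) v w := by
  rw [christoffel, fderivWithin_slice (Q := fun q => g q.1 q.2) h.isOpen ht hy
    (h.differentiable_g ⟨ht, hy⟩), sliceChristoffel_apply]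
  rfl

theorem covDeriv_slice (ht : t ∈ J) (hy : y ∈ V) (v : E3) :
    covDeriv (g t) V (U t) y v =
      sliceNabla (fun q => g q.1 q.2) (J ×ˢ V) (fun q => U q.1 q.2) (t, y) v := by
  rw [covDeriv, fderivWithin_slice (Q := fun q => U q.1 q.2) h.isOpen ht hy
    (h.differentiable_U ⟨ht, hy⟩), christoffel_slice h ht hy, sliceNabla_apply]

theorem curvature_slice (ht : t ∈ J) (hy : y ∈ V) (a b c : E3) :
    curvature (g t) V y a b c = sliceCurvature (fun q => g q.1 q.2) (J ×ˢ V) (t, y) a b c := by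
  have hΓ := h.smooth_sliceChristoffel.differentiableOn (by simp) (t, y) ⟨ht, hy⟩
  have hc : ∀ c : E3, DifferentiableWithinAt ℝ (fun _ : ℝ × E3 => c) (J ×ˢ V) (t, y) :=
    fun c => differentiableWithinAt_const c
  have key : ∀ a b : E3, fderivWithin ℝ (fun q => christoffel (g t) V q b c) V y a =
      fderivWithin ℝ (sliceChristoffel (fun q => g q.1 q.2) (J ×ˢ V)) (J ×ˢ V) (t, y) (0, a) b c := by
    intro a b
    rw [fderivWithin_congr (fun z hz => christoffel_slice h ht hz b c)
      (christoffel_slice h ht hy b c), fderivWithin_slice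
      (Q := fun q => sliceChristoffel (fun q => g q.1 q.2) (J ×ˢ V) q b c) h.isOpen ht hy
      ((hΓ.clm_apply (hc b)).clm_apply (hc c)), spatialDeriv_apply,
      fderivWithin_apply_fields (h.uniqueDiffOn _ ⟨ht, hy⟩) hΓ (hc b) (hc c)]
    simp
  simp only [curvature, key, christoffel_slice h ht hy, sliceCurvature]

theorem ricci_slice (ht : t ∈ J) (hy : y ∈ V) {X Y : E3} (hF : IsFrame (g t y) X Y (U t y))
    (v w : E3) :
    ricci (g t) V y v w =
      g t y (sliceCurvature (fun q => g q.1 q.2) (J ×ˢ V) (t, y) X v w) X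
      + g t y (sliceCurvature (fun q => g q.1 q.2) (J ×ˢ V) (t, y) Y v w) Y
      + g t y (sliceCurvature (fun q => g q.1 q.2) (J ×ˢ V) (t, y) (U t y) v w) (U t y) := by
  let A : E3 →ₗ[ℝ] E3 :=
    { toFun := fun a => sliceCurvature (fun q => g q.1 q.2) (J ×ˢ V) (t, y) a v w
      map_add' := fun a b => by
        simp only [sliceCurvature, ← spatialDeriv_apply, map_add, add_apply]
        abel
      map_smul' := fun c a => by
        simp only [sliceCurvature, ← spatialDeriv_apply, map_smul, smul_apply, RingHom.id_apply]
        module }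
  simp only [ricci, curvature_slice h ht hy]
  exact trace_eq_frame (h.symm (t, y) ⟨ht, hy⟩) hF A

theorem EvolvesLocally.timeDeriv_metric (he : EvolvesLocally J V f g U T) (ht : t ∈ J)
    (hy : y ∈ V) (v w : E3) :
    timeDeriv (fun q => g q.1 q.2) (J ×ˢ V) (t, y) v w =
      -(g t y (U t y) v * slicediff V f t y w + slicediff V f t y v * g t y (U t y) w)
        + 2 * T t y v w := by
  have hJ := uniqueDiffOn_convex h.convex h.interior_nonempty t ht
  have hg := h.differentiable_g (p := (t, y)) ⟨ht, hy⟩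
  have hc : ∀ c : E3, DifferentiableWithinAt ℝ (fun _ : ℝ × E3 => c) (J ×ˢ V) (t, y) :=
    fun c => differentiableWithinAt_const c
  have h1 := hasDerivWithinAt_time (Q := fun q => g q.1 q.2 v w) hy
    ((hg.clm_apply (hc v)).clm_apply (hc w))
  rw [timeDeriv, fderivWithin_apply_fields (h.uniqueDiffOn _ ⟨ht, hy⟩) hg (hc v) (hc w)] at h1
  simp only [fderivWithin_fun_const, Pi.zero_apply, zero_apply, map_zero, add_zero] at h1
  exact hJ.eq_deriv _ h1 (he.evol_g t ht y hy v w)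

theorem EvolvesLocally.evolvingFields (he : EvolvesLocally J V f g U T) :
    EvolvingFields J V (fun q => f q.1 q.2) (fun q => g q.1 q.2) (fun q => U q.1 q.2) where
  toSlicedFields := h
  evol_U := by
    rintro ⟨t, y⟩ ⟨ht, hy⟩
    have hJ := uniqueDiffOn_convex h.convex h.interior_nonempty t ht
    have h1 := hasDerivWithinAt_time (Q := fun q => U q.1 q.2) hy (h.differentiable_U ⟨ht, hy⟩)
    rw [hJ.eq_deriv _ h1 (he.evol_U t ht y hy), covDeriv_slice h ht hy, slicegrad_eq h ht hy]
  rate_U := by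
    rintro ⟨t, y⟩ ⟨ht, hy⟩ w
    -- Lowering the index gives `T(U, ·) = -½ df + ½ U(f) θ`. In `∂_t g` the multiples of `θ` then
    -- cancel and `-2 df` remains.
    have h1 := congrArg (fun x => g t y x w) (he.T_U t ht y hy)
    have h2 := h.metric_inverse ⟨ht, hy⟩ (T t y (U t y))
    have h3 := h.metric_sliceGradient ⟨ht, hy⟩ w
    simp only [sharp, map_add, map_smul, add_apply, smul_apply, slicegrad_eq h ht hy,
      smul_eq_mul] at h1 h2 h3
    rw [h2, h3] at h1
    have h4 : g t y (U t y) (U t y) = 1 := h.unit (t, y) ⟨ht, hy⟩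
    rw [he.timeDeriv_metric h ht hy, h1, h4, slicediff_eq h ht hy]
    ring

/-- The complex condition is split into real and imaginary parts, with `2T` replaced by `∂_t g` on
the plane orthogonal to `U` and `-f Ricci(Z, Z)` by `f g(R(U, Z)U, Z)`. -/
theorem QuadLocally.quadAt (he : EvolvesLocally J V f g U T) (hq : QuadLocally J V f g U T)
    {p : ℝ × E3} (hp : p ∈ J ×ˢ V) :
    QuadAt J V (fun q => f q.1 q.2) (fun q => g q.1 q.2) (fun q => U q.1 q.2) p := by
  obtain ⟨t, y⟩ := p
  obtain ⟨ht, hy⟩ := hp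
  intro X Y hF B m r τ d hB hm hr hτ hd
  have hsym := h.symm (t, y) ⟨ht, hy⟩
  have hskew := h.sliceCurvature_skew (p := (t, y)) ⟨ht, hy⟩
  have hanti : ∀ a b c, sliceCurvature (fun q => g q.1 q.2) (J ×ˢ V) (t, y) a b c =
      -sliceCurvature (fun q => g q.1 q.2) (J ×ˢ V) (t, y) b a c := by
    intro a b c
    simp only [sliceCurvature]
    abel
  have hQ := hq t ht y hy X Y hF.xx hF.yy hF.xy hF.xn hF.yn
  simp only at hsym hskew
  have hUX : g t y (U t y) X = 0 := (hsym _ _).trans hF.xn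
  have hUY : g t y (U t y) Y = 0 := (hsym _ _).trans hF.yn
  have tXX : τ X X = 2 * T t y X X := by
    rw [hτ]; simp only [he.timeDeriv_metric h ht hy, hUX]; ring
  have tYY : τ Y Y = 2 * T t y Y Y := by
    rw [hτ]; simp only [he.timeDeriv_metric h ht hy, hUY]; ring
  have tXY : τ X Y = 2 * T t y X Y := by
    rw [hτ]; simp only [he.timeDeriv_metric h ht hy, hUX, hUY]; ring
  have tYX : T t y Y X = T t y X Y := he.T_symm t ht y hy Y X
  have eB : ∀ v w, g t y (covDeriv (g t) V (U t) y v) w = B v w := by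
    intro v w; rw [hB, covDeriv_slice h ht hy]
  have em : ∀ v w, mixedCurv J V f g U t y v w = m v w := by
    intro v w; rw [hm]; rfl
  have ed : ∀ v, slicediff V f t y v = d v := by
    intro v; rw [hd, slicediff_eq h ht hy]
  have er : ∀ v w, g t y (sliceCurvature (fun q => g q.1 q.2) (J ×ˢ V) (t, y) (U t y) v w) (U t y) =
      -r v w := by
    intro v w; rw [hr]; exact hskew _ _ _ _
  have self : ∀ a b c, g t y (sliceCurvature (fun q => g q.1 q.2) (J ×ˢ V) (t, y) a b c) c = 0 := by
    intro a b c
    have := hskew a b c c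
    linarith
  have same : ∀ a c d, g t y (sliceCurvature (fun q => g q.1 q.2) (J ×ˢ V) (t, y) a a c) d = 0 := by
    intro a c d
    simp [sliceCurvature]
  have swap := hskew X Y Y X
  have ant := congrArg (fun x => g t y x Y) (hanti X Y X)
  simp only [map_neg, neg_apply] at ant
  have mneg₁ : ∀ v w, m (-v) w = -m v w := by
    intro v w
    simp only [hm, (he.evolvingFields h).lorentzMetric_curvature_U (p := (t, y)) ⟨ht, hy⟩,
      ← spatialDeriv_apply, map_neg, neg_apply]
    ring
  have mneg₂ : ∀ v w, m v (-w) = -m v w := by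
    intro v w
    simp only [hm, (he.evolvingFields h).lorentzMetric_curvature_U (p := (t, y)) ⟨ht, hy⟩, map_neg]
    ring
  have rneg₁ : ∀ v w, ricci (g t) V y (-v) w = -ricci (g t) V y v w := by
    intro v w
    simp only [ricci_slice h ht hy hF, sliceCurvature, ← spatialDeriv_apply, map_neg, neg_apply,
      map_add, map_sub, add_apply, sub_apply]
    ring
  have rneg₂ : ∀ v w, ricci (g t) V y v (-w) = -ricci (g t) V y v w := by
    intro v w
    simp only [ricci_slice h ht hy hF, sliceCurvature, map_neg, neg_apply,
      map_add, map_sub, add_apply, sub_apply]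
    ring
  -- In the difference the curvature of the plane of `X, Y` occurs twice with opposite signs, by
  -- `swap` and `ant`; only the contribution of `U` to the trace survives.
  have ricre : ricci (g t) V y X X - ricci (g t) V y Y Y = -(r X X - r Y Y) := by
    rw [ricci_slice h ht hy hF, ricci_slice h ht hy hF, er, er, same, same]
    linarith
  have ricim : ricci (g t) V y X Y + ricci (g t) V y Y X = -(r X Y + r Y X) := by
    rw [ricci_slice h ht hy hF, ricci_slice h ht hy hF, er, er, same, same, self, self]
    ring
  simp only [quadExpr, rho, complexify, curvTensor, eB, em, ed, map_neg, neg_apply, mneg₁, mneg₂,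
    rneg₁, rneg₂, tYX] at hQ
  have eBn : ∀ v w, B v (-w) = -B v w := by
    intro v w; simp [hB]
  simp only [eBn] at hQ
  -- As the cast of a real number, the factor passes through real and imaginary parts.
  rw [show (1 : ℂ) / (f t y : ℂ) = ((1 / f t y : ℝ) : ℂ) by push_cast; rfl] at hQ
  have h1 := congrArg Complex.re hQ
  have h2 := congrArg Complex.im hQ
  simp [pow_two] at h1 h2
  rw [tXX, tYY, tXY]
  constructor
  · linear_combination h1 + f t y * ricre
  · linear_combination h2 - f t y * ricim

end Slices

/-! ### Charts -/

section Charts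

variable {M : Type*} [TopologicalSpace M] [ChartedSpace E3 M] [IsManifold (𝓡 3) ∞ M]

/-- The derivative of the inverse of the chart around `x₀`. -/
def chartInvDeriv (x₀ : M) (y : E3) : E3 →L[ℝ] E3 :=
  mfderiv 𝓘(ℝ, E3) (𝓡 3) (extChartAt (𝓡 3) x₀).symm y

/-- The derivative of the chart around `x₀`, at the point with coordinates `y`. -/
def chartDeriv (x₀ : M) (y : E3) : E3 →L[ℝ] E3 :=
  mfderiv (𝓡 3) 𝓘(ℝ, E3) (extChartAt (𝓡 3) x₀) ((extChartAt (𝓡 3) x₀).symm y)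

theorem isManifold_one : IsManifold (𝓡 3) 1 M :=
  IsManifold.of_le (n := ∞) (by simp)

theorem chartDeriv_chartInvDeriv {x₀ : M} {y : E3} (hy : y ∈ (extChartAt (𝓡 3) x₀).target)
    (v : E3) : chartDeriv x₀ y (chartInvDeriv x₀ y v) = v := by
  have := isManifold_one (M := M)
  have h := mfderiv_extChartAt_comp_mfderivWithin_extChartAt_symm (I := 𝓡 3) hy
  rw [ModelWithCorners.Boundaryless.range_eq_univ, mfderivWithin_univ] at h
  exact congrArg (fun L : E3 →L[ℝ] E3 => L v) h

theorem chartInvDeriv_chartDeriv {x₀ : M} {y : E3} (hy : y ∈ (extChartAt (𝓡 3) x₀).target)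
    (v : E3) : chartInvDeriv x₀ y (chartDeriv x₀ y v) = v := by
  have := isManifold_one (M := M)
  have h := mfderivWithin_extChartAt_symm_comp_mfderiv_extChartAt (I := 𝓡 3) hy
  rw [ModelWithCorners.Boundaryless.range_eq_univ, mfderivWithin_univ] at h
  exact congrArg (fun L : E3 →L[ℝ] E3 => L v) h

omit [IsManifold (𝓡 3) ∞ M] in
theorem chartVec_eq (X : ∀ x : M, TangentSpace (𝓡 3) x) (x₀ : M) (y : E3) :
    chartVec X x₀ y = chartDeriv x₀ y (X ((extChartAt (𝓡 3) x₀).symm y)) := rfl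

omit [IsManifold (𝓡 3) ∞ M] in
theorem chartTensor_apply
    (B : ∀ x : M, TangentSpace (𝓡 3) x →L[ℝ] TangentSpace (𝓡 3) x →L[ℝ] ℝ) (x₀ : M) (y v w : E3) :
    chartTensor B x₀ y v w = B ((extChartAt (𝓡 3) x₀).symm y) (chartInvDeriv x₀ y v)
      (chartInvDeriv x₀ y w) := rfl

theorem chartInvDeriv_chartVec (X : ∀ x : M, TangentSpace (𝓡 3) x) {x₀ : M} {y : E3}
    (hy : y ∈ (extChartAt (𝓡 3) x₀).target) :
    chartInvDeriv x₀ y (chartVec X x₀ y) = X ((extChartAt (𝓡 3) x₀).symm y) := by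
  rw [chartVec_eq]
  exact chartInvDeriv_chartDeriv hy _

theorem chartTensor_chartVec
    (B : ∀ x : M, TangentSpace (𝓡 3) x →L[ℝ] TangentSpace (𝓡 3) x →L[ℝ] ℝ)
    (X Y : ∀ x : M, TangentSpace (𝓡 3) x) {x₀ : M} {y : E3}
    (hy : y ∈ (extChartAt (𝓡 3) x₀).target) :
    chartTensor B x₀ y (chartVec X x₀ y) (chartVec Y x₀ y) =
      B ((extChartAt (𝓡 3) x₀).symm y) (X ((extChartAt (𝓡 3) x₀).symm y))
        (Y ((extChartAt (𝓡 3) x₀).symm y)) := by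
  rw [chartTensor_apply, chartInvDeriv_chartVec X hy, chartInvDeriv_chartVec Y hy]

/-- Smoothness in the tangent bundle is tested in the trivialization at `x₀`, whose fibre map is the
derivative of the chart; this links it to `chartVec`. -/
theorem trivializationAt_snd {x₀ : M} {y : E3} (hy : y ∈ (extChartAt (𝓡 3) x₀).target) (v : E3) :
    (trivializationAt E3 (TangentSpace (𝓡 3)) x₀
      (⟨(extChartAt (𝓡 3) x₀).symm y, v⟩ : TangentBundle (𝓡 3) M)).2 = chartDeriv x₀ y v := by
  have := isManifold_one (M := M)
  have hx : (extChartAt (𝓡 3) x₀).symm y ∈ (chartAt E3 x₀).source := by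
    rw [← extChartAt_source (𝓡 3)]; exact (extChartAt (𝓡 3) x₀).map_target hy
  have h := TangentBundle.continuousLinearMapAt_trivializationAt (I := 𝓡 3) hx
  have h2 : (trivializationAt E3 (TangentSpace (𝓡 3)) x₀).continuousLinearMapAt ℝ
    ((extChartAt (𝓡 3) x₀).symm y) v = chartDeriv x₀ y v :=
    congrArg (fun L : E3 →L[ℝ] E3 => L v) h
  rw [← h2, Bundle.Trivialization.continuousLinearMapAt_apply,
    Bundle.Trivialization.coe_linearMapAt_of_mem]
  simpa using hx

theorem symm_mem_baseSet {x₀ : M} {y : E3} (hy : y ∈ (extChartAt (𝓡 3) x₀).target) :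
    (extChartAt (𝓡 3) x₀).symm y ∈ (trivializationAt E3 (TangentSpace (𝓡 3)) x₀).baseSet := by
  have hx : (extChartAt (𝓡 3) x₀).symm y ∈ (chartAt E3 x₀).source := by
    rw [← extChartAt_source (𝓡 3)]; exact (extChartAt (𝓡 3) x₀).map_target hy
  simpa using hx

theorem contMDiffOn_prod_symm (J : Set ℝ) (x₀ : M) :
    ContMDiffOn 𝓘(ℝ, ℝ × E3) (𝓘(ℝ, ℝ).prod (𝓡 3)) ∞
      (fun q : ℝ × E3 => (q.1, (extChartAt (𝓡 3) x₀).symm q.2))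
      (J ×ˢ (extChartAt (𝓡 3) x₀).target) := by
  refine ContMDiffOn.prodMk ?_ ?_
  · exact contDiff_fst.contMDiff.contMDiffOn
  · exact (contMDiffOn_extChartAt_symm x₀).comp contDiff_snd.contMDiff.contMDiffOn
      fun q hq => hq.2

theorem contDiffOn_chartFun {J : Set ℝ} {f : ℝ → M → ℝ}
    (hf : ContMDiffOn (𝓘(ℝ, ℝ).prod (𝓡 3)) 𝓘(ℝ, ℝ) ∞ (fun p : ℝ × M => f p.1 p.2) (J ×ˢ univ))
    (x₀ : M) : ContDiffOn ℝ ∞ (fun q : ℝ × E3 => chartFun (f q.1) x₀ q.2)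
      (J ×ˢ (extChartAt (𝓡 3) x₀).target) := by
  rw [← contMDiffOn_iff_contDiffOn]
  exact hf.comp (contMDiffOn_prod_symm J x₀) fun q hq => ⟨hq.1, mem_univ _⟩

theorem contDiffOn_chartVec {J : Set ℝ} {U : ℝ → ∀ x : M, TangentSpace (𝓡 3) x}
    (hU : ContMDiffOn (𝓘(ℝ, ℝ).prod (𝓡 3)) ((𝓡 3).prod 𝓘(ℝ, E3)) ∞
      (fun p : ℝ × M => (⟨p.2, U p.1 p.2⟩ : TangentBundle (𝓡 3) M)) (J ×ˢ univ))
    (x₀ : M) : ContDiffOn ℝ ∞ (fun q : ℝ × E3 => chartVec (U q.1) x₀ q.2)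
      (J ×ˢ (extChartAt (𝓡 3) x₀).target) := by
  have h1 := hU.comp (contMDiffOn_prod_symm J x₀) fun q hq => ⟨hq.1, mem_univ _⟩
  have h2 := ((trivializationAt E3 (TangentSpace (𝓡 3)) x₀).contMDiffOn_iff (IB := 𝓡 3) ?_).1 h1
  · rw [← contMDiffOn_iff_contDiffOn]
    refine h2.2.congr fun q hq => ?_
    rw [chartVec_eq]
    exact (trivializationAt_snd hq.2 _).symm
  · intro q hq
    rw [Bundle.Trivialization.mem_source]
    exact symm_mem_baseSet hq.2

/-- In the trivialization at `x₀` the coordinate field of `v` has the constant component `v`. -/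
theorem contMDiffOn_chartInvDeriv (J : Set ℝ) (x₀ : M) (v : E3) :
    ContMDiffOn 𝓘(ℝ, ℝ × E3) ((𝓡 3).prod 𝓘(ℝ, E3)) ∞
      (fun q : ℝ × E3 => (⟨(extChartAt (𝓡 3) x₀).symm q.2, chartInvDeriv x₀ q.2 v⟩ :
        TangentBundle (𝓡 3) M)) (J ×ˢ (extChartAt (𝓡 3) x₀).target) := by
  refine ((trivializationAt E3 (TangentSpace (𝓡 3)) x₀).contMDiffOn_iff (IB := 𝓡 3) ?_).2
    ⟨?_, ?_⟩
  · intro q hq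
    rw [Bundle.Trivialization.mem_source]
    exact symm_mem_baseSet hq.2
  · exact contMDiff_snd.comp_contMDiffOn (contMDiffOn_prod_symm J x₀)
  · refine (contMDiffOn_const (c := v)).congr fun q hq => ?_
    rw [trivializationAt_snd hq.2, chartDeriv_chartInvDeriv hq.2]

theorem contDiffOn_chartTensor {J : Set ℝ}
    {g : ℝ → ∀ x : M, TangentSpace (𝓡 3) x →L[ℝ] TangentSpace (𝓡 3) x →L[ℝ] ℝ}
    (hg : ContMDiffOn (𝓘(ℝ, ℝ).prod (𝓡 3)) ((𝓡 3).prod 𝓘(ℝ, E3 →L[ℝ] E3 →L[ℝ] ℝ)) ∞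
      (fun p : ℝ × M => Bundle.TotalSpace.mk' (E3 →L[ℝ] E3 →L[ℝ] ℝ)
        (E := fun x : M => TangentSpace (𝓡 3) x →L[ℝ] TangentSpace (𝓡 3) x →L[ℝ] ℝ)
        p.2 (g p.1 p.2)) (J ×ˢ univ)) (x₀ : M) :
    ContDiffOn ℝ ∞ (fun q : ℝ × E3 => chartTensor (g q.1) x₀ q.2)
      (J ×ˢ (extChartAt (𝓡 3) x₀).target) := by
  refine contDiffOn_clm_apply.2 fun v => contDiffOn_clm_apply.2 fun w => ?_
  rw [← contMDiffOn_iff_contDiffOn]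
  have h1 := hg.comp (contMDiffOn_prod_symm J x₀) fun q hq => ⟨hq.1, mem_univ _⟩
  have h2 : ContMDiffOn 𝓘(ℝ, ℝ × E3) ((𝓡 3).prod 𝓘(ℝ)) ∞
      (fun q : ℝ × E3 => Bundle.TotalSpace.mk' ℝ (E := Bundle.Trivial M ℝ)
        ((extChartAt (𝓡 3) x₀).symm q.2)
        (g q.1 ((extChartAt (𝓡 3) x₀).symm q.2) (chartInvDeriv x₀ q.2 v) (chartInvDeriv x₀ q.2 w)))
      (J ×ˢ (extChartAt (𝓡 3) x₀).target) := by
    apply ContMDiffOn.clm_bundle_apply₂ (F₁ := E3) (F₂ := E3)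
    · exact h1
    · exact contMDiffOn_chartInvDeriv J x₀ v
    · exact contMDiffOn_chartInvDeriv J x₀ w
  intro q hq
  have h3 := h2 q hq
  rw [Bundle.contMDiffWithinAt_totalSpace] at h3
  exact h3.2

end Charts

/-! ### Transfer of the fields and of the Lie derivative to a chart -/

section ChartFields

variable {M : Type*} [TopologicalSpace M] [ChartedSpace E3 M] [IsManifold (𝓡 3) ∞ M]
  {J : Set ℝ} {f : ℝ → M → ℝ}
  {g : ℝ → ∀ x : M, TangentSpace (𝓡 3) x →L[ℝ] TangentSpace (𝓡 3) x →L[ℝ] ℝ}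
  {U : ℝ → ∀ x : M, TangentSpace (𝓡 3) x}

theorem chartInvDeriv_injective {x₀ : M} {y : E3} (hy : y ∈ (extChartAt (𝓡 3) x₀).target) {v : E3}
    (hv : v ≠ 0) : chartInvDeriv x₀ y v ≠ 0 := fun h0 => hv <| by
  rw [← chartDeriv_chartInvDeriv hy v, h0, map_zero]

theorem interior_nonempty_of_nontrivial (hJ : J.OrdConnected) (hJ' : J.Nontrivial) :
    (interior J).Nonempty := by
  obtain ⟨a, ha, b, hb, hab⟩ := hJ'.exists_lt
  refine ⟨(a + b) / 2, mem_interior.2 ⟨Ioo a b, ?_, isOpen_Ioo, ?_, ?_⟩⟩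
  · exact fun z hz => hJ.out ha hb ⟨hz.1.le, hz.2.le⟩
  · linarith
  · linarith

theorem IsEvolvingTriple.slicedFields (h : IsEvolvingTriple J f g U) (hJ : J.OrdConnected)
    (hJ' : J.Nontrivial) (x₀ : M) :
    SlicedFields J (extChartAt (𝓡 3) x₀).target (fun q => chartFun (f q.1) x₀ q.2)
      (fun q => chartTensor (g q.1) x₀ q.2) (fun q => chartVec (U q.1) x₀ q.2) where
  convex := convex_iff_ordConnected.2 hJ
  interior_nonempty := interior_nonempty_of_nontrivial hJ hJ'
  isOpen := isOpen_extChartAt_target x₀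
  smooth_f := contDiffOn_chartFun h.smooth_f x₀
  smooth_g := contDiffOn_chartTensor h.smooth_g x₀
  smooth_U := contDiffOn_chartVec h.smooth_U x₀
  symm := fun p hp v w => h.symm p.1 hp.1 _ _ _
  pos := fun p hp v hv => h.pos p.1 hp.1 _ _ (chartInvDeriv_injective hp.2 hv)
  unit := fun p hp => by
    rw [chartTensor_chartVec _ _ _ hp.2]
    exact h.unit p.1 hp.1 _
  f_ne := fun p hp => h.f_ne p.1 hp.1 _

theorem differentiableAt_chartVec {X : ∀ x : M, TangentSpace (𝓡 3) x} {x₀ : M} {y : E3}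
    (hy : y ∈ (extChartAt (𝓡 3) x₀).target)
    (hX : MDifferentiableAt (𝓡 3) ((𝓡 3).prod 𝓘(ℝ, E3))
      (fun z => (⟨z, X z⟩ : TangentBundle (𝓡 3) M)) ((extChartAt (𝓡 3) x₀).symm y)) :
    DifferentiableAt ℝ (chartVec X x₀) y := by
  have hm : MDifferentiableAt 𝓘(ℝ, E3) (𝓡 3) (extChartAt (𝓡 3) x₀).symm y :=
    ((contMDiffOn_extChartAt_symm (n := ∞) x₀ y hy).contMDiffAt
      ((isOpen_extChartAt_target x₀).mem_nhds hy)).mdifferentiableAt (by simp)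
  have h1 := hX.comp y hm
  have h2 := ((trivializationAt E3 (TangentSpace (𝓡 3)) x₀).mdifferentiableAt_totalSpace_iff
    (𝓡 3) _ ?_).1 h1
  · rw [← mdifferentiableAt_iff_differentiableAt]
    refine h2.2.congr_of_eventuallyEq ?_
    filter_upwards [(isOpen_extChartAt_target x₀).mem_nhds hy] with z hz
    rw [chartVec_eq]
    exact (trivializationAt_snd hz _).symm
  · rw [Bundle.Trivialization.mem_source]
    exact symm_mem_baseSet hy

theorem mpullback_eq_chartVec (X : ∀ x : M, TangentSpace (𝓡 3) x) {x₀ : M} {y : E3}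
    (hy : y ∈ (extChartAt (𝓡 3) x₀).target) :
    VectorField.mpullback 𝓘(ℝ, E3) (𝓡 3) (extChartAt (𝓡 3) x₀).symm X y = chartVec X x₀ y := by
  have h : (chartInvDeriv x₀ y).inverse = chartDeriv x₀ y :=
    ContinuousLinearMap.inverse_eq (ContinuousLinearMap.ext (chartInvDeriv_chartDeriv hy))
      (ContinuousLinearMap.ext (chartDeriv_chartInvDeriv hy))
  rw [VectorField.mpullback_apply, chartVec_eq, ← h]
  rfl

theorem mlieBracket_model (V W : ∀ y : E3, TangentSpace 𝓘(ℝ, E3) y) (y : E3) :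
    VectorField.mlieBracket 𝓘(ℝ, E3) V W y = VectorField.lieBracket ℝ V W y := by
  rw [← VectorField.mlieBracketWithin_univ, VectorField.mlieBracketWithin_eq_lieBracketWithin]
  exact congrFun VectorField.lieBracketWithin_univ y

/-- Naturality of the Lie bracket under pullback by the inverse chart, followed by its formula in a
vector space. -/
theorem chartVec_mlieBracket {X Y : ∀ x : M, TangentSpace (𝓡 3) x} {x₀ : M} {y : E3}
    (hy : y ∈ (extChartAt (𝓡 3) x₀).target)
    (hX : MDifferentiableAt (𝓡 3) ((𝓡 3).prod 𝓘(ℝ, E3))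
      (fun z => (⟨z, X z⟩ : TangentBundle (𝓡 3) M)) ((extChartAt (𝓡 3) x₀).symm y))
    (hY : MDifferentiableAt (𝓡 3) ((𝓡 3).prod 𝓘(ℝ, E3))
      (fun z => (⟨z, Y z⟩ : TangentBundle (𝓡 3) M)) ((extChartAt (𝓡 3) x₀).symm y)) :
    chartVec (VectorField.mlieBracket (𝓡 3) X Y) x₀ y =
      fderiv ℝ (chartVec Y x₀) y (chartVec X x₀ y) - fderiv ℝ (chartVec X x₀) y (chartVec Y x₀ y) := by
  have hI : IsManifold (𝓡 3) (minSmoothness ℝ 2) M :=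
    IsManifold.of_le (n := ∞) (by simpa using ENat.LEInfty.out)
  have hm : ContMDiffAt 𝓘(ℝ, E3) (𝓡 3) ∞ (extChartAt (𝓡 3) x₀).symm y :=
    (contMDiffOn_extChartAt_symm (n := ∞) x₀ y hy).contMDiffAt
      ((isOpen_extChartAt_target x₀).mem_nhds hy)
  have h1 := VectorField.mpullback_mlieBracket hX hY hm (by simpa using ENat.LEInfty.out)
  rw [mpullback_eq_chartVec _ hy] at h1
  have ev : ∀ Z : ∀ x : M, TangentSpace (𝓡 3) x,
      VectorField.mpullback 𝓘(ℝ, E3) (𝓡 3) (extChartAt (𝓡 3) x₀).symm Z =ᶠ[nhds y]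
        chartVec Z x₀ := by
    intro Z
    filter_upwards [(isOpen_extChartAt_target x₀).mem_nhds hy] with z hz
    exact mpullback_eq_chartVec Z hz
  exact h1.trans ((Filter.EventuallyEq.mlieBracket_vectorField_eq (ev X) (ev Y)).trans
    (mlieBracket_model _ _ y))

theorem mvfderiv_chart {h : M → ℝ} {k : E3 → ℝ} {x₀ : M} {y : E3}
    (hy : y ∈ (extChartAt (𝓡 3) x₀).target) (hk : DifferentiableAt ℝ k y)
    (hhk : ∀ z ∈ (extChartAt (𝓡 3) x₀).target, h ((extChartAt (𝓡 3) x₀).symm z) = k z)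
    (X : ∀ x : M, TangentSpace (𝓡 3) x) :
    mvfderiv (𝓡 3) h ((extChartAt (𝓡 3) x₀).symm y) (X ((extChartAt (𝓡 3) x₀).symm y)) =
      fderiv ℝ k y (chartVec X x₀ y) := by
  have := isManifold_one (M := M)
  have hx := (extChartAt (𝓡 3) x₀).map_target hy
  have hx' : (extChartAt (𝓡 3) x₀).symm y ∈ (chartAt E3 x₀).source := by
    rwa [← extChartAt_source (𝓡 3)]
  have hφ : MDifferentiableAt (𝓡 3) 𝓘(ℝ, E3) (extChartAt (𝓡 3) x₀)
    ((extChartAt (𝓡 3) x₀).symm y) := mdifferentiableAt_extChartAt hx'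
  have hφy := (extChartAt (𝓡 3) x₀).right_inv hy
  have hk' : HasFDerivAt k (fderiv ℝ k y)
      ((extChartAt (𝓡 3) x₀) ((extChartAt (𝓡 3) x₀).symm y)) := by
    rw [hφy]; exact hk.hasFDerivAt
  have h1 : HasMFDerivAt (𝓡 3) 𝓘(ℝ, ℝ) (k ∘ extChartAt (𝓡 3) x₀)
      ((extChartAt (𝓡 3) x₀).symm y) _ := hk'.hasMFDerivAt.comp _ hφ.hasMFDerivAt
  have h2 : h =ᶠ[nhds ((extChartAt (𝓡 3) x₀).symm y)] k ∘ extChartAt (𝓡 3) x₀ := by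
    filter_upwards [(isOpen_extChartAt_source x₀).mem_nhds hx] with z hz
    have := hhk _ ((extChartAt (𝓡 3) x₀).map_source hz)
    rwa [(extChartAt (𝓡 3) x₀).left_inv hz] at this
  have h3 := (h1.congr_of_eventuallyEq h2).mfderiv
  rw [mvfderiv, ContinuousLinearMap.comp_apply, h3]
  rfl

theorem IsEvolvingTriple.mdifferentiableAt_U (h : IsEvolvingTriple J f g U) {t : ℝ} (ht : t ∈ J)
    (x : M) : MDifferentiableAt (𝓡 3) ((𝓡 3).prod 𝓘(ℝ, E3))
      (fun z => (⟨z, U t z⟩ : TangentBundle (𝓡 3) M)) x := by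
  have h1 : ContMDiff (𝓡 3) (𝓘(ℝ, ℝ).prod (𝓡 3)) ∞ (fun z : M => (t, z)) :=
    contMDiff_const.prodMk contMDiff_id
  have h2 := h.smooth_U.comp (contMDiffOn_univ.2 h1) fun z _ => ⟨ht, mem_univ _⟩
  exact (contMDiffOn_univ.1 h2).contMDiffAt.mdifferentiableAt (by simp)

theorem lieForm_slice {V : Set E3} {f : ℝ → E3 → ℝ} {g : ℝ → E3 → E3 →L[ℝ] E3 →L[ℝ] ℝ}
    {U : ℝ → E3 → E3}
    (h : SlicedFields J V (fun q => f q.1 q.2) (fun q => g q.1 q.2) (fun q => U q.1 q.2))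
    {t : ℝ} (ht : t ∈ J) {y : E3} (hy : y ∈ V) (v w : E3) :
    lieForm (fun q => g q.1 q.2) (J ×ˢ V) (fun q => U q.1 q.2) (t, y) v w =
      fderiv ℝ (g t) y (U t y) v w + g t y (fderiv ℝ (U t) y v) w
        + g t y v (fderiv ℝ (U t) y w) := by
  have sg := fderivWithin_slice (Q := fun q => g q.1 q.2) h.isOpen ht hy
    (h.differentiable_g ⟨ht, hy⟩)
  have sU := fderivWithin_slice (Q := fun q => U q.1 q.2) h.isOpen ht hy
    (h.differentiable_U ⟨ht, hy⟩)
  rw [fderivWithin_of_isOpen h.isOpen hy] at sg sU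
  rw [lieForm, ← sg, ← sU]

theorem differentiableAt_slice_metric {V : Set E3} {f : ℝ → E3 → ℝ}
    {g : ℝ → E3 → E3 →L[ℝ] E3 →L[ℝ] ℝ} {U : ℝ → E3 → E3}
    (h : SlicedFields J V (fun q => f q.1 q.2) (fun q => g q.1 q.2) (fun q => U q.1 q.2))
    {t : ℝ} (ht : t ∈ J) {y : E3} (hy : y ∈ V) : DifferentiableAt ℝ (g t) y := by
  have h1 : ContDiffOn ℝ ∞ (g t) V :=
    h.smooth_g.comp (contDiff_prodMk_right t).contDiffOn fun z hz => ⟨ht, hz⟩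
  exact (h1.contDiffAt (h.isOpen.mem_nhds hy)).differentiableAt (by simp)

/-- The derivatives of `X` and `Y` produced by the product rule are those occurring in the brackets.
They cancel, so the result depends only on the values of `X` and `Y` at the point. -/
theorem lieDeriv_model {B : E3 → E3 →L[ℝ] E3 →L[ℝ] ℝ} {N X Y : E3 → E3} {y : E3}
    (hB : DifferentiableAt ℝ B y) (hX : DifferentiableAt ℝ X y) (hY : DifferentiableAt ℝ Y y) :
    fderiv ℝ (fun z => B z (X z) (Y z)) y (N y)
        - B y (fderiv ℝ X y (N y) - fderiv ℝ N y (X y)) (Y y)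
        - B y (X y) (fderiv ℝ Y y (N y) - fderiv ℝ N y (Y y)) =
      fderiv ℝ B y (N y) (X y) (Y y) + B y (fderiv ℝ N y (X y)) (Y y)
        + B y (X y) (fderiv ℝ N y (Y y)) := by
  have e := fderivWithin_apply_fields (uniqueDiffWithinAt_univ (x := y))
    hB.differentiableWithinAt hX.differentiableWithinAt hY.differentiableWithinAt (N y)
  simp only [fderivWithin_univ] at e
  rw [e]
  simp only [map_sub, sub_apply]
  ring

/-- The Lie derivative of the metric in a chart. -/
theorem IsEvolvingTriple.lieDerivMetric_eq (h : IsEvolvingTriple J f g U) (hJ : J.OrdConnected)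
    (hJ' : J.Nontrivial) {t : ℝ} (ht : t ∈ J) {x₀ : M} {y : E3}
    (hy : y ∈ (extChartAt (𝓡 3) x₀).target) {X Y : ∀ x : M, TangentSpace (𝓡 3) x}
    (hX : MDifferentiableAt (𝓡 3) ((𝓡 3).prod 𝓘(ℝ, E3))
      (fun z => (⟨z, X z⟩ : TangentBundle (𝓡 3) M)) ((extChartAt (𝓡 3) x₀).symm y))
    (hY : MDifferentiableAt (𝓡 3) ((𝓡 3).prod 𝓘(ℝ, E3))
      (fun z => (⟨z, Y z⟩ : TangentBundle (𝓡 3) M)) ((extChartAt (𝓡 3) x₀).symm y)) :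
    lieDerivMetric (g t) (U t) X Y ((extChartAt (𝓡 3) x₀).symm y) =
      lieForm (fun q => chartTensor (g q.1) x₀ q.2) (J ×ˢ (extChartAt (𝓡 3) x₀).target)
        (fun q => chartVec (U q.1) x₀ q.2) (t, y) (chartVec X x₀ y) (chartVec Y x₀ y) := by
  have hs := h.slicedFields hJ hJ' x₀
  have hU := h.mdifferentiableAt_U ht ((extChartAt (𝓡 3) x₀).symm y)
  have dX := differentiableAt_chartVec hy hX
  have dY := differentiableAt_chartVec hy hY
  have dg := differentiableAt_slice_metric (f := fun t => chartFun (f t) x₀)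
    (g := fun t => chartTensor (g t) x₀) (U := fun t => chartVec (U t) x₀) hs ht hy
  have dk : DifferentiableAt ℝ
      (fun z => chartTensor (g t) x₀ z (chartVec X x₀ z) (chartVec Y x₀ z)) y :=
    (dg.clm_apply dX).clm_apply dY
  have e1 := mvfderiv_chart (h := fun z => g t z (X z) (Y z)) hy dk
    (fun z hz => (chartTensor_chartVec (g t) X Y hz).symm) (U t)
  have b1 := chartVec_mlieBracket hy hU hX
  have b2 := chartVec_mlieBracket hy hU hY
  have c1 := chartTensor_chartVec (g t) (VectorField.mlieBracket (𝓡 3) (U t) X) Y hy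
  have c2 := chartTensor_chartVec (g t) X (VectorField.mlieBracket (𝓡 3) (U t) Y) hy
  have key := lieDeriv_model (N := chartVec (U t) x₀) dg dX dY
  rw [b1] at c1
  rw [b2] at c2
  rw [← e1, c1, c2] at key
  exact key.trans (lieForm_slice (f := fun t => chartFun (f t) x₀)
    (g := fun t => chartTensor (g t) x₀) (U := fun t => chartVec (U t) x₀) hs ht hy _ _).symm

end ChartFields

/-! ### Integral curves of `∂_t + fU` are null geodesics -/

section AutonomousFlow

variable {D : Type*} [NormedAddCommGroup D] [NormedSpace ℝ D] {F : D → D} {S : Set D}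
  {c : ℝ → D} {s O : Set ℝ} {τ : ℝ}

/-- Bootstrapping: if `c` is of class `Cⁿ`, so is `c' = F ∘ c`, hence `c` is of class `Cⁿ⁺¹`. The
open set `O` keeps the parameter where the curve stays in the domain of `F`. -/
theorem contDiffWithinAt_of_integralCurve (hs : UniqueDiffOn ℝ s) (hO : IsOpen O)
    (hF : ContDiffOn ℝ ∞ F S) (hc : ∀ r ∈ s ∩ O, c r ∈ S)
    (hd : ∀ r ∈ s ∩ O, HasDerivWithinAt c (F (c r)) s r) (hτ : τ ∈ s ∩ O) :
    ContDiffWithinAt ℝ 2 c s τ := by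
  have hu : UniqueDiffOn ℝ (s ∩ O) := hs.inter hO
  have hd' : ∀ r ∈ s ∩ O, HasDerivWithinAt c (F (c r)) (s ∩ O) r := fun r hr =>
    (hd r hr).mono inter_subset_left
  have hdiff : DifferentiableOn ℝ c (s ∩ O) := fun r hr => (hd' r hr).differentiableWithinAt
  have step : ∀ n : ℕ, ContDiffOn ℝ n c (s ∩ O) := by
    intro n
    induction n with
    | zero => exact contDiffOn_zero.2 hdiff.continuousOn
    | succ n ih =>
      push_cast
      refine (contDiffOn_succ_iff_derivWithin hu).2 ⟨hdiff, by simp, ?_⟩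
      refine ((hF.of_le (by exact_mod_cast le_top)).comp ih hc).congr fun r hr => ?_
      exact (hd' r hr).derivWithin (hu r hr)
  exact (contDiffWithinAt_inter (hO.mem_nhds hτ.2)).1 (step 2 τ hτ)

/-- The chain rule for `c' = F ∘ c`; it turns an identity for the field at a point into an equation
for the acceleration of the curve. -/
theorem derivWithin_derivWithin_of_integralCurve (hs : UniqueDiffOn ℝ s) (hO : IsOpen O)
    (hF : ContDiffOn ℝ ∞ F S) (hc : ∀ r ∈ s ∩ O, c r ∈ S)
    (hd : ∀ r ∈ s ∩ O, HasDerivWithinAt c (F (c r)) s r) (hτ : τ ∈ s ∩ O) :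
    derivWithin (derivWithin c s) s τ = fderivWithin ℝ F S (c τ) (F (c τ)) := by
  have hu : UniqueDiffOn ℝ (s ∩ O) := hs.inter hO
  rw [← derivWithin_inter (hO.mem_nhds hτ.2)]
  have h1 := ((hF.differentiableOn (by simp)) (c τ) (hc τ hτ)).hasFDerivWithinAt
  have h2 := h1.comp_hasDerivWithinAt τ ((hd τ hτ).mono inter_subset_left) hc
  rw [derivWithin_congr (f := F ∘ c) (fun r hr => (hd r hr).derivWithin (hs r hr.1))
    ((hd τ hτ).derivWithin (hs τ hτ.1))]
  exact h2.derivWithin (hu τ hτ)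

end AutonomousFlow

section Geodesics

variable {M : Type*} [TopologicalSpace M] [ChartedSpace E3 M] [IsManifold (𝓡 3) ∞ M]
  {J : Set ℝ} {f : ℝ → M → ℝ}
  {g : ℝ → ∀ x : M, TangentSpace (𝓡 3) x →L[ℝ] TangentSpace (𝓡 3) x →L[ℝ] ℝ}
  {U : ℝ → ∀ x : M, TangentSpace (𝓡 3) x}
  {T : ℝ → ∀ x : M, TangentSpace (𝓡 3) x →L[ℝ] TangentSpace (𝓡 3) x →L[ℝ] ℝ}
  {γ : ℝ → ℝ × M} {s : Set ℝ} {τ : ℝ}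

/-- The field `∂_t + fU` in the chart around `x₀`. -/
def chartNullField (f : ℝ → M → ℝ) (U : ℝ → ∀ x : M, TangentSpace (𝓡 3) x) (x₀ : M)
    (q : ℝ × E3) : ℝ × E3 :=
  (1, chartFun (f q.1) x₀ q.2 • chartVec (U q.1) x₀ q.2)

omit [IsManifold (𝓡 3) ∞ M] in
theorem hasDerivWithinAt_fst_of_integralCurve
    (hγ : IsMIntegralCurveOn (I := 𝓘(ℝ, ℝ).prod (𝓡 3)) γ (nullField f U) s) (hτ : τ ∈ s) :
    HasDerivWithinAt (fun r => (γ r).1) 1 s τ := by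
  have h := (hasMFDerivAt_fst (I := 𝓘(ℝ, ℝ)) (I' := 𝓡 3) (γ τ)).comp_hasMFDerivWithinAt τ (hγ τ hτ)
  have h2 : HasFDerivWithinAt (fun r => (γ r).1) ((ContinuousLinearMap.fst ℝ ℝ E3).comp
      ((1 : ℝ →L[ℝ] ℝ).smulRight ((1 : ℝ), (f (γ τ).1 (γ τ).2 • U (γ τ).1 (γ τ).2 : E3)))) s τ :=
    h.hasFDerivWithinAt
  exact h2.hasDerivWithinAt.congr_deriv (by simp)

theorem hasDerivWithinAt_of_comp_snd {c : ℝ → E3} {L : E3 →L[ℝ] E3} {v : E3}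
    (h : HasFDerivWithinAt c (L.comp ((ContinuousLinearMap.snd ℝ ℝ E3).comp
      ((1 : ℝ →L[ℝ] ℝ).smulRight ((1 : ℝ), v)))) s τ) : HasDerivWithinAt c (L v) s τ :=
  h.hasDerivWithinAt.congr_deriv (by simp)

theorem hasDerivWithinAt_chart_of_integralCurve
    (hγ : IsMIntegralCurveOn (I := 𝓘(ℝ, ℝ).prod (𝓡 3)) γ (nullField f U) s) (hτ : τ ∈ s) {x₀ : M}
    (hx : (γ τ).2 ∈ (extChartAt (𝓡 3) x₀).source) :
    HasDerivWithinAt (fun r => ((γ r).1, extChartAt (𝓡 3) x₀ (γ r).2))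
      (chartNullField f U x₀ ((γ τ).1, extChartAt (𝓡 3) x₀ (γ τ).2)) s τ := by
  have := isManifold_one (M := M)
  have hx' : (γ τ).2 ∈ (chartAt E3 x₀).source := by rwa [← extChartAt_source (𝓡 3)]
  have hφ : HasMFDerivAt (𝓡 3) 𝓘(ℝ, E3) (extChartAt (𝓡 3) x₀) (γ τ).2
      (mfderiv (𝓡 3) 𝓘(ℝ, E3) (extChartAt (𝓡 3) x₀) (γ τ).2) :=
    (mdifferentiableAt_extChartAt hx').hasMFDerivAt
  have h := hφ.comp_hasMFDerivWithinAt τ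
    ((hasMFDerivAt_snd (I := 𝓘(ℝ, ℝ)) (I' := 𝓡 3) (γ τ)).comp_hasMFDerivWithinAt τ (hγ τ hτ))
  have h2 : HasFDerivWithinAt (fun r => extChartAt (𝓡 3) x₀ (γ r).2)
      ((mfderiv (𝓡 3) 𝓘(ℝ, E3) (extChartAt (𝓡 3) x₀) (γ τ).2 : E3 →L[ℝ] E3).comp
        ((ContinuousLinearMap.snd ℝ ℝ E3).comp ((1 : ℝ →L[ℝ] ℝ).smulRight
          ((1 : ℝ), (f (γ τ).1 (γ τ).2 • U (γ τ).1 (γ τ).2 : E3))))) s τ :=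
    h.hasFDerivWithinAt
  refine ((hasDerivWithinAt_fst_of_integralCurve hγ hτ).prodMk
    (hasDerivWithinAt_of_comp_snd h2)).congr_deriv ?_
  rw [chartNullField, chartFun, chartVec]
  rw [(extChartAt (𝓡 3) x₀).left_inv hx]
  have e : ∀ (L : E3 →L[ℝ] E3) (a : ℝ) (v : E3), ((1 : ℝ), L (a • v)) = (1, a • L v) := by simp
  exact e _ _ _

omit [IsManifold (𝓡 3) ∞ M] in
theorem continuousOn_of_integralCurve
    (hγ : IsMIntegralCurveOn (I := 𝓘(ℝ, ℝ).prod (𝓡 3)) γ (nullField f U) s) : ContinuousOn γ s :=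
  fun τ hτ => (hγ τ hτ).1

omit [IsManifold (𝓡 3) ∞ M] in
/-- Near a parameter, an integral curve stays in a chart. -/
theorem exists_isOpen_chart_of_integralCurve
    (hγ : IsMIntegralCurveOn (I := 𝓘(ℝ, ℝ).prod (𝓡 3)) γ (nullField f U) s) (hτ : τ ∈ s) {x₀ : M}
    (hx : (γ τ).2 ∈ (extChartAt (𝓡 3) x₀).source) :
    ∃ O : Set ℝ, IsOpen O ∧ τ ∈ O ∧ ∀ r ∈ s ∩ O, (γ r).2 ∈ (extChartAt (𝓡 3) x₀).source := by
  have h : ContinuousWithinAt (fun r => (γ r).2) s τ :=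
    (continuousOn_of_integralCurve hγ).snd τ hτ
  obtain ⟨O, hO, hτO, hsub⟩ := mem_nhdsWithin.1
    (h.preimage_mem_nhdsWithin ((isOpen_extChartAt_source x₀).mem_nhds hx))
  exact ⟨O, hO, hτO, fun r hr => hsub ⟨hr.2, hr.1⟩⟩

theorem IsEvolvingTriple.contDiffOn_chartNullField (h : IsEvolvingTriple J f g U) (x₀ : M) :
    ContDiffOn ℝ ∞ (chartNullField f U x₀) (J ×ˢ (extChartAt (𝓡 3) x₀).target) :=
  contDiffOn_const.prodMk
    ((contDiffOn_chartFun h.smooth_f x₀).smul (contDiffOn_chartVec h.smooth_U x₀))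

theorem IsEvolvingTriple.contDiffWithinAt_chart_of_integralCurve (h : IsEvolvingTriple J f g U)
    (hs : UniqueDiffOn ℝ s) (hsJ : ∀ r ∈ s, (γ r).1 ∈ J)
    (hγ : IsMIntegralCurveOn (I := 𝓘(ℝ, ℝ).prod (𝓡 3)) γ (nullField f U) s) (hτ : τ ∈ s) {x₀ : M}
    (hx : (γ τ).2 ∈ (extChartAt (𝓡 3) x₀).source) :
    ContDiffWithinAt ℝ 2 (fun r => ((γ r).1, extChartAt (𝓡 3) x₀ (γ r).2)) s τ := by
  obtain ⟨O, hO, hτO, hsub⟩ := exists_isOpen_chart_of_integralCurve hγ hτ hx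
  exact contDiffWithinAt_of_integralCurve hs hO (h.contDiffOn_chartNullField x₀)
    (fun r hr => ⟨hsJ r hr.1, (extChartAt (𝓡 3) x₀).map_source (hsub r hr)⟩)
    (fun r hr => hasDerivWithinAt_chart_of_integralCurve hγ hr.1 (hsub r hr)) ⟨hτ, hτO⟩

omit [IsManifold (𝓡 3) ∞ M] in
/-- A function along an integral curve, in a chart. -/
theorem eventuallyEq_chart_of_integralCurve
    (hγ : IsMIntegralCurveOn (I := 𝓘(ℝ, ℝ).prod (𝓡 3)) γ (nullField f U) s) (hτ : τ ∈ s) {x₀ : M}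
    (hx : (γ τ).2 ∈ (extChartAt (𝓡 3) x₀).source) (k : ℝ → M → ℝ) :
    (fun r => k (γ r).1 (γ r).2) =ᶠ[nhdsWithin τ s]
      (fun q : ℝ × E3 => chartFun (k q.1) x₀ q.2) ∘
        fun r => ((γ r).1, extChartAt (𝓡 3) x₀ (γ r).2) := by
  obtain ⟨O, hO, hτO, hsub⟩ := exists_isOpen_chart_of_integralCurve hγ hτ hx
  filter_upwards [inter_mem_nhdsWithin s (hO.mem_nhds hτO)] with r hr
  simp only [Function.comp, chartFun]
  rw [(extChartAt (𝓡 3) x₀).left_inv (hsub r hr)]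

/-- The derivative of a function along an integral curve, in a chart. -/
theorem hasDerivWithinAt_comp_of_integralCurve (hsJ : ∀ r ∈ s, (γ r).1 ∈ J)
    (hγ : IsMIntegralCurveOn (I := 𝓘(ℝ, ℝ).prod (𝓡 3)) γ (nullField f U) s) (hτ : τ ∈ s) {x₀ : M}
    (hx : (γ τ).2 ∈ (extChartAt (𝓡 3) x₀).source) {k : ℝ → M → ℝ}
    (hk : DifferentiableWithinAt ℝ (fun q : ℝ × E3 => chartFun (k q.1) x₀ q.2)
      (J ×ˢ (extChartAt (𝓡 3) x₀).target) ((γ τ).1, extChartAt (𝓡 3) x₀ (γ τ).2)) :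
    HasDerivWithinAt (fun r => k (γ r).1 (γ r).2)
      (fderivWithin ℝ (fun q : ℝ × E3 => chartFun (k q.1) x₀ q.2)
        (J ×ˢ (extChartAt (𝓡 3) x₀).target) ((γ τ).1, extChartAt (𝓡 3) x₀ (γ τ).2)
        (chartNullField f U x₀ ((γ τ).1, extChartAt (𝓡 3) x₀ (γ τ).2))) s τ := by
  obtain ⟨O, hO, hτO, hsub⟩ := exists_isOpen_chart_of_integralCurve hγ hτ hx
  have h1 : HasDerivWithinAt ((fun q : ℝ × E3 => chartFun (k q.1) x₀ q.2) ∘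
      fun r => ((γ r).1, extChartAt (𝓡 3) x₀ (γ r).2)) _ (s ∩ O) τ :=
    HasFDerivWithinAt.comp_hasDerivWithinAt τ (t := J ×ˢ (extChartAt (𝓡 3) x₀).target)
      hk.hasFDerivWithinAt
      ((hasDerivWithinAt_chart_of_integralCurve hγ hτ hx).mono inter_subset_left)
      fun r hr => ⟨hsJ r hr.1, (extChartAt (𝓡 3) x₀).map_source (hsub r hr)⟩
  rw [hasDerivWithinAt_inter (hO.mem_nhds hτO)] at h1
  exact h1.congr_of_eventuallyEq (eventuallyEq_chart_of_integralCurve hγ hτ hx k)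
    ((eventuallyEq_chart_of_integralCurve hγ hτ hx k).self_of_nhdsWithin hτ)

/-- Needed for the continuity of `α`, the logarithmic derivative of `f` along the curve. -/
theorem IsEvolvingTriple.contDiffOn_lapse_of_integralCurve (h : IsEvolvingTriple J f g U)
    (hs : UniqueDiffOn ℝ s) (hsJ : ∀ r ∈ s, (γ r).1 ∈ J)
    (hγ : IsMIntegralCurveOn (I := 𝓘(ℝ, ℝ).prod (𝓡 3)) γ (nullField f U) s) :
    ContDiffOn ℝ 1 (fun r => f (γ r).1 (γ r).2) s := by
  intro τ hτ
  have hx := mem_extChartAt_source (I := 𝓡 3) (γ τ).2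
  obtain ⟨O, hO, hτO, hsub⟩ := exists_isOpen_chart_of_integralCurve hγ hτ hx
  have hc := (h.contDiffWithinAt_chart_of_integralCurve hs hsJ hγ hτ hx).of_le
    (m := 1) (by norm_num)
  have h1 : ContDiffWithinAt ℝ 1 ((fun q : ℝ × E3 => chartFun (f q.1) (γ τ).2 q.2) ∘
      fun r => ((γ r).1, extChartAt (𝓡 3) (γ τ).2 (γ r).2)) (s ∩ O) τ :=
    (((contDiffOn_chartFun h.smooth_f (γ τ).2).of_le (by simp)) _
      ⟨hsJ τ hτ, (extChartAt (𝓡 3) (γ τ).2).map_source hx⟩).comp τ (hc.mono inter_subset_left)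
      fun r hr => ⟨hsJ r hr.1, (extChartAt (𝓡 3) (γ τ).2).map_source (hsub r hr)⟩
  rw [contDiffWithinAt_inter (hO.mem_nhds hτO)] at h1
  exact h1.congr_of_eventuallyEq (eventuallyEq_chart_of_integralCurve hγ hτ hx f)
    ((eventuallyEq_chart_of_integralCurve hγ hτ hx f).self_of_nhdsWithin hτ)

theorem IsEvolvingTriple.isNullGeodesicOn (h : IsEvolvingTriple J f g U) (he : Evolves J f g U T)
    (hJ : J.OrdConnected) (hJ' : J.Nontrivial) (hs : s.OrdConnected) (hs' : s.Nontrivial)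
    (hsJ : ∀ r ∈ s, (γ r).1 ∈ J)
    (hγ : IsMIntegralCurveOn (I := 𝓘(ℝ, ℝ).prod (𝓡 3)) γ (nullField f U) s) :
    IsNullGeodesicOn J f g γ s := by
  have hu : UniqueDiffOn ℝ s := uniqueDiffOn_convex (convex_iff_ordConnected.2 hs)
    (interior_nonempty_of_nontrivial hs hs')
  have hlapse := h.contDiffOn_lapse_of_integralCurve hu hsJ hγ
  -- This choice of `α` refers to no chart, so one function serves in all of them.
  refine ⟨fun τ => derivWithin (fun r => f (γ r).1 (γ r).2) s τ / f (γ τ).1 (γ τ).2,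
    (hlapse.continuousOn_derivWithin hu le_rfl).div hlapse.continuousOn
      fun τ hτ => h.f_ne _ (hsJ τ hτ) _, ?_⟩
  intro x₀ τ hτ hx
  have hS := h.slicedFields hJ hJ' x₀
  have hE := (he x₀).evolvingFields hS
  have hp : ((γ τ).1, extChartAt (𝓡 3) x₀ (γ τ).2) ∈ J ×ˢ (extChartAt (𝓡 3) x₀).target :=
    ⟨hsJ τ hτ, (extChartAt (𝓡 3) x₀).map_source hx⟩
  have hd := (hasDerivWithinAt_chart_of_integralCurve hγ hτ hx).derivWithin (hu τ hτ)
  have hα := (hasDerivWithinAt_comp_of_integralCurve hsJ hγ hτ hx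
    (hS.differentiable_f hp)).derivWithin (hu τ hτ)
  have hf : chartFun (f (γ τ).1) x₀ (extChartAt (𝓡 3) x₀ (γ τ).2) = f (γ τ).1 (γ τ).2 := by
    rw [chartFun, (extChartAt (𝓡 3) x₀).left_inv hx]
  obtain ⟨O, hO, hτO, hsub⟩ := exists_isOpen_chart_of_integralCurve hγ hτ hx
  have hdd := derivWithin_derivWithin_of_integralCurve hu hO (h.contDiffOn_chartNullField x₀)
    (fun r hr => ⟨hsJ r hr.1, (extChartAt (𝓡 3) x₀).map_source (hsub r hr)⟩)
    (fun r hr => hasDerivWithinAt_chart_of_integralCurve hγ hr.1 (hsub r hr)) ⟨hτ, hτO⟩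
  have hn := hE.nabla_nullField hp
  intro c c' G
  refine ⟨h.contDiffWithinAt_chart_of_integralCurve hu hsJ hγ hτ hx, ?_, ?_, ?_⟩
  · intro h0
    have : (1 : ℝ) = 0 := congrArg Prod.fst (hd.symm.trans h0)
    exact one_ne_zero this
  · have h1 : c' τ = chartNullField f U x₀ (c τ) := hd
    rw [h1]
    refine (lorentzMetric_apply (fun q : ℝ × E3 => chartFun (f q.1) x₀ q.2)
      (fun q => chartTensor (g q.1) x₀ q.2) (c τ) _ _).trans ?_
    have h2 := hS.unit _ hp
    simp only [chartNullField, map_smul, smul_apply, smul_eq_mul]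
    rw [h2]
    ring
  · have h1 : c' τ = chartNullField f U x₀ (c τ) := hd
    have h2 : derivWithin c' s τ = _ := hdd
    rw [h1, h2]
    beta_reduce
    rw [hα, ← hf]
    exact hn

end Geodesics

/-! ### The shear on the manifold -/

section Shear

variable {M : Type*} [TopologicalSpace M] [ChartedSpace E3 M] [IsManifold (𝓡 3) ∞ M]
  {J : Set ℝ} {f : ℝ → M → ℝ}
  {g : ℝ → ∀ x : M, TangentSpace (𝓡 3) x →L[ℝ] TangentSpace (𝓡 3) x →L[ℝ] ℝ}
  {U : ℝ → ∀ x : M, TangentSpace (𝓡 3) x}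

/-- A tangent vector extends to a vector field with constant coefficients in a chart. -/
theorem exists_extension {x₀ : M} {y : E3} (hy : y ∈ (extChartAt (𝓡 3) x₀).target) (v : E3) :
    ∃ X : ∀ x : M, TangentSpace (𝓡 3) x, MDifferentiableAt (𝓡 3) ((𝓡 3).prod 𝓘(ℝ, E3))
      (fun z => (⟨z, X z⟩ : TangentBundle (𝓡 3) M)) ((extChartAt (𝓡 3) x₀).symm y) ∧
      chartVec X x₀ y = v := by
  refine ⟨fun z => chartInvDeriv x₀ (extChartAt (𝓡 3) x₀ z) v, ?_, ?_⟩
  · have hx := (extChartAt (𝓡 3) x₀).map_target hy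
    have h1 : ContMDiffOn (𝓡 3) 𝓘(ℝ, ℝ × E3) ∞ (fun z : M => ((0 : ℝ), extChartAt (𝓡 3) x₀ z))
        (extChartAt (𝓡 3) x₀).source := by
      rw [extChartAt_source]
      exact contMDiffOn_const.prodMk_space contMDiffOn_extChartAt
    have h2 := (contMDiffOn_chartInvDeriv univ x₀ v).comp h1 fun z hz =>
      ⟨mem_univ _, (extChartAt (𝓡 3) x₀).map_source hz⟩
    have e : ∀ (z z' : M) (_ : z = z') (a : E3), (⟨z, a⟩ : TangentBundle (𝓡 3) M) = ⟨z', a⟩ := by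
      rintro z _ rfl a; rfl
    have h3 : ContMDiffOn (𝓡 3) ((𝓡 3).prod 𝓘(ℝ, E3)) ∞
        (fun z => (⟨z, chartInvDeriv x₀ (extChartAt (𝓡 3) x₀ z) v⟩ : TangentBundle (𝓡 3) M))
        (extChartAt (𝓡 3) x₀).source :=
      h2.congr fun z hz => e _ _ ((extChartAt (𝓡 3) x₀).left_inv hz).symm _
    exact (h3.contMDiffAt ((isOpen_extChartAt_source x₀).mem_nhds hx)).mdifferentiableAt (by simp)
  · have e : chartInvDeriv x₀ (extChartAt (𝓡 3) x₀ ((extChartAt (𝓡 3) x₀).symm y)) v =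
        chartInvDeriv x₀ y v := by rw [(extChartAt (𝓡 3) x₀).right_inv hy]
    exact (congrArg (chartDeriv x₀ y) e).trans (chartDeriv_chartInvDeriv hy v)

theorem IsEvolvingTriple.exists_chart_frame (h : IsEvolvingTriple J f g U) (hJ : J.OrdConnected)
    (hJ' : J.Nontrivial) (x₀ : M) {q : ℝ × E3} (hq : q ∈ J ×ˢ (extChartAt (𝓡 3) x₀).target) :
    ∃ X Y, IsFrame (chartTensor (g q.1) x₀ q.2) X Y (chartVec (U q.1) x₀ q.2) :=
  have hS := h.slicedFields hJ hJ' x₀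
  exists_isFrame finrank_E3 (hS.symm q hq) (hS.pos q hq) (hS.unit q hq)

/-- `W t x` is the squared norm of the shear of `U_t` at `x`. -/
def IsShearNorm (J : Set ℝ)
    (g : ℝ → ∀ x : M, TangentSpace (𝓡 3) x →L[ℝ] TangentSpace (𝓡 3) x →L[ℝ] ℝ)
    (U : ℝ → ∀ x : M, TangentSpace (𝓡 3) x) (W : ℝ → M → ℝ) : Prop :=
  ∀ x₀ : M, ∀ q ∈ J ×ˢ (extChartAt (𝓡 3) x₀).target, ∀ X Y,
    IsFrame (chartTensor (g q.1) x₀ q.2) X Y (chartVec (U q.1) x₀ q.2) →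
    chartFun (W q.1) x₀ q.2 =
      shearNorm (lieForm (fun q => chartTensor (g q.1) x₀ q.2) (J ×ˢ (extChartAt (𝓡 3) x₀).target)
        (fun q => chartVec (U q.1) x₀ q.2) q) X Y

/-- The intrinsic Lie derivative makes the value independent of the chart, and `shearNorm_eq` makes
it independent of the frame. Thus one number can be chosen at each point of `J × M`; outside `J` the
value is immaterial. -/
theorem IsEvolvingTriple.exists_isShearNorm (h : IsEvolvingTriple J f g U) (hJ : J.OrdConnected)
    (hJ' : J.Nontrivial) : ∃ W, IsShearNorm J g U W := by
  have key : ∀ (t : ℝ) (x : M), ∃ w : ℝ, t ∈ J → ∀ X Y : ∀ x : M, TangentSpace (𝓡 3) x,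
      MDifferentiableAt (𝓡 3) ((𝓡 3).prod 𝓘(ℝ, E3))
        (fun z => (⟨z, X z⟩ : TangentBundle (𝓡 3) M)) x →
      MDifferentiableAt (𝓡 3) ((𝓡 3).prod 𝓘(ℝ, E3))
        (fun z => (⟨z, Y z⟩ : TangentBundle (𝓡 3) M)) x →
      g t x (X x) (X x) = 1 → g t x (Y x) (Y x) = 1 → g t x (X x) (Y x) = 0 →
      g t x (X x) (U t x) = 0 → g t x (Y x) (U t x) = 0 →
      w = (lieDerivMetric (g t) (U t) X X x - lieDerivMetric (g t) (U t) Y Y x) ^ 2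
        + 4 * lieDerivMetric (g t) (U t) X Y x ^ 2 := by
    intro t x
    by_cases ht : t ∈ J
    · have hy := mem_extChartAt_target (I := 𝓡 3) x
      have hxy := extChartAt_to_inv (I := 𝓡 3) x
      have hq : (t, extChartAt (𝓡 3) x x) ∈ J ×ˢ (extChartAt (𝓡 3) x).target := ⟨ht, hy⟩
      have hS := h.slicedFields hJ hJ' x
      obtain ⟨X₀, Y₀, hF⟩ := h.exists_chart_frame hJ hJ' x hq
      refine ⟨shearNorm (lieForm (fun q => chartTensor (g q.1) x q.2)
        (J ×ˢ (extChartAt (𝓡 3) x).target) (fun q => chartVec (U q.1) x q.2)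
        (t, extChartAt (𝓡 3) x x)) X₀ Y₀, fun _ X Y hX hY xx yy xy xu yu => ?_⟩
      have e : ∀ A B : ∀ x : M, TangentSpace (𝓡 3) x, chartTensor (g t) x (extChartAt (𝓡 3) x x)
          (chartVec A x (extChartAt (𝓡 3) x x)) (chartVec B x (extChartAt (𝓡 3) x x)) =
          g t x (A x) (B x) := fun A B => by
        have := chartTensor_chartVec (g t) A B hy
        rwa [hxy] at this
      have hF' : IsFrame (chartTensor (g t) x (extChartAt (𝓡 3) x x))
          (chartVec X x (extChartAt (𝓡 3) x x)) (chartVec Y x (extChartAt (𝓡 3) x x))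
          (chartVec (U t) x (extChartAt (𝓡 3) x x)) :=
        ⟨(e X X).trans xx, (e Y Y).trans yy, hF.nn, (e X Y).trans xy, (e X (U t)).trans xu,
          (e Y (U t)).trans yu⟩
      have l : ∀ A B : ∀ x : M, TangentSpace (𝓡 3) x,
          MDifferentiableAt (𝓡 3) ((𝓡 3).prod 𝓘(ℝ, E3))
            (fun z => (⟨z, A z⟩ : TangentBundle (𝓡 3) M)) x →
          MDifferentiableAt (𝓡 3) ((𝓡 3).prod 𝓘(ℝ, E3))
            (fun z => (⟨z, B z⟩ : TangentBundle (𝓡 3) M)) x →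
          lieDerivMetric (g t) (U t) A B x =
            lieForm (fun q => chartTensor (g q.1) x q.2) (J ×ˢ (extChartAt (𝓡 3) x).target)
              (fun q => chartVec (U q.1) x q.2) (t, extChartAt (𝓡 3) x x)
              (chartVec A x (extChartAt (𝓡 3) x x)) (chartVec B x (extChartAt (𝓡 3) x x)) :=
          fun A B hA hB => by
        have := h.lieDerivMetric_eq hJ hJ' ht hy (X := A) (Y := B) (by rwa [hxy]) (by rwa [hxy])
        rwa [hxy] at this
      rw [l X X hX hX, l Y Y hY hY, l X Y hX hY]
      exact (shearNorm_eq finrank_E3 (hS.symm _ hq) hF hF' (hS.lieForm_symm hq)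
        (lieForm_combination _ _)).symm
    · exact ⟨0, fun h' => absurd h' ht⟩
  choose W hW using key
  refine ⟨W, fun x₀ q hq X Y hF => ?_⟩
  obtain ⟨A, hA, rfl⟩ := exists_extension hq.2 X
  obtain ⟨B, hB, rfl⟩ := exists_extension hq.2 Y
  have e := fun A B => chartTensor_chartVec (g q.1) A B hq.2
  rw [chartFun, hW q.1 _ hq.1 A B hA hB ((e A A).symm.trans hF.xx) ((e B B).symm.trans hF.yy)
    ((e A B).symm.trans hF.xy) ((e A (U q.1)).symm.trans hF.xn) ((e B (U q.1)).symm.trans hF.yn),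
    h.lieDerivMetric_eq hJ hJ' hq.1 hq.2 hA hA, h.lieDerivMetric_eq hJ hJ' hq.1 hq.2 hB hB,
    h.lieDerivMetric_eq hJ hJ' hq.1 hq.2 hA hB]
  rfl

variable {W : ℝ → M → ℝ} {t : ℝ} {A : Set M}

theorem IsShearNorm.nonneg (hW : IsShearNorm J g U W) (h : IsEvolvingTriple J f g U)
    (hJ : J.OrdConnected) (hJ' : J.Nontrivial) (ht : t ∈ J) (x : M) : 0 ≤ W t x := by
  have hq : (t, extChartAt (𝓡 3) x x) ∈ J ×ˢ (extChartAt (𝓡 3) x).target :=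
    ⟨ht, mem_extChartAt_target (I := 𝓡 3) x⟩
  obtain ⟨X, Y, hF⟩ := h.exists_chart_frame hJ hJ' x hq
  have := hW x _ hq X Y hF
  rw [chartFun, extChartAt_to_inv] at this
  rw [this]
  exact shearNorm_nonneg _ _ _

theorem IsShearNorm.eq_zero_of_conformal (hW : IsShearNorm J g U W) (h : IsEvolvingTriple J f g U)
    (hJ : J.OrdConnected) (hJ' : J.Nontrivial) (ht : t ∈ J)
    (hc : IsTangentToConformalFoliationOn (g t) (U t) A) {x : M} (hx : x ∈ A) : W t x = 0 := by
  obtain ⟨a, ha⟩ := hc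
  have hy := mem_extChartAt_target (I := 𝓡 3) x
  have hxy := extChartAt_to_inv (I := 𝓡 3) x
  have hq : (t, extChartAt (𝓡 3) x x) ∈ J ×ˢ (extChartAt (𝓡 3) x).target := ⟨ht, hy⟩
  obtain ⟨X, Y, hF⟩ := h.exists_chart_frame hJ hJ' x hq
  have e1 := hW x _ hq X Y hF
  obtain ⟨B, hB, rfl⟩ := exists_extension hy X
  obtain ⟨D, hD, rfl⟩ := exists_extension hy Y
  have e := fun A B => chartTensor_chartVec (g t) A B hy
  have hx' : (extChartAt (𝓡 3) x).symm (extChartAt (𝓡 3) x x) ∈ A := by rwa [hxy]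
  have sB := (h.symm t ht _ _ _).trans ((e B (U t)).symm.trans hF.xn)
  have sD := (h.symm t ht _ _ _).trans ((e D (U t)).symm.trans hF.yn)
  have l1 := ha _ hx' B B hB hB sB sB
  have l2 := ha _ hx' D D hD hD sD sD
  have l3 := ha _ hx' B D hB hD sB sD
  rw [h.lieDerivMetric_eq hJ hJ' ht hy hB hB, ← e, hF.xx] at l1
  rw [h.lieDerivMetric_eq hJ hJ' ht hy hD hD, ← e, hF.yy] at l2
  rw [h.lieDerivMetric_eq hJ hJ' ht hy hB hD, ← e, hF.xy] at l3
  rw [chartFun, hxy, shearNorm, l1, l2, l3] at e1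
  rw [e1]
  ring

/-- A sum of two squares vanishes, so on the plane orthogonal to `N` the form is a multiple of the
metric, with factor its value on the unit vector `X`. -/
theorem form_eq_of_shearNorm_eq_zero {B : E3 →L[ℝ] E3 →L[ℝ] ℝ} (hB : ∀ v w, B v w = B w v)
    {X Y N : E3} (hF : IsFrame B X Y N) {l : E3 → E3 → ℝ} (hl : ∀ v w, l v w = l w v)
    (hadd : ∀ (a b : ℝ) (v w z : E3), l (a • v + b • w) z = a * l v z + b * l w z)
    (h0 : shearNorm l X Y = 0) {v w : E3} (hv : B v N = 0) (hw : B w N = 0) :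
    l v w = l X X * B v w := by
  have h1 : l X X - l Y Y = 0 := by
    unfold shearNorm at h0; nlinarith [sq_nonneg (l X X - l Y Y), sq_nonneg (l X Y)]
  have h2 : l X Y = 0 := by
    unfold shearNorm at h0; nlinarith [sq_nonneg (l X X - l Y Y), sq_nonneg (l X Y)]
  have ev := hF.expand finrank_E3 hB v
  have ew := hF.expand finrank_E3 hB w
  rw [hv, zero_smul, add_zero] at ev
  rw [hw, zero_smul, add_zero] at ew
  have hadd' : ∀ (a b : ℝ) (v w z : E3), l z (a • v + b • w) = a * l z v + b * l z w := by
    intro a b v w z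
    rw [hl, hadd, hl v, hl w]
  have hYX : l Y X = 0 := (hl Y X).trans h2
  have hYY : l Y Y = l X X := by linarith
  have e1 : l v w = l X X * (B v X * B w X + B v Y * B w Y) := by
    conv_lhs => rw [ev, ew]
    rw [hadd, hadd', hadd', h2, hYX, hYY]
    ring
  have e2 : B v w = B v X * B w X + B v Y * B w Y := by
    conv_lhs => rw [ew]
    simp only [map_add, map_smul, smul_eq_mul]
    ring
  rw [e1, e2]

theorem IsShearNorm.conformal_of_eq_zero (hW : IsShearNorm J g U W) (h : IsEvolvingTriple J f g U)
    (hJ : J.OrdConnected) (hJ' : J.Nontrivial) (ht : t ∈ J) (h0 : ∀ x ∈ A, W t x = 0) :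
    IsTangentToConformalFoliationOn (g t) (U t) A := by
  have hq : ∀ x : M, (t, extChartAt (𝓡 3) x x) ∈ J ×ˢ (extChartAt (𝓡 3) x).target :=
    fun x => ⟨ht, mem_extChartAt_target (I := 𝓡 3) x⟩
  choose X Y hF using fun x => h.exists_chart_frame hJ hJ' x (hq x)
  -- The conformal factor at `x` is the value of `ℒ_U g` on the first vector of any frame chosen at
  -- `x`.
  refine ⟨fun x => lieForm (fun q => chartTensor (g q.1) x q.2) (J ×ˢ (extChartAt (𝓡 3) x).target)
    (fun q => chartVec (U q.1) x q.2) (t, extChartAt (𝓡 3) x x) (X x) (X x), ?_⟩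
  intro x hx P Q hP hQ hPU hQU
  have hS := h.slicedFields hJ hJ' x
  have hy := mem_extChartAt_target (I := 𝓡 3) x
  have hxy := extChartAt_to_inv (I := 𝓡 3) x
  have e : ∀ A B : ∀ x : M, TangentSpace (𝓡 3) x, chartTensor (g t) x (extChartAt (𝓡 3) x x)
      (chartVec A x (extChartAt (𝓡 3) x x)) (chartVec B x (extChartAt (𝓡 3) x x)) =
      g t x (A x) (B x) := fun A B => by
    have := chartTensor_chartVec (g t) A B hy
    rwa [hxy] at this
  have e1 := hW x _ (hq x) _ _ (hF x)
  rw [chartFun, hxy, h0 x hx] at e1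
  have l := h.lieDerivMetric_eq hJ hJ' ht hy (X := P) (Y := Q) (by rwa [hxy]) (by rwa [hxy])
  rw [hxy] at l
  rw [l, form_eq_of_shearNorm_eq_zero (hS.symm _ (hq x)) (hF x) (hS.lieForm_symm (hq x))
    (lieForm_combination _ _) e1.symm ((e P (U t)).trans ((h.symm t ht _ _ _).trans hPU))
    ((e Q (U t)).trans ((h.symm t ht _ _ _).trans hQU))]
  exact congrArg _ (e P Q)

end Shear

/-! ### Propagation of the vanishing of the shear -/

section Propagation

/-- Grönwall: `exp(-Cτ) w` is nonincreasing and starts at zero, so `w t ≤ 0`. -/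
theorem eq_zero_of_hasDerivWithinAt_le {w d : ℝ → ℝ} {t C : ℝ} (ht : 0 ≤ t)
    (hd : ∀ τ ∈ Icc 0 t, HasDerivWithinAt w (d τ) (Icc 0 t) τ)
    (hle : ∀ τ ∈ Icc 0 t, d τ ≤ C * w τ) (hnn : 0 ≤ w t) (h0 : w 0 = 0) : w t = 0 := by
  have hu : ∀ τ ∈ Icc 0 t, HasDerivWithinAt (fun r => Real.exp (-C * r) * w r)
      (Real.exp (-C * τ) * (-C) * w τ + Real.exp (-C * τ) * d τ) (Icc 0 t) τ := by
    intro τ hτ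
    have h1 : HasDerivAt (fun r => Real.exp (-C * r)) (Real.exp (-C * τ) * (-C)) τ := by
      simpa using ((hasDerivAt_id τ).const_mul (-C)).exp
    exact h1.hasDerivWithinAt.mul (hd τ hτ)
  have hder : ∀ τ ∈ interior (Icc 0 t), HasDerivAt (fun r => Real.exp (-C * r) * w r)
      (Real.exp (-C * τ) * (-C) * w τ + Real.exp (-C * τ) * d τ) τ := fun τ hτ =>
    (hu τ (interior_subset hτ)).hasDerivAt (mem_interior_iff_mem_nhds.1 hτ)
  have hanti := antitoneOn_of_deriv_nonpos (convex_Icc 0 t)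
    (fun τ hτ => (hu τ hτ).continuousWithinAt)
    (fun τ hτ => (hder τ hτ).differentiableAt.differentiableWithinAt) (fun τ hτ => by
      rw [(hder τ hτ).deriv]
      have := mul_le_mul_of_nonneg_left (hle τ (interior_subset hτ)) (Real.exp_pos (-C * τ)).le
      linarith)
  have h1 := hanti ⟨le_rfl, ht⟩ ⟨ht, le_rfl⟩ ht
  simp only [h0, mul_zero] at h1
  exact le_antisymm (nonpos_of_mul_nonpos_right h1 (Real.exp_pos _)) hnn

variable {M : Type*} [TopologicalSpace M] [ChartedSpace E3 M] [IsManifold (𝓡 3) ∞ M]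
  {J : Set ℝ} {f : ℝ → M → ℝ}
  {g : ℝ → ∀ x : M, TangentSpace (𝓡 3) x →L[ℝ] TangentSpace (𝓡 3) x →L[ℝ] ℝ}
  {U : ℝ → ∀ x : M, TangentSpace (𝓡 3) x}
  {T : ℝ → ∀ x : M, TangentSpace (𝓡 3) x →L[ℝ] TangentSpace (𝓡 3) x →L[ℝ] ℝ}
  {W : ℝ → M → ℝ} {t : ℝ}

/-- In the chart around `x₀`, the function `W` is differentiable at `q` and its derivative along
`∂_t + fU` is at most `C W`. -/
structure GrowthAt (J : Set ℝ) (f : ℝ → M → ℝ) (U : ℝ → ∀ x : M, TangentSpace (𝓡 3) x)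
    (W : ℝ → M → ℝ) (C : ℝ) (x₀ : M) (q : ℝ × M) : Prop where
  mem_source : q.2 ∈ (extChartAt (𝓡 3) x₀).source
  differentiable : DifferentiableWithinAt ℝ (fun p : ℝ × E3 => chartFun (W p.1) x₀ p.2)
    (J ×ˢ (extChartAt (𝓡 3) x₀).target) (q.1, extChartAt (𝓡 3) x₀ q.2)
  le : fderivWithin ℝ (fun p : ℝ × E3 => chartFun (W p.1) x₀ p.2)
    (J ×ˢ (extChartAt (𝓡 3) x₀).target) (q.1, extChartAt (𝓡 3) x₀ q.2)
    (chartNullField f U x₀ (q.1, extChartAt (𝓡 3) x₀ q.2)) ≤ C * W q.1 q.2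

theorem IsShearNorm.eventually_growthAt (hW : IsShearNorm J g U W) (h : IsEvolvingTriple J f g U)
    (he : Evolves J f g U T) (hQ : QuadCondition J f g U T) (hJ : J.OrdConnected)
    (hJ' : J.Nontrivial) (ht : t ∈ J) (x₀ : M) :
    ∃ C, ∀ᶠ q in nhdsWithin (t, x₀) (J ×ˢ univ), GrowthAt J f U W C x₀ q := by
  have hS := h.slicedFields hJ hJ' x₀
  have hp : (t, extChartAt (𝓡 3) x₀ x₀) ∈ J ×ˢ (extChartAt (𝓡 3) x₀).target :=
    ⟨ht, mem_extChartAt_target (I := 𝓡 3) x₀⟩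
  obtain ⟨C, hC⟩ := ((he x₀).evolvingFields hS).shear_estimate finrank_E3
    (fun p hp => QuadLocally.quadAt hS (he x₀) (hQ x₀) hp)
    (W := fun p : ℝ × E3 => chartFun (W p.1) x₀ p.2) (hW x₀) hp
  refine ⟨C, ?_⟩
  have hx := mem_extChartAt_source (I := 𝓡 3) x₀
  have hsrc : ∀ᶠ q : ℝ × M in nhdsWithin (t, x₀) (J ×ˢ univ),
      q.2 ∈ (extChartAt (𝓡 3) x₀).source :=
    mem_nhdsWithin_of_mem_nhds (continuous_snd.continuousAt.preimage_mem_nhds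
      ((isOpen_extChartAt_source x₀).mem_nhds hx))
  have hcont : ContinuousAt (fun q : ℝ × M => (q.1, extChartAt (𝓡 3) x₀ q.2)) (t, x₀) :=
    continuousAt_fst.prodMk
      (ContinuousAt.comp (x := (t, x₀)) (continuousAt_extChartAt x₀) continuousAt_snd)
  have htend : Filter.Tendsto (fun q : ℝ × M => (q.1, extChartAt (𝓡 3) x₀ q.2))
      (nhdsWithin (t, x₀) (J ×ˢ univ))
      (nhdsWithin (t, extChartAt (𝓡 3) x₀ x₀) (J ×ˢ (extChartAt (𝓡 3) x₀).target)) := by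
    refine tendsto_nhdsWithin_iff.2 ⟨hcont.tendsto.mono_left nhdsWithin_le_nhds, ?_⟩
    filter_upwards [hsrc, self_mem_nhdsWithin] with q hq hqJ
    exact ⟨hqJ.1, (extChartAt (𝓡 3) x₀).map_source hq⟩
  filter_upwards [htend.eventually hC, hsrc] with q hq hqs
  refine ⟨hqs, hq.1, ?_⟩
  have := hq.2
  simp only [chartFun, (extChartAt (𝓡 3) x₀).left_inv hqs] at this
  simpa only [chartNullField, chartFun, (extChartAt (𝓡 3) x₀).left_inv hqs] using this

/-- Compactness gives one constant for all of `K`: finitely many local constants are replaced by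
their maximum, which is allowed because `W ≥ 0`. -/
theorem IsShearNorm.exists_growthAt (hW : IsShearNorm J g U W) (h : IsEvolvingTriple J f g U)
    (he : Evolves J f g U T) (hQ : QuadCondition J f g U T) (hJ : J.OrdConnected)
    (hJ' : J.Nontrivial) {K : Set (ℝ × M)} (hK : IsCompact K) (hKJ : K ⊆ J ×ˢ univ) :
    ∃ C, ∀ q ∈ K, ∃ x₀, GrowthAt J f U W C x₀ q := by
  -- The induction runs over arbitrary sets, so membership in `J`, needed for `W ≥ 0`, is carried
  -- inside the statement.
  suffices ∃ C, ∀ q ∈ K, q.1 ∈ J → ∃ x₀, GrowthAt J f U W C x₀ q by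
    obtain ⟨C, hC⟩ := this
    exact ⟨C, fun q hq => hC q hq (hKJ hq).1⟩
  have mono : ∀ {C D : ℝ} {x₀ : M} {q : ℝ × M}, q.1 ∈ J → C ≤ D → GrowthAt J f U W C x₀ q →
      GrowthAt J f U W D x₀ q := fun hq hCD hG => ⟨hG.1, hG.2, hG.3.trans
    (mul_le_mul_of_nonneg_right hCD (hW.nonneg h hJ hJ' hq _))⟩
  refine hK.induction_on (p := fun K => ∃ C, ∀ q ∈ K, q.1 ∈ J → ∃ x₀, GrowthAt J f U W C x₀ q)
    ⟨0, by simp⟩ ?_ ?_ ?_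
  · rintro A B hAB ⟨C, hC⟩
    exact ⟨C, fun q hq => hC q (hAB hq)⟩
  · rintro A B ⟨C, hC⟩ ⟨D, hD⟩
    refine ⟨max C D, ?_⟩
    rintro q (hq | hq) hqJ
    · obtain ⟨x₀, hG⟩ := hC q hq hqJ
      exact ⟨x₀, mono hqJ (le_max_left _ _) hG⟩
    · obtain ⟨x₀, hG⟩ := hD q hq hqJ
      exact ⟨x₀, mono hqJ (le_max_right _ _) hG⟩
  · rintro ⟨t, x₀⟩ hq
    obtain ⟨C, hC⟩ := hW.eventually_growthAt h he hQ hJ hJ' (hKJ hq).1 x₀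
    exact ⟨_, nhdsWithin_mono _ hKJ hC, C, fun q hq _ => ⟨x₀, hq⟩⟩

omit [IsManifold (𝓡 3) ∞ M] in
-- The time component of the field is `1`, so the parameter of a curve starting at time zero is the
-- time itself.
theorem fst_of_integralCurve {γ : ℝ → ℝ × M}
    (hγ : IsMIntegralCurveOn (I := 𝓘(ℝ, ℝ).prod (𝓡 3)) γ (nullField f U) (Icc 0 t))
    (h0 : (γ 0).1 = 0) {τ : ℝ} (hτ : τ ∈ Icc 0 t) : (γ τ).1 = τ := by
  have hd : ∀ r ∈ Icc 0 t, HasDerivWithinAt (fun r => (γ r).1 - r) 0 (Icc 0 t) r := fun r hr =>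
    ((hasDerivWithinAt_fst_of_integralCurve hγ hr).sub (hasDerivWithinAt_id r _)).congr_deriv
      (sub_self _)
  have := constant_of_derivWithin_zero (f := fun r => (γ r).1 - r)
    (fun r hr => (hd r hr).differentiableWithinAt)
    (fun r hr => (hd r ⟨hr.1, hr.2.le⟩).derivWithin
      (uniqueDiffOn_Icc (hr.1.trans_lt hr.2) r ⟨hr.1, hr.2.le⟩)) τ hτ
  simp only [h0, sub_zero] at this
  linarith

theorem IsShearNorm.eq_zero_of_reachedAt (hW : IsShearNorm J g U W) (h : IsEvolvingTriple J f g U)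
    (he : Evolves J f g U T) (hQ : QuadCondition J f g U T) (hJ : J.OrdConnected)
    (hJ' : J.Nontrivial) (h0J : 0 ∈ J) (h0 : ∀ x, W 0 x = 0) (ht : t ∈ J) (ht0 : 0 ≤ t) {x : M}
    (hx : x ∈ reachedAt f U t) : W t x = 0 := by
  obtain ⟨γ, hγ, hγ0, hγt⟩ := hx
  have hfst := fun {τ} => fst_of_integralCurve hγ hγ0 (τ := τ)
  have hsJ : ∀ r ∈ Icc 0 t, (γ r).1 ∈ J := fun r hr => by
    rw [hfst hr]; exact hJ.out h0J ht hr
  -- The image of `γ` is compact, which gives a uniform growth constant even if `M` is not compact.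
  obtain ⟨C, hC⟩ := hW.exists_growthAt h he hQ hJ hJ'
    (isCompact_Icc.image_of_continuousOn (continuousOn_of_integralCurve hγ))
    (by rintro _ ⟨r, hr, rfl⟩; exact ⟨hsJ r hr, mem_univ _⟩)
  have : Nonempty M := ⟨x⟩
  choose! x₀ hG using fun r (hr : r ∈ Icc 0 t) => hC (γ r) ⟨r, hr, rfl⟩
  have key := eq_zero_of_hasDerivWithinAt_le (w := fun r => W (γ r).1 (γ r).2) ht0
    (fun r hr => hasDerivWithinAt_comp_of_integralCurve hsJ hγ hr (hG r hr).mem_source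
      (hG r hr).differentiable) (fun r hr => (hG r hr).le)
    (hW.nonneg h hJ hJ' (hsJ t ⟨ht0, le_rfl⟩) _) (by simp only [hγ0, h0])
  simpa [hγt] using key

omit [IsManifold (𝓡 3) ∞ M] in
theorem GrowthAt.continuousWithinAt {C : ℝ} {x₀ : M} {q : ℝ × M} (hG : GrowthAt J f U W C x₀ q) :
    ContinuousWithinAt (fun q : ℝ × M => W q.1 q.2) (J ×ˢ univ) q := by
  have hsrc : (J ×ˢ (univ : Set M)) ∩ {p : ℝ × M | p.2 ∈ (extChartAt (𝓡 3) x₀).source} ∈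
      nhdsWithin q (J ×ˢ univ) :=
    inter_mem_nhdsWithin _ (continuous_snd.continuousAt.preimage_mem_nhds
      ((isOpen_extChartAt_source x₀).mem_nhds hG.mem_source))
  have hcont : ContinuousAt (fun q : ℝ × M => (q.1, extChartAt (𝓡 3) x₀ q.2)) q :=
    continuousAt_fst.prodMk
      (ContinuousAt.comp (x := q) (continuousAt_extChartAt' hG.mem_source) continuousAt_snd)
  have htend : Filter.Tendsto (fun q : ℝ × M => (q.1, extChartAt (𝓡 3) x₀ q.2))
      (nhdsWithin q (J ×ˢ univ))
      (nhdsWithin (q.1, extChartAt (𝓡 3) x₀ q.2) (J ×ˢ (extChartAt (𝓡 3) x₀).target)) := by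
    refine tendsto_nhdsWithin_iff.2 ⟨hcont.tendsto.mono_left nhdsWithin_le_nhds, ?_⟩
    filter_upwards [hsrc] with p hp
    exact ⟨hp.1.1, (extChartAt (𝓡 3) x₀).map_source hp.2⟩
  have h1 := hG.differentiable.continuousWithinAt.tendsto.comp htend
  have e : ∀ p : ℝ × M, p.2 ∈ (extChartAt (𝓡 3) x₀).source →
      chartFun (W p.1) x₀ (extChartAt (𝓡 3) x₀ p.2) = W p.1 p.2 := fun p hp => by
    rw [chartFun, (extChartAt (𝓡 3) x₀).left_inv hp]
  rw [e q hG.mem_source] at h1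
  refine h1.congr' ?_
  filter_upwards [hsrc] with p hp
  exact e p hp.2

/-- The first-order condition at a maximum located at the right endpoint: the one-sided derivative
of `exp(-Cr) w` is nonnegative there. -/
theorem mul_le_of_isMaxOn_exp_mul {w : ℝ → ℝ} {d τ C : ℝ} (hτ : 0 < τ)
    (hd : HasDerivWithinAt w d (Icc 0 τ) τ)
    (hmax : IsMaxOn (fun r => Real.exp (-C * r) * w r) (Icc 0 τ) τ) : C * w τ ≤ d := by
  have h1 : HasDerivAt (fun r => Real.exp (-C * r)) (Real.exp (-C * τ) * (-C)) τ := by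
    simpa using ((hasDerivAt_id τ).const_mul (-C)).exp
  have h2 := hmax.localize.hasFDerivWithinAt_nonpos
    (h1.hasDerivWithinAt.mul hd).hasFDerivWithinAt
    -- The direction `-τ` points from `τ` into the interval; the segment reached is all of `[0, τ]`.
    (mem_posTangentConeAt_of_segment_subset (y := -τ) (by
      rw [add_neg_cancel, segment_symm, segment_eq_Icc hτ.le]))
  simp only [ContinuousLinearMap.toSpanSingleton_apply, smul_eq_mul] at h2
  have h3 : 0 ≤ τ * (Real.exp (-C * τ) * (d - C * w τ)) := by linarith
  have h4 := nonneg_of_mul_nonneg_right h3 hτ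
  have h5 := nonneg_of_mul_nonneg_right h4 (Real.exp_pos _)
  linarith

omit [IsManifold (𝓡 3) ∞ M] in
/-- At a point where `exp (-Dt) W` is maximal along the slice and along the past, the growth rate
of `W` along `∂_t + fU` is at least `D`. -/
theorem GrowthAt.mul_le_of_isMaxOn {C D : ℝ} {x₀ : M} {q : ℝ × M} (hG : GrowthAt J f U W C x₀ q)
    (hJ : J.OrdConnected) (h0J : 0 ∈ J) (hq : q.1 ∈ J) (hq0 : 0 < q.1)
    (hslice : ∀ x, W q.1 x ≤ W q.1 q.2)
    (htime : IsMaxOn (fun r => Real.exp (-D * r) * W r q.2) (Icc 0 q.1) q.1) :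
    D * W q.1 q.2 ≤ C * W q.1 q.2 := by
  have hV := isOpen_extChartAt_target (I := 𝓡 3) x₀
  have hy := (extChartAt (𝓡 3) x₀).map_source hG.mem_source
  have hxy := (extChartAt (𝓡 3) x₀).left_inv hG.mem_source
  -- At a maximum over the slice the part `fU` of the field contributes nothing, so the derivative
  -- along `∂_t + fU` is the time derivative.
  have hsp : spatialDeriv (fun p : ℝ × E3 => chartFun (W p.1) x₀ p.2)
      (J ×ˢ (extChartAt (𝓡 3) x₀).target) (q.1, extChartAt (𝓡 3) x₀ q.2) = 0 := by
    rw [← fderivWithin_slice hV hq hy hG.differentiable, fderivWithin_of_isOpen hV hy]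
    refine IsLocalMax.fderiv_eq_zero (Filter.Eventually.of_forall fun z => ?_)
    simp only [chartFun, hxy]
    exact hslice _
  have htm := hasDerivWithinAt_time hy hG.differentiable
  simp only [chartFun, hxy] at htm
  have h1 := mul_le_of_isMaxOn_exp_mul hq0 (htm.mono (hJ.out h0J hq)) htime
  have h2 := hG.le
  rw [chartNullField, fderivWithin_eq_time_add_spatial, hsp] at h2
  simp only [one_smul, zero_apply, add_zero] at h2
  exact h1.trans h2

/-- Maximum principle for `exp(-(C+1)t) W` on the compact set `[0, t] × M`. At a maximum with
positive time, the growth bound gives `(C+1)W ≤ CW`, so `W ≤ 0`; at time zero `W` vanishes. -/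
theorem IsShearNorm.eq_zero_of_compactSpace [CompactSpace M] (hW : IsShearNorm J g U W)
    (h : IsEvolvingTriple J f g U) (he : Evolves J f g U T) (hQ : QuadCondition J f g U T)
    (hJ : J.OrdConnected) (hJ' : J.Nontrivial) (h0J : 0 ∈ J) (h0 : ∀ x, W 0 x = 0) (ht : t ∈ J)
    (ht0 : 0 ≤ t) (x : M) : W t x = 0 := by
  have hIJ : Icc 0 t ⊆ J := hJ.out h0J ht
  have hK : IsCompact (Icc 0 t ×ˢ (univ : Set M)) := isCompact_Icc.prod isCompact_univ
  have hKJ : Icc 0 t ×ˢ (univ : Set M) ⊆ J ×ˢ univ := prod_mono_left hIJ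
  obtain ⟨C, hC⟩ := hW.exists_growthAt h he hQ hJ hJ' hK hKJ
  have hcont : ContinuousOn (fun q : ℝ × M => Real.exp (-(C + 1) * q.1) * W q.1 q.2)
      (Icc 0 t ×ˢ univ) := by
    refine ContinuousOn.mul (by fun_prop) fun q hq => ?_
    obtain ⟨x₀, hG⟩ := hC q hq
    exact hG.continuousWithinAt.mono hKJ
  obtain ⟨q, hq, hmax⟩ := hK.exists_isMaxOn ⟨(t, x), ⟨ht0, le_rfl⟩, mem_univ _⟩ hcont
  have hWq : W q.1 q.2 ≤ 0 := by
    rcases hq.1.1.eq_or_lt with hq0 | hq0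
    · rw [← hq0, h0]
    · obtain ⟨x₀, hG⟩ := hC q hq
      -- The exponential factor is constant on a slice, so the maximum of the product is also a
      -- maximum of `W` over that slice.
      have := hG.mul_le_of_isMaxOn (D := C + 1) hJ h0J (hIJ hq.1) hq0
        (fun z => le_of_mul_le_mul_left (hmax (a := (q.1, z)) ⟨hq.1, mem_univ _⟩) (Real.exp_pos _))
        (fun r hr => hmax (a := (r, q.2)) ⟨⟨hr.1, hr.2.trans hq.1.2⟩, mem_univ _⟩)
      linarith
  have h1 : Real.exp (-(C + 1) * t) * W t x ≤ Real.exp (-(C + 1) * q.1) * W q.1 q.2 :=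
    hmax (a := (t, x)) ⟨⟨ht0, le_rfl⟩, mem_univ _⟩
  have h2 := h1.trans (mul_nonpos_of_nonneg_of_nonpos (Real.exp_pos _).le hWq)
  exact le_antisymm (nonpos_of_mul_nonpos_right h2 (Real.exp_pos _)) (hW.nonneg h hJ hJ' ht x)

end Propagation

end SlicedSpacetime

end

theorem mainTheorem1 {M : Type*} [TopologicalSpace M] [T2Space M] [SecondCountableTopology M]
    [ChartedSpace E3 M] [IsManifold (𝓡 3) ∞ M]
    (J : Set ℝ) (hJ : J.OrdConnected) (hJ' : J.Nontrivial)
    (f : ℝ → M → ℝ)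
    (g : ℝ → ∀ x : M, TangentSpace (𝓡 3) x →L[ℝ] TangentSpace (𝓡 3) x →L[ℝ] ℝ)
    (U : ℝ → ∀ x : M, TangentSpace (𝓡 3) x)
    (T : ℝ → ∀ x : M, TangentSpace (𝓡 3) x →L[ℝ] TangentSpace (𝓡 3) x →L[ℝ] ℝ)
    (htriple : IsEvolvingTriple J f g U)
    (hevol : Evolves J f g U T) :
    (∀ (γ : ℝ → ℝ × M) (s : Set ℝ), s.OrdConnected → s.Nontrivial →
      (∀ τ ∈ s, (γ τ).1 ∈ J) →
      IsMIntegralCurveOn (I := 𝓘(ℝ, ℝ).prod (𝓡 3)) γ (nullField f U) s →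
      IsNullGeodesicOn J f g γ s) ∧
    (QuadCondition J f g U T → 0 ∈ J →
      IsTangentToConformalFoliationOn (g 0) (U 0) univ →
      ∀ t ∈ J, 0 ≤ t →
        IsTangentToConformalFoliationOn (g t) (U t) (reachedAt f U t) ∧
        (CompactSpace M → IsTangentToConformalFoliationOn (g t) (U t) univ)) := by
  refine ⟨fun γ s hs hs' hsJ hγ => htriple.isNullGeodesicOn hevol hJ hJ' hs hs' hsJ hγ, ?_⟩
  intro hquad h0J hconf t ht ht0
  obtain ⟨W, hW⟩ := htriple.exists_isShearNorm hJ hJ'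
  have h0 : ∀ x, W 0 x = 0 := fun x =>
    hW.eq_zero_of_conformal htriple hJ hJ' h0J hconf (mem_univ x)
  exact ⟨hW.conformal_of_eq_zero htriple hJ hJ' ht fun x hx =>
      hW.eq_zero_of_reachedAt htriple hevol hquad hJ hJ' h0J h0 ht ht0 hx,
    fun _ => hW.conformal_of_eq_zero htriple hJ hJ' ht fun x _ =>
      hW.eq_zero_of_compactSpace htriple hevol hquad hJ hJ' h0J h0 ht ht0 x⟩
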